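/- Let $S$ be a compact connected smooth surface without boundary (Hausdorff, not necessarily orientable), and let $D=\{c_1,\dots,c_n\}$ be a star divisor on $S$: a finite (possibly empty) collection of smooth closed curves, i.e. closed connected embedded one-dimensional submanifolds, which are pairwise transverse and such that around every $p\in S$ there is a smooth chart centred at $p$ in which the curves of $D$ through $p$ are distinct lines through the origin. Let ${}^bTS$ be the $b$-tangent bundle of $(S,D)$, the Lie algebroid whose sections are the smooth vector fields on $S$ tangent to every $c_i$, with the usual Lie bracket and the inclusion as anchor; let ${}^b\Omega^k(S)$ be the sections of $\wedge^k({}^bTS)^*$, with the Lie algebroid differential $d$. A log-symplectic form on $(S,D)$ is a form $\omega\in{}^b\Omega^2(S)$ with $d\omega=0$ for which $\omega^\flat:{}^bTS\to({}^bTS)^*$ is an isomorphism. Two log-symplectic forms $\omega_0,\omega_1$ on $(S,D)$ are called $b$-symplectomorphic if there is a smooth isotopy $\gamma_t:S\to S$, with $\gamma_0=\mathrm{id}$, of diffeomorphisms satisfying $\gamma_t(c_i)=c_i$ for all $t$ and $i$, such that $\gamma_1^*\omega_1=\omega_0$. Then $\omega_0$ and $\omega_1$ are $b$-symplectomorphic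 if and only if both of the following hold: 1. they are cohomologous in the degree-2 Lie algebroid cohomology of ${}^bTS$, i.e. $\omega_1-\omega_0=d\alpha$ for some $\alpha\in{}^b\Omega^1(S)$; 2. they induce the same orientation of ${}^bTS$, i.e. $\omega_0=f\omega_1$ for a positive function $f\in C^\infty(S)$. -/

import Mathlib

open scoped Manifold ContDiff
open VectorField

namespace StarLog

/-- The model plane of a surface. -/
abbrev Plane : Type := EuclideanSpace ℝ (Fin 2)

section Basic

variable (S : Type*) [TopologicalSpace S] [ChartedSpace Plane S]

/-- The ring of smooth real functions on the surface. -/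
abbrev SmoothFn : Type _ := C^∞⟮𝓡 2, S; 𝓘(ℝ, ℝ), ℝ⟯

/-- A star divisor: a finite collection of smooth closed curves (closed connected subsets that are
locally lines in smooth charts) which are pairwise transverse and such that around every point the
curves through that point are, in one smooth chart centred there, distinct lines through the
origin. -/
structure StarDivisor where
  card : ℕ
  curve : Fin card → Set S
  isClosed : ∀ i, IsClosed (curve i)
  isConnected : ∀ i, IsConnected (curve i)
  star_chart : ∀ p : S, ∃ φ ∈ IsManifold.maximalAtlas (𝓡 2) ∞ S, p ∈ φ.source ∧ φ p = 0 ∧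
    ∃ l : Fin card → (Plane →L[ℝ] ℝ),
      (∀ i, p ∈ curve i → l i ≠ 0 ∧ ∀ q ∈ φ.source, q ∈ curve i ↔ l i (φ q) = 0) ∧
      ∀ i j, i ≠ j → p ∈ curve i → p ∈ curve j → LinearIndependent ℝ ![l i, l j]

variable {S}

/-- The tangent space at `p` of a closed submanifold `c`: the tangent vectors that annihilate all
smooth functions vanishing on `c`. -/
def tangentAlong (c : Set S) (p : S) : Set (TangentSpace (𝓡 2) p) :=
  {v | ∀ f : SmoothFn S, (∀ q ∈ c, f q = 0) → mvfderiv (𝓡 2) f p v = 0}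

end Basic

section BTangent

variable {S : Type*} [TopologicalSpace S] [ChartedSpace Plane S] [IsManifold (𝓡 2) ∞ S]

variable (S) in
/-- Smooth vector fields on the surface. -/
abbrev VField : Type _ := Cₛ^∞⟮𝓡 2; Plane, (TangentSpace (𝓡 2) : S → Type _)⟯

/-- Product of a smooth function and a smooth vector field. -/
noncomputable def fsmul (f : SmoothFn S) (X : VField S) : VField S :=
  ⟨fun p => f p • X p, f.contMDiff.smul_section X.contMDiff⟩

/-- The derivative `X f` of a smooth function along a smooth vector field. -/
noncomputable def act (X : VField S) (f : SmoothFn S) : SmoothFn S :=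
  ⟨fun p => mvfderiv (𝓡 2) f p (X p), by
    have h1 : ContMDiff (𝓡 2).tangent (𝓘(ℝ, ℝ)).tangent ∞ (tangentMap (𝓡 2) 𝓘(ℝ, ℝ) f) :=
      f.contMDiff.contMDiff_tangentMap (by simp)
    exact ((contMDiff_snd_tangentBundle_modelSpace ℝ 𝓘(ℝ, ℝ)).comp h1).comp X.contMDiff⟩

lemma act_apply (X : VField S) (f : SmoothFn S) (p : S) :
    act X f p = mvfderiv (𝓡 2) f p (X p) := rfl

lemma isManifold_three : IsManifold (𝓡 2) (minSmoothness ℝ 3) S := by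
  have h : (3 : WithTop ℕ∞) ≤ ∞ := by
    rw [show (3 : WithTop ℕ∞) = ((3 : ℕ∞) : WithTop ℕ∞) from rfl]
    exact WithTop.coe_le_coe.mpr le_top
  simpa using (IsManifold.of_le h : IsManifold (𝓡 2) 3 S)

/-- The Lie bracket of smooth vector fields. -/
noncomputable def vbracket (X Y : VField S) : VField S :=
  ⟨mlieBracket (𝓡 2) X Y, by
    have : IsManifold (𝓡 2) (minSmoothness ℝ 3) S := isManifold_three
    have : IsManifold (𝓡 2) (((⊤ : ℕ∞) : WithTop ℕ∞) + 1) S := by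
      simpa using (inferInstance : IsManifold (𝓡 2) ∞ S)
    exact ContDiff.mlieBracket_vectorField (m := ⊤) (n := ⊤) X.contMDiff Y.contMDiff (by simp)⟩

/-- The bracket acts on functions as the commutator. -/
lemma act_vbracket (X Y : VField S) (f : SmoothFn S) (p : S) :
    act (vbracket X Y) f p = act X (act Y f) p - act Y (act X f) p := by
  have : IsManifold (𝓡 2) (minSmoothness ℝ 3) S := isManifold_three
  have : IsManifold (𝓡 2) (((⊤ : ℕ∞) : WithTop ℕ∞) + 1) S := by
    simpa using (inferInstance : IsManifold (𝓡 2) ∞ S)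
  have h2 : minSmoothness ℝ 2 ≤ ∞ := by
    rw [minSmoothness_of_isRCLikeNormedField,
      show (2 : WithTop ℕ∞) = ((2 : ℕ∞) : WithTop ℕ∞) from rfl]
    exact WithTop.coe_le_coe.mpr le_top
  let CM : (∀ q : S, TangentSpace (𝓡 2) q) → S → Prop := fun Z q =>
    ContMDiffAt (𝓡 2) (𝓡 2).tangent ∞ (fun x => (⟨x, Z x⟩ : TangentBundle (𝓡 2) S)) q
  obtain ⟨v, hv⟩ := exists_ne (0 : Plane)
  let v' : TangentSpace (𝓡 2) p := v
  obtain ⟨s, hs, hW⟩ := FiberBundle.exists_contMDiffOn_extend (k := ∞) (𝓡 2) Plane v'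
  set W := FiberBundle.extend Plane v' with hWdef
  have hWp : W p ≠ 0 := by
    rw [hWdef, FiberBundle.extend_apply_self]; exact hv
  have hev : ∀ᶠ q in nhds p, CM W q := by
    filter_upwards [eventually_mem_nhds_iff.mpr hs] with q hq
    exact (hW q (mem_of_mem_nhds hq)).contMDiffAt hq
  have hWs : CM W p := hev.self_of_nhds
  have hbr : ∀ Z : VField S, CM (mlieBracket (𝓡 2) Z W) p := fun Z =>
    ContMDiffAt.mlieBracket_vectorField (m := ⊤) (n := ⊤) Z.contMDiff.contMDiffAt hWs (by simp)
  have md : ∀ {Z : ∀ q : S, TangentSpace (𝓡 2) q}, CM Z p → MDifferentiableAt (𝓡 2) (𝓡 2).tangent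
        (fun x => (⟨x, Z x⟩ : TangentBundle (𝓡 2) S)) p :=
    fun h => ContMDiffAt.mdifferentiableAt h (by simp)
  have sm : ∀ (g : SmoothFn S) {Z : ∀ q : S, TangentSpace (𝓡 2) q}, CM Z p →
      CM (⇑g • Z) p :=
    fun g Z h => g.contMDiff.contMDiffAt.smul_section h
  have key : ∀ U V : VField S, mlieBracket (𝓡 2) U (mlieBracket (𝓡 2) V (⇑f • W)) p =
      act U (act V f) p • W p + act V f p • mlieBracket (𝓡 2) U W p +
        (act U f p • mlieBracket (𝓡 2) V W p +
          f p • mlieBracket (𝓡 2) U (mlieBracket (𝓡 2) V W) p) := by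
    intro U V
    have e : mlieBracket (𝓡 2) V (⇑f • W) =ᶠ[nhds p]
        (⇑(act V f) • W + ⇑f • mlieBracket (𝓡 2) V W) := by
      filter_upwards [hev] with q hq
      exact mlieBracket_smul_right f.mdifferentiableAt (ContMDiffAt.mdifferentiableAt hq (by simp))
    rw [Filter.EventuallyEq.mlieBracket_vectorField_eq (Filter.EventuallyEq.refl _ (⇑U)) e,
      mlieBracket_add_right (md (sm _ hWs)) (md (sm _ (hbr V))),
      mlieBracket_smul_right (act V f).mdifferentiableAt (md hWs),
      mlieBracket_smul_right f.mdifferentiableAt (md (hbr V))]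
    rfl
  have c2 : ∀ {Z : ∀ q : S, TangentSpace (𝓡 2) q}, CM Z p →
      ContMDiffAt (𝓡 2) (𝓡 2).tangent (minSmoothness ℝ 2)
        (fun x => (⟨x, Z x⟩ : TangentBundle (𝓡 2) S)) p := fun h => ContMDiffAt.of_le h h2
  have J1 := leibniz_identity_mlieBracket_apply (c2 X.contMDiff.contMDiffAt)
    (c2 Y.contMDiff.contMDiffAt) (c2 hWs)
  have J2 := leibniz_identity_mlieBracket_apply (c2 X.contMDiff.contMDiffAt)
    (c2 Y.contMDiff.contMDiffAt) (c2 (sm f hWs))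
  have e3 : mlieBracket (𝓡 2) (mlieBracket (𝓡 2) X Y) (⇑f • W) p =
      act (vbracket X Y) f p • W p +
        f p • mlieBracket (𝓡 2) (mlieBracket (𝓡 2) X Y) W p :=
    mlieBracket_smul_right f.mdifferentiableAt (md hWs)
  rw [key X Y, key Y X, e3, J1] at J2
  have : (act (vbracket X Y) f p - (act X (act Y f) p - act Y (act X f) p)) • W p = 0 := by
    rw [sub_smul, sub_smul]
    rw [smul_add] at J2
    rw [← sub_eq_zero] at J2
    rw [← neg_eq_zero, ← J2]
    abel
  rcases smul_eq_zero.mp this with h | h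
  · exact sub_eq_zero.mp h
  · exact absurd h hWp

variable (D : StarDivisor S)

/-- Sections of the `b`-tangent bundle: the smooth vector fields tangent to every curve of the
divisor. -/
noncomputable def BField : Submodule ℝ (VField S) where
  carrier := {X | ∀ i, ∀ p ∈ D.curve i, X p ∈ tangentAlong (D.curve i) p}
  add_mem' := by
    intro X Y hX hY i p hp f hf
    have h1 := hX i p hp f hf
    have h2 := hY i p hp f hf
    simp [h1, h2]
  zero_mem' := by
    intro i p hp f hf
    simp
  smul_mem' := by
    intro c X hX i p hp f hf
    have h1 := hX i p hp f hf
    simp [h1]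

variable {D}

/-- The sections of the `b`-tangent bundle form a module over the smooth functions. -/
noncomputable instance : Module (SmoothFn S) (BField D) where
  smul f X := ⟨fsmul f X.1, fun i p hp g hg => by
    have h1 := X.2 i p hp g hg
    change mvfderiv (𝓡 2) g p (f p • X.1 p) = 0
    rw [map_smul, h1, smul_zero]⟩
  one_smul X := by
    ext p : 2
    exact one_smul ℝ (X.1 p)
  mul_smul f g X := by
    ext p : 2
    exact mul_smul (f p) (g p) (X.1 p)
  smul_zero f := by
    ext p : 2
    exact smul_zero (f p)
  smul_add f X Y := by
    ext p : 2
    exact smul_add (f p) (X.1 p) (Y.1 p)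
  add_smul f g X := by
    ext p : 2
    exact add_smul (f p) (g p) (X.1 p)
  zero_smul X := by
    ext p : 2
    exact zero_smul ℝ (X.1 p)

/-- The Lie algebroid bracket on sections of the `b`-tangent bundle. -/
noncomputable def bbracket (X Y : BField D) : BField D :=
  ⟨vbracket X.1 Y.1, fun i p hp f hf => by
    have h := act_vbracket X.1 Y.1 f p
    have hX : act X.1 (act Y.1 f) p = 0 :=
      X.2 i p hp (act Y.1 f) fun q hq => Y.2 i q hq f hf
    have hY : act Y.1 (act X.1 f) p = 0 :=
      Y.2 i p hp (act X.1 f) fun q hq => X.2 i q hq f hf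
    rw [hX, hY, sub_zero] at h
    exact h⟩

variable (D)

/-- Smooth sections of the dual of the `b`-tangent bundle. -/
abbrev BOneForm : Type _ := BField D →ₗ[SmoothFn S] SmoothFn S

/-- Smooth sections of the second tensor power of the dual of the `b`-tangent bundle; the
`b`-forms of degree two are those that are alternating. -/
abbrev BBilin : Type _ := BField D →ₗ[SmoothFn S] BField D →ₗ[SmoothFn S] SmoothFn S

variable {D}

/-- The Lie algebroid differential of a `b`-form of degree one. -/
noncomputable def bdOne (α : BOneForm D) (X Y : BField D) : SmoothFn S :=
  act X.1 (α Y) - act Y.1 (α X) - α (bbracket X Y)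

/-- The Lie algebroid differential of a `b`-form of degree two. -/
noncomputable def bdTwo (η : BBilin D) (X Y Z : BField D) : SmoothFn S :=
  act X.1 (η Y Z) - act Y.1 (η X Z) + act Z.1 (η X Y)
    - η (bbracket X Y) Z + η (bbracket X Z) Y - η (bbracket Y Z) X

variable (D) in
/-- A star log symplectic form: a closed `b`-form of degree two that is nondegenerate, i.e. the
induced map from the `b`-tangent bundle to its dual is an isomorphism. -/
structure LogSymplecticForm where
  form : BBilin D
  alt : ∀ X, form X X = 0
  closed : ∀ X Y Z, bdTwo form X Y Z = 0
  nondegenerate : Function.Bijective form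

/-- Equality of classes in the Lie algebroid cohomology of degree two. -/
def Cohomologous (ω₀ ω₁ : LogSymplecticForm D) : Prop :=
  ∃ α : BOneForm D, ∀ X Y, ω₁.form X Y - ω₀.form X Y = bdOne α X Y

/-- The two forms induce the same orientation of the `b`-tangent bundle. -/
def SameOrientation (ω₀ ω₁ : LogSymplecticForm D) : Prop :=
  ∃ f : SmoothFn S, (∀ p, 0 < f p) ∧ ω₀.form = f • ω₁.form

variable (D) in
/-- A `b`-diffeomorphism: a diffeomorphism of the surface mapping each curve of the divisor onto
itself. -/
structure BDiffeo where
  toDiffeo : S ≃ₘ⟮𝓡 2, 𝓡 2⟯ S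
  image_curve : ∀ i, toDiffeo '' D.curve i = D.curve i

/-- Push-forward of a section of the `b`-tangent bundle by a `b`-diffeomorphism `φ`; its value at
`q` is the image of `X (φ⁻¹ q)` under the derivative of `φ`. -/
noncomputable def BDiffeo.push (φ : BDiffeo D) (X : BField D) : BField D :=
  ⟨⟨fun q => mfderiv (𝓡 2) (𝓡 2) φ.toDiffeo (φ.toDiffeo.symm q) (X.1 (φ.toDiffeo.symm q)), by
    have h1 : ContMDiff (𝓡 2).tangent (𝓡 2).tangent ∞ (tangentMap (𝓡 2) (𝓡 2) φ.toDiffeo) :=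
      φ.toDiffeo.contMDiff.contMDiff_tangentMap (by simp)
    have h2 := (h1.comp X.1.contMDiff).comp φ.toDiffeo.symm.contMDiff
    refine h2.congr fun q => ?_
    have e : φ.toDiffeo (φ.toDiffeo.symm q) = q := φ.toDiffeo.apply_symm_apply q
    exact Bundle.TotalSpace.ext e.symm HEq.rfl⟩, by
    intro i q hq f hf
    have hp : φ.toDiffeo.symm q ∈ D.curve i := by
      obtain ⟨r, hr, rfl⟩ := (φ.image_curve i).symm ▸ hq
      simpa using hr
    have h := X.2 i _ hp (f.comp ⟨φ.toDiffeo, φ.toDiffeo.contMDiff⟩) fun r hr =>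
      hf _ ((φ.image_curve i) ▸ Set.mem_image_of_mem _ hr)
    have e : φ.toDiffeo (φ.toDiffeo.symm q) = q := φ.toDiffeo.apply_symm_apply q
    have hc := mvfderiv_comp_apply_of_eq (I := 𝓡 2) (φ.toDiffeo.symm q)
      (f.mdifferentiableAt (x := q))
      (φ.toDiffeo.contMDiff.mdifferentiable (by simp) (φ.toDiffeo.symm q)) e
      (X.1 (φ.toDiffeo.symm q))
    exact hc.symm.trans h⟩

/-- Pull-back of a `b`-form of degree two by a `b`-diffeomorphism. -/
noncomputable def BDiffeo.pull (φ : BDiffeo D) (η : BBilin D) (X Y : BField D) : SmoothFn S :=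
  (η (φ.push X) (φ.push Y)).comp ⟨φ.toDiffeo, φ.toDiffeo.contMDiff⟩

variable (D) in
/-- A smooth isotopy of `b`-diffeomorphisms starting at the identity. -/
structure BIsotopy where
  at_time : ℝ → BDiffeo D
  smooth : ContMDiff (𝓘(ℝ, ℝ).prod (𝓡 2)) (𝓡 2) ∞
    fun z : ℝ × S => (at_time z.1).toDiffeo z.2
  start : ∀ p, (at_time 0).toDiffeo p = p

/-- Two star log symplectic forms are `b`-symplectomorphic if the end of an isotopy of
`b`-diffeomorphisms, starting at the identity, pulls one back to the other. -/
def BSymplectomorphic (ω₀ ω₁ : LogSymplecticForm D) : Prop :=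
  ∃ γ : BIsotopy D, ∀ X Y, (γ.at_time 1).pull ω₁.form X Y = ω₀.form X Y

end BTangent
end StarLog

/-! Sufficiency is Moser's argument. Let ω₁ - ω₀ = dα and ω₀ = fω₁ with f > 0, and let τ be a smooth
step from 0 to 1. Then ω_t = (1-τ)ω₀ + τω₁ is the positive multiple ((1-τ)f + τ)ω₁ of ω₁.
Nondegeneracy gives a section v of the b-tangent bundle with ι_v ω₁ = α, and h = -τ'/((1-τ)f + τ)
makes ι_{hv} ω_t = -τ'α. The flow γ_t of hv preserves the curves because v is tangent to them, and
by Cartan's formula γ_t^*ω_t does not depend on t (`bSymplectomorphic_of_cohomologous`).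

Conversely, let γ_1^*ω₁ = ω₀ and let V_t be the velocity of γ. Integrating Cartan's formula gives ω₀
- ω₁ = d∫₀¹ γ_t^*(ι_{V_t} ω₁) dt. Off the divisor γ_t^*ω₁ never vanishes, so its sign is constant in
t, which gives the orientation.

Forms are handled through their values on sections. Off the divisor, a dense open set, a b-form of
degree two is locally a db ∧ dc, so identities are checked there and extended by continuity; in
particular any two such forms are proportional (`IsAreaLike.mul_eq_mul`). The divisor itself matters
in three places: nonvanishing of a log symplectic form on it (`StarChart.exists_dlog`), invariance
of the curves under the flow (`mem_curve_of_mem_curve`), and smoothness in t of γ_t^*(ι_{V_t} ω₁)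
across it (`BIsotopy.contMDiff_pullOne_velocity`). All three rest on Hadamard division by the
equations of the curves.

The analytic input is smooth dependence of flows on initial values and smoothness of parametric
integrals. Both come from smoothness of y ↦ f ∘ y on spaces of continuous maps, the former through
the implicit function theorem. -/

/-! ### Superposition operators on spaces of continuous maps. -/

section Nemytskii
open scoped Topology

universe u
variable {K : Type*} [TopologicalSpace K] [CompactSpace K]
variable {E F : Type u} [NormedAddCommGroup E] [NormedSpace ℝ E] [NormedAddCommGroup F]
  [NormedSpace ℝ F]

/-- Pointwise application of a continuous family of continuous linear maps. -/
noncomputable def ContinuousMap.applyCLM (K : Type*) [TopologicalSpace K] [CompactSpace K]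
    (E F : Type u) [NormedAddCommGroup E] [NormedSpace ℝ E] [NormedAddCommGroup F]
    [NormedSpace ℝ F] : C(K, E →L[ℝ] F) →L[ℝ] C(K, E) →L[ℝ] C(K, F) :=
  LinearMap.mkContinuous₂
    (LinearMap.mk₂ ℝ (fun (A : C(K, E →L[ℝ] F)) (h : C(K, E)) => (⟨fun k => A k (h k), by fun_prop⟩ : C(K, F)))
      (fun A B h => by ext; simp) (fun c A h => by ext; simp)
      (fun A h g => by ext; simp) (fun c A h => by ext; simp)) 1 (by
    intro A h
    rw [ContinuousMap.norm_le _ (by positivity)]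
    intro k
    rw [one_mul]
    exact ((A k).le_opNorm (h k)).trans
      (mul_le_mul (A.norm_coe_le_norm k) (h.norm_coe_le_norm k) (norm_nonneg _) (norm_nonneg A)))

/-- The pointwise mean value inequality is uniform in k because y ↦ f' ∘ y is continuous for the sup
norm. -/
lemma ContinuousMap.hasFDerivAt_postcomp {f : E → F} (hf : ContDiff ℝ 1 f) (y : C(K, E)) :
    HasFDerivAt (fun y : C(K, E) => (⟨f, hf.continuous⟩ : C(E, F)).comp y)
      (ContinuousMap.applyCLM K E F
        ((⟨fderiv ℝ f, hf.continuous_fderiv one_ne_zero⟩ : C(E, E →L[ℝ] F)).comp y)) y := by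
  rw [hasFDerivAt_iff_isLittleO_nhds_zero, Asymptotics.isLittleO_iff]
  intro ε hε
  have hc : Continuous fun y : C(K, E) =>
      (⟨fderiv ℝ f, hf.continuous_fderiv one_ne_zero⟩ : C(E, E →L[ℝ] F)).comp y :=
    ContinuousMap.continuous_postcomp _
  obtain ⟨δ, hδ, H⟩ := (Metric.continuous_iff (α := C(K, E)) (β := C(K, E →L[ℝ] F))).1 hc y ε hε
  filter_upwards [Metric.ball_mem_nhds (0 : C(K, E)) hδ] with h hh
  rw [mem_ball_zero_iff] at hh
  rw [ContinuousMap.norm_le _ (by positivity)]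
  intro k
  have hb : ∀ z ∈ Metric.ball (y k) δ, ‖fderiv ℝ f z - fderiv ℝ f (y k)‖ ≤ ε := by
    intro z hz
    have hK : Nonempty K := ⟨k⟩
    -- Perturbing y by the constant z - y k turns sup-norm continuity into a bound at the point z,
    -- with δ independent of k.
    have := H (y + ContinuousMap.const K (z - y k)) (by
      rw [dist_eq_norm, add_sub_cancel_left]
      refine (ContinuousMap.norm_lt_iff _ hδ).2 fun j => ?_
      simpa [dist_eq_norm] using hz)
    have h2 := (ContinuousMap.dist_apply_le_dist k).trans this.le
    simpa [dist_eq_norm] using h2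
  have := (convex_ball (y k) δ).norm_image_sub_le_of_norm_hasFDerivWithin_le' (f := f)
    (f' := fderiv ℝ f) (φ := fderiv ℝ f (y k)) (C := ε)
    (fun z _ => (hf.differentiable one_ne_zero z).hasFDerivAt.hasFDerivWithinAt) hb
    (Metric.mem_ball_self hδ) (y := y k + h k)
    (by simpa [dist_eq_norm] using (h.norm_coe_le_norm k).trans_lt hh)
  rw [add_sub_cancel_left] at this
  exact this.trans (mul_le_mul_of_nonneg_left (h.norm_coe_le_norm k) hε.le)

/-- The derivative is a continuous linear map applied to postcomposition with f', so the induction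
replaces f by f'. The target F must vary, and E and F share a universe so that it can become E →L[ℝ]
F. -/
lemma ContinuousMap.contDiff_postcomp_nat (n : ℕ) : ∀ {F : Type u} [NormedAddCommGroup F]
    [NormedSpace ℝ F] {f : E → F} (hf : ContDiff ℝ n f),
    ContDiff ℝ n (fun y : C(K, E) => (⟨f, hf.continuous⟩ : C(E, F)).comp y) := by
  induction n with
  | zero =>
    intro F _ _ f hf
    exact contDiff_zero.2 (ContinuousMap.continuous_postcomp _)
  | succ n ih =>
    intro F _ _ f hf
    have h1 : ContDiff ℝ 1 f := hf.of_le (by exact_mod_cast Nat.le_add_left 1 n)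
    have h2 : ContDiff ℝ n (fderiv ℝ f) := by
      have := hf
      push_cast at this
      exact (contDiff_succ_iff_fderiv.1 this).2.2
    push_cast
    rw [contDiff_succ_iff_hasFDerivAt]
    refine ⟨fun y => ContinuousMap.applyCLM K E F ((⟨fderiv ℝ f, h2.continuous⟩ :
      C(E, E →L[ℝ] F)).comp y), ?_, fun y => ContinuousMap.hasFDerivAt_postcomp h1 y⟩
    exact (ContinuousMap.applyCLM K E F).contDiff.comp (ih h2)

/-- Composition with a `C^n` map is a `C^n` operation on continuous maps. -/
lemma ContinuousMap.contDiff_postcomp {n : ℕ∞} {f : E → F} (hf : ContDiff ℝ n f) :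
    ContDiff ℝ n (fun y : C(K, E) => (⟨f, hf.continuous⟩ : C(E, F)).comp y) :=
  contDiff_iff_forall_nat_le.2 fun _ hm =>
    ContinuousMap.contDiff_postcomp_nat _ (hf.of_le (by exact_mod_cast hm))

end Nemytskii

/-! ### Integrals depending on parameters. -/

section ParametricIntegral
open scoped Topology unitInterval

universe u
variable {E F : Type u} [NormedAddCommGroup E] [NormedSpace ℝ E] [NormedAddCommGroup F]
  [NormedSpace ℝ F]

/-- The constant maps, as a continuous linear map. -/
noncomputable def ContinuousMap.constCLM (K : Type*) [TopologicalSpace K] [CompactSpace K]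
    (E : Type*) [NormedAddCommGroup E] [NormedSpace ℝ E] : E →L[ℝ] C(K, E) :=
  LinearMap.mkContinuous
    { toFun := ContinuousMap.const K
      map_add' := fun _ _ => rfl
      map_smul' := fun _ _ => rfl } 1 (by
    intro x
    rw [ContinuousMap.norm_le _ (by positivity)]
    intro k
    exact (one_mul ‖x‖).ge)

lemma ContinuousMap.constCLM_apply {K : Type*} [TopologicalSpace K] [CompactSpace K] (x : E) :
    ContinuousMap.constCLM K E x = ContinuousMap.const K x := rfl

/-- The primitive vanishing at zero of a continuous map on the unit interval. -/
noncomputable def ContinuousMap.primitiveCLM (E : Type*) [NormedAddCommGroup E]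
    [NormedSpace ℝ E] : C(I, E) →L[ℝ] C(I, E) :=
  LinearMap.mkContinuous
    { toFun := fun y => ⟨fun s => ∫ u in (0 : ℝ)..s, y (Set.projIcc 0 1 zero_le_one u), by
        have : Continuous fun s : ℝ => ∫ u in (0 : ℝ)..s, y (Set.projIcc 0 1 zero_le_one u) :=
          intervalIntegral.continuous_primitive
            (fun a b => (y.continuous.comp continuous_projIcc).intervalIntegrable a b) 0
        exact this.comp continuous_subtype_val⟩
      map_add' := fun y z => by
        ext s
        exact intervalIntegral.integral_add
          ((y.continuous.comp continuous_projIcc).intervalIntegrable _ _)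
          ((z.continuous.comp continuous_projIcc).intervalIntegrable _ _)
      map_smul' := fun c y => by
        ext s
        exact intervalIntegral.integral_smul c _ } 1 (by
    intro y
    rw [ContinuousMap.norm_le _ (by positivity)]
    intro s
    refine (intervalIntegral.norm_integral_le_of_norm_le_const (C := ‖y‖)
      fun u _ => y.norm_coe_le_norm _).trans ?_
    rw [one_mul, sub_zero, abs_of_nonneg s.2.1]
    exact mul_le_of_le_one_right (norm_nonneg _) s.2.2)

lemma ContinuousMap.primitiveCLM_apply (y : C(I, E)) (s : I) :
    ContinuousMap.primitiveCLM E y s = ∫ u in (0 : ℝ)..s, y (Set.projIcc 0 1 zero_le_one u) := rfl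

lemma ContinuousMap.integral_projIcc_eq {y : C(I, E)} {z : ℝ → E} (h : ∀ s : I, y s = z s) :
    ContinuousMap.primitiveCLM E y 1 = ∫ u in (0 : ℝ)..1, z u := by
  rw [ContinuousMap.primitiveCLM_apply]
  refine intervalIntegral.integral_congr fun u hu => ?_
  rw [Set.Icc.coe_one, Set.uIcc_of_le zero_le_one] at hu
  rw [h, Set.projIcc_of_mem _ hu]

/-- The vertical segment over `x`, as a continuous map. -/
noncomputable def unitSegment (x : E) : C(I, ℝ × E) := ⟨fun s => (s, x), by fun_prop⟩

lemma hasFDerivAt_unitSegment (x : E) : HasFDerivAt (unitSegment (E := E))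
    ((ContinuousMap.constCLM I (ℝ × E)).comp (ContinuousLinearMap.inr ℝ ℝ E)) x := by
  have : (unitSegment (E := E)) = fun x => unitSegment 0 +
      (ContinuousMap.constCLM I (ℝ × E)).comp (ContinuousLinearMap.inr ℝ ℝ E) x := by
    ext x s <;> simp [unitSegment, ContinuousMap.constCLM_apply]
  rw [this]
  exact (ContinuousLinearMap.hasFDerivAt _).const_add _

lemma contDiff_unitSegment {n : WithTop ℕ∞} : ContDiff ℝ n (unitSegment (E := E)) := by
  have : (unitSegment (E := E)) = fun x => unitSegment 0 +
      (ContinuousMap.constCLM I (ℝ × E)).comp (ContinuousLinearMap.inr ℝ ℝ E) x := by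
    ext x s <;> simp [unitSegment, ContinuousMap.constCLM_apply]
  rw [this]
  exact contDiff_const.add (ContinuousLinearMap.contDiff _)

-- Factors the integral as an affine map into C(I, ℝ × E), a superposition operator, and a
-- continuous linear map; only the middle factor is nonlinear.
set_option linter.unusedSectionVars false in
lemma integral_eq_primitiveCLM_unitSegment {g : ℝ × E → F} (hg : Continuous g) (x : E) :
    ∫ t in (0 : ℝ)..1, g (t, x) =
      ContinuousMap.primitiveCLM F ((⟨g, hg⟩ : C(ℝ × E, F)).comp (unitSegment x)) 1 :=
  (ContinuousMap.integral_projIcc_eq (z := fun t => g (t, x)) fun _ => rfl).symm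

/-- The integral of a `C^n` function over a compact interval depends in a `C^n` way on
parameters. -/
lemma ContDiff.unitInterval_integral {n : ℕ∞} {g : ℝ × E → F} (hg : ContDiff ℝ n g) :
    ContDiff ℝ n fun x => ∫ t in (0 : ℝ)..1, g (t, x) := by
  simp_rw [integral_eq_primitiveCLM_unitSegment hg.continuous]
  exact ((ContinuousMap.evalCLM ℝ (1 : I)).comp (ContinuousMap.primitiveCLM F)).contDiff.comp
    ((ContinuousMap.contDiff_postcomp hg).comp contDiff_unitSegment)

/-- The chain rule for the same factorisation; the integral is continuous linear, so it commutes
with the derivative. -/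
lemma ContDiff.fderiv_unitInterval_integral {g : ℝ × E → F} (hg : ContDiff ℝ 1 g) (x v : E) :
    fderiv ℝ (fun x => ∫ t in (0 : ℝ)..1, g (t, x)) x v =
      ∫ t in (0 : ℝ)..1, fderiv ℝ g (t, x) (0, v) := by
  have h1 := ((ContinuousMap.evalCLM ℝ (1 : I)).comp
    (ContinuousMap.primitiveCLM F)).hasFDerivAt.comp x
      ((ContinuousMap.hasFDerivAt_postcomp hg (unitSegment x)).comp x (hasFDerivAt_unitSegment x))
  have h2 : HasFDerivAt (fun x => ∫ t in (0 : ℝ)..1, g (t, x))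
      (((ContinuousMap.evalCLM ℝ (1 : I)).comp (ContinuousMap.primitiveCLM F)).comp
        ((ContinuousMap.applyCLM I (ℝ × E) F ((⟨fderiv ℝ g,
          hg.continuous_fderiv one_ne_zero⟩ : C(ℝ × E, ℝ × E →L[ℝ] F)).comp (unitSegment x))).comp
          ((ContinuousMap.constCLM I (ℝ × E)).comp (ContinuousLinearMap.inr ℝ ℝ E)))) x := by
    simp_rw [integral_eq_primitiveCLM_unitSegment hg.continuous]
    exact h1
  rw [h2.fderiv]
  exact ContinuousMap.integral_projIcc_eq fun _ => rfl

end ParametricIntegral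

/-! ### Hadamard division by linear equations. -/

section Hadamard
open scoped Topology unitInterval

variable {E : Type} [NormedAddCommGroup E] [NormedSpace ℝ E]

/-- Hadamard's lemma: a smooth function vanishing on a hyperplane is divisible by its equation. -/
lemma exists_contDiff_eq_mul_of_eq_zero {f : E → ℝ} (hf : ContDiff ℝ ∞ f) {l : E →L[ℝ] ℝ}
    (hl : l ≠ 0) (h : ∀ x, l x = 0 → f x = 0) :
    ∃ g : E → ℝ, ContDiff ℝ ∞ g ∧ ∀ x, f x = l x * g x := by
  obtain ⟨w, hw⟩ : ∃ w, l w = 1 := by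
    obtain ⟨w, hw⟩ : ∃ w, l w ≠ 0 := by
      by_contra! H
      exact hl (by ext x; simpa using H x)
    exact ⟨(l w)⁻¹ • w, by simp [hw]⟩
  -- A segment in the direction w, from the projection of x onto ker l at time 0 to x at time 1; its
  -- velocity is l x • w, which produces the factor l x.
  let q : ℝ × E → E := fun z => z.2 - ((1 - z.1) * l z.2) • w
  have hq : ContDiff ℝ ∞ q := by fun_prop
  have hf' : ContDiff ℝ ∞ (fderiv ℝ f) := hf.fderiv_right (by simp)
  have hG : ContDiff ℝ ∞ fun z : ℝ × E => fderiv ℝ f (q z) w :=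
    (hf'.comp hq).clm_apply contDiff_const
  refine ⟨fun x => ∫ t in (0 : ℝ)..1, fderiv ℝ f (q (t, x)) w,
    ContDiff.unitInterval_integral (n := ⊤) hG, fun x => ?_⟩
  have hd : ∀ t ∈ Set.uIcc (0 : ℝ) 1, HasDerivAt (fun t => f (q (t, x)))
      (l x * fderiv ℝ f (q (t, x)) w) t := by
    intro t _
    have h1 : HasDerivAt (fun t => q (t, x)) (l x • w) t := by
      have : HasDerivAt (fun t : ℝ => (1 - t) * l x) (-1 * l x) t :=
        ((hasDerivAt_id t).const_sub 1).mul_const _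
      simpa [q] using (this.smul_const w).const_sub x
    have h2 := ((hf.differentiable (by simp)) (q (t, x))).hasFDerivAt.comp_hasDerivAt t h1
    rw [map_smul, smul_eq_mul] at h2
    exact h2
  have := intervalIntegral.integral_eq_sub_of_hasDerivAt hd
    ((continuous_const.mul (hG.continuous.comp (by fun_prop :
      Continuous fun t : ℝ => (t, x)))).intervalIntegrable 0 1)
  rw [intervalIntegral.integral_const_mul] at this
  rw [this, h (q (0, x)) (by simp [q, hw])]
  simp [q]

/-- A smooth function vanishing on finitely many distinct hyperplanes is divisible by the product
of their equations. -/
lemma exists_contDiff_eq_prod_mul_of_eq_zero {ι : Type*} (s : Finset ι) (l : ι → E →L[ℝ] ℝ)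
    (hl : ∀ i ∈ s, l i ≠ 0)
    (hind : ∀ i ∈ s, ∀ j ∈ s, i ≠ j → ∃ w, l i w = 0 ∧ l j w = 1)
    {f : E → ℝ} (hf : ContDiff ℝ ∞ f) (h : ∀ i ∈ s, ∀ x, l i x = 0 → f x = 0) :
    ∃ g : E → ℝ, ContDiff ℝ ∞ g ∧ ∀ x, f x = (∏ i ∈ s, l i x) * g x := by
  classical
  induction s using Finset.induction_on generalizing f with
  | empty => exact ⟨f, hf, fun x => by simp⟩
  | insert i s hi ih =>
    obtain ⟨g, hg, hfg⟩ := exists_contDiff_eq_mul_of_eq_zero hf (hl i (Finset.mem_insert_self _ _))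
      (h i (Finset.mem_insert_self _ _))
    obtain ⟨k, hk, hgk⟩ := ih (fun j hj => hl j (Finset.mem_insert_of_mem hj))
      (fun a ha b hb => hind a (Finset.mem_insert_of_mem ha) b (Finset.mem_insert_of_mem hb))
      hg (by
        intro j hj x hx
        obtain ⟨w, hw0, hw1⟩ := hind j (Finset.mem_insert_of_mem hj) i
          (Finset.mem_insert_self _ _) (fun e => hi (e ▸ hj))
        -- Moving along w stays in ker (l j) and leaves ker (l i) for all ε but one, so g vanishes
        -- there and, by continuity, at ε = 0.
        have hz : ∀ ε : ℝ, l i x + ε ≠ 0 → g (x + ε • w) = 0 := by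
          intro ε hε
          have h1 := hfg (x + ε • w)
          rw [h j (Finset.mem_insert_of_mem hj) _ (by simp [hx, hw0])] at h1
          have h2 : l i (x + ε • w) ≠ 0 := by simpa [hw1] using hε
          exact (mul_eq_zero.1 h1.symm).resolve_left h2
        have hcont : Continuous fun ε : ℝ => g (x + ε • w) := hg.continuous.comp (by fun_prop)
        have hd : Dense {ε : ℝ | ε ≠ -l i x} := dense_compl_singleton _
        have := hcont.ext_on hd (continuous_const (y := (0 : ℝ))) fun ε hε =>
          hz ε fun e => hε (by linarith)
        simpa using congrFun this 0)
    exact ⟨k, hk, fun x => by rw [hfg, hgk, Finset.prod_insert hi, mul_assoc]⟩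

end Hadamard

/-! ### Local flows in a Banach space by the implicit function theorem. -/

section LocalFlow
open scoped Topology unitInterval

universe u
variable {E : Type u} [NormedAddCommGroup E] [NormedSpace ℝ E]

/-- The defect of a curve on the unit interval from solving the integral equation of
the time-rescaled flow with given initial value and duration. -/
noncomputable def flowDefect (f : C(E, E)) (z : (E × ℝ) × C(I, E)) : C(I, E) :=
  z.2 - ContinuousMap.constCLM I E z.1.1 - z.1.2 • ContinuousMap.primitiveCLM E (f.comp z.2)

lemma contDiff_flowDefect {n : ℕ∞} {f : E → E} (hf : ContDiff ℝ n f) :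
    ContDiff ℝ n (flowDefect ⟨f, hf.continuous⟩) := by
  have h1 : ContDiff ℝ n fun z : (E × ℝ) × C(I, E) => ContinuousMap.primitiveCLM E
      ((⟨f, hf.continuous⟩ : C(E, E)).comp z.2) :=
    (ContinuousMap.primitiveCLM E).contDiff.comp
      ((ContinuousMap.contDiff_postcomp hf).comp contDiff_snd)
  exact (contDiff_snd.sub ((ContinuousMap.constCLM I E).contDiff.comp
    (contDiff_fst.comp contDiff_fst))).sub ((contDiff_snd.comp contDiff_fst).smul h1)

lemma flowDefect_eq_zero_iff (f : C(E, E)) (x : E) (t : ℝ) (y : C(I, E)) :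
    flowDefect f ((x, t), y) = 0 ↔
      ∀ s : I, y s = x + t • ∫ u in (0 : ℝ)..s, f (y (Set.projIcc 0 1 zero_le_one u)) := by
  rw [ContinuousMap.ext_iff]
  refine forall_congr' fun s => ?_
  have : flowDefect f ((x, t), y) s = y s - x -
      t • ∫ u in (0 : ℝ)..s, f (y (Set.projIcc 0 1 zero_le_one u)) := rfl
  rw [this, ContinuousMap.zero_apply, sub_sub, sub_eq_zero]

/-- An initial piece of a solution, run at speed r, solves the equation of duration r * t. This
relates the implicit function at different durations. -/
lemma flowDefect_rescale {f : C(E, E)} {x : E} {t : ℝ} {y : C(I, E)}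
    (h : flowDefect f ((x, t), y) = 0) (r : I) :
    flowDefect f ((x, r * t), y.comp ⟨fun s => r * s, by fun_prop⟩) = 0 := by
  rw [flowDefect_eq_zero_iff] at h ⊢
  intro s
  simp only [ContinuousMap.comp_apply, ContinuousMap.coe_mk]
  rw [h, mul_comm (r : ℝ) t, mul_smul]
  congr 2
  have h1 := intervalIntegral.smul_integral_comp_mul_left (a := (0 : ℝ)) (b := s)
    (fun u => f (y (Set.projIcc 0 1 zero_le_one u))) (r : ℝ)
  rw [mul_zero] at h1
  rw [Set.Icc.coe_mul, ← h1]
  congr 1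
  refine intervalIntegral.integral_congr fun u hu => ?_
  rw [Set.uIcc_of_le s.2.1] at hu
  have hu1 : u ∈ I := ⟨hu.1, hu.2.trans s.2.2⟩
  have hu2 : (r : ℝ) * u ∈ I := unitInterval.mul_mem r.2 hu1
  simp only [Set.projIcc_of_mem _ hu1, Set.projIcc_of_mem _ hu2]
  rfl

variable [CompleteSpace E]

/-- A `C^n` vector field has a local flow that is `C^n` in time and initial value. -/
lemma exists_contDiffAt_localFlow_of_contDiff {n : ℕ} (hn : n ≠ 0) {f : E → E}
    (hf : ContDiff ℝ n f) (x₀ : E) :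
    ∃ Φ : ℝ × E → E, ContDiffAt ℝ n Φ (0, x₀) ∧ (∀ᶠ x in 𝓝 x₀, Φ (0, x) = x) ∧
      ∀ᶠ z in 𝓝 ((0 : ℝ), x₀), HasDerivAt (fun t => Φ (t, z.2)) (f (Φ z)) z.1 := by
  set fc : C(E, E) := ⟨f, hf.continuous⟩ with hfc
  set y₀ : C(I, E) := ContinuousMap.constCLM I E x₀ with hy₀
  set u₀ : (E × ℝ) × C(I, E) := ((x₀, 0), y₀) with hu₀
  have hF : ContDiff ℝ n (flowDefect fc) := contDiff_flowDefect (n := (n : ℕ∞)) hf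
  have hF0 : flowDefect fc u₀ = 0 := by simp [flowDefect, hu₀, hy₀]
  have hn' : (n : WithTop ℕ∞) ≠ 0 := by exact_mod_cast hn
  -- At duration 0 the integral term drops out and the defect is y - y₀, with derivative the
  -- identity.
  have hinv : (fderiv ℝ (flowDefect fc) u₀ ∘L .inr ℝ (E × ℝ) C(I, E)).IsInvertible := by
    have h1 : HasFDerivAt (fun y : C(I, E) => flowDefect fc ((x₀, 0), y))
        (fderiv ℝ (flowDefect fc) u₀ ∘L .inr ℝ (E × ℝ) C(I, E)) y₀ :=
      ((hF.differentiable hn') u₀).hasFDerivAt.comp y₀ (hasFDerivAt_prodMk_right (x₀, (0 : ℝ)) y₀)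
    have h2 : HasFDerivAt (fun y : C(I, E) => flowDefect fc ((x₀, 0), y))
        (ContinuousLinearMap.id ℝ C(I, E)) y₀ := by
      have : (fun y : C(I, E) => flowDefect fc ((x₀, 0), y)) = fun y => y - y₀ := by
        funext y; simp [flowDefect, hy₀]
      rw [this]
      exact (hasFDerivAt_id y₀).sub_const y₀
    rw [h1.unique h2]
    exact ⟨ContinuousLinearEquiv.refl ℝ _, rfl⟩
  set ψ := hF.contDiffAt.implicitFunction hn' hinv with hψ
  have hψC : ContDiffAt ℝ n ψ (x₀, 0) := hF.contDiffAt.contDiffAt_implicitFunction hn' hinv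
  have hψ0 : ψ (x₀, 0) = y₀ := hF.contDiffAt.implicitFunction_apply_self hn' hinv
  have hsol : ∀ᶠ z in 𝓝 (x₀, (0 : ℝ)), flowDefect fc (z, ψ z) = 0 := by
    simpa [hF0] using hF.contDiffAt.eventually_apply_implicitFunction hn' hinv
  have huniq : ∀ᶠ v in 𝓝 u₀, flowDefect fc v = 0 → ψ v.1 = v.2 := by
    filter_upwards [hF.contDiffAt.eventually_apply_eq_iff_implicitFunction hn' hinv] with v hv h
    exact hv.1 (h.trans hF0.symm)
  obtain ⟨δ, hδ, Hu⟩ := Metric.eventually_nhds_iff.1 huniq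
  have hnear : ∀ᶠ z in 𝓝 (x₀, (0 : ℝ)), dist (ψ z) y₀ < δ := by
    have : Filter.Tendsto ψ (𝓝 (x₀, 0)) (𝓝 y₀) := hψ0 ▸ hψC.continuousAt
    exact this.eventually (Metric.ball_mem_nhds y₀ hδ)
  have hcont : ∀ᶠ z in 𝓝 (x₀, (0 : ℝ)), ContinuousAt ψ z := by
    filter_upwards [hψC.eventually (by simp)] with z hz using hz.continuousAt
  obtain ⟨ρ, hρ, H⟩ := Metric.eventually_nhds_iff.1 (hsol.and (hnear.and hcont))
  set η := min ρ δ with hη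
  have hηpos : 0 < η := lt_min hρ hδ
  have hball : ∀ {x : E} {t : ℝ}, dist x x₀ < η → |t| < η → dist (x, t) (x₀, (0 : ℝ)) < η := by
    intro x t hx ht
    rw [Prod.dist_eq]
    exact max_lt hx (by simpa using ht)
  -- `ψ (x, t)` is the whole trajectory rescaled to the unit interval; its endpoint is the flow at
  -- time t.
  let Φ : ℝ × E → E := fun z => ψ (z.2, z.1) 1
  have hΦ : ContDiffAt ℝ n Φ (0, x₀) := by
    have h1 : ContDiffAt ℝ n (fun z : ℝ × E => ψ (z.2, z.1)) (0, x₀) :=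
      ContDiffAt.comp (0, x₀) (g := ψ) (f := fun z : ℝ × E => (z.2, z.1)) hψC
        (contDiff_snd.prodMk contDiff_fst).contDiffAt
    exact (ContinuousMap.evalCLM ℝ (1 : I)).contDiff.contDiffAt.comp _ h1
  -- The rescaled trajectory is close to y₀ and solves the equation of duration r * t, so local
  -- uniqueness identifies it with ψ (x, r * t).
  have hscale : ∀ (x : E) (t : ℝ), dist x x₀ < η → |t| < η → ∀ r : I,
      Φ (r * t, x) = ψ (x, t) r := by
    intro x t hx ht r
    have hs := H ((hball hx ht).trans_le (min_le_left _ _))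
    have hrt : |(r : ℝ) * t| < η := by
      rw [abs_mul, abs_of_nonneg r.2.1]
      exact (mul_le_of_le_one_left (abs_nonneg t) r.2.2).trans_lt ht
    have := @Hu ((x, r * t), (ψ (x, t)).comp ⟨fun s => r * s, by fun_prop⟩) (by
      rw [Prod.dist_eq]
      refine max_lt ((hball hx hrt).trans_le (min_le_right _ _)) ?_
      refine lt_of_le_of_lt ?_ hs.2.1
      rw [ContinuousMap.dist_le dist_nonneg]
      intro s
      exact ContinuousMap.dist_apply_le_dist (f := ψ (x, t)) (g := y₀) (r * s))
      (flowDefect_rescale hs.1 r)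
    change ψ (x, r * t) 1 = _
    rw [this]
    simp
  -- The substitution v = u * t gives the usual integral equation, which can be differentiated in t.
  have hint : ∀ (x : E) (t : ℝ), dist x x₀ < η → |t| < η →
      Φ (t, x) = x + ∫ v in (0 : ℝ)..t, f (Φ (v, x)) := by
    intro x t hx ht
    have h1 := (flowDefect_eq_zero_iff _ _ _ _).1
      (H ((hball hx ht).trans_le (min_le_left _ _))).1 1
    change ψ (x, t) 1 = _
    rw [h1]
    congr 1
    have h2 := intervalIntegral.smul_integral_comp_mul_right (a := (0 : ℝ)) (b := 1)
      (fun v => f (Φ (v, x))) t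
    rw [zero_mul, one_mul] at h2
    rw [← h2]
    congr 1
    refine intervalIntegral.integral_congr fun u hu => ?_
    rw [Set.Icc.coe_one, Set.uIcc_of_le zero_le_one] at hu
    have := hscale x t hx ht ⟨u, hu⟩
    simp only [Set.projIcc_of_mem _ hu]
    rw [this]
    rfl
  refine ⟨Φ, hΦ, ?_, ?_⟩
  · filter_upwards [Metric.ball_mem_nhds x₀ hηpos] with x hx
    have := hint x 0 hx (by simpa using hηpos)
    simpa using this
  · filter_upwards [Metric.ball_mem_nhds ((0 : ℝ), x₀) hηpos] with z hz
    rw [Metric.mem_ball, Prod.dist_eq, max_lt_iff] at hz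
    obtain ⟨t, x⟩ := z
    have ht : |t| < η := by simpa using hz.1
    have hx : dist x x₀ < η := hz.2
    have hc : ∀ v ∈ Metric.ball (0 : ℝ) η, ContinuousAt (fun v => f (Φ (v, x))) v := by
      intro v hv
      have h1 : ContinuousAt ψ (x, v) :=
        (H ((hball hx (by simpa using hv)).trans_le (min_le_left _ _))).2.2
      have h2 : ContinuousAt (fun v : ℝ => ψ (x, v)) v :=
        ContinuousAt.comp (f := fun v : ℝ => (x, v)) h1 (by fun_prop)
      exact hf.continuous.continuousAt.comp
        ((ContinuousMap.evalCLM ℝ (1 : I)).continuous.continuousAt.comp h2)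
    have hmem : t ∈ Metric.ball (0 : ℝ) η := by simpa using ht
    have hco : ContinuousOn (fun v => f (Φ (v, x))) (Metric.ball (0 : ℝ) η) :=
      fun v hv => (hc v hv).continuousWithinAt
    have hsub : Set.uIcc 0 t ⊆ Metric.ball (0 : ℝ) η :=
      (convex_ball (0 : ℝ) η).ordConnected.uIcc_subset (Metric.mem_ball_self hηpos) hmem
    have hd := (intervalIntegral.integral_hasDerivAt_right
      ((hco.mono hsub).intervalIntegrable)
      (hco.stronglyMeasurableAtFilter Metric.isOpen_ball t hmem) (hc t hmem)).const_add x
    refine hd.congr_of_eventuallyEq ?_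
    filter_upwards [Metric.isOpen_ball.mem_nhds hmem] with τ hτ
    exact hint x τ hx (by simpa using hτ)

/-- A vector field that is `C^n` at a point has a local flow there that is `C^n` in time and initial
value. -/
lemma exists_contDiffAt_localFlow [FiniteDimensional ℝ E] {n : ℕ} (hn : n ≠ 0) {f : E → E} {x₀ : E}
    (hf : ContDiffAt ℝ n f x₀) :
    ∃ Φ : ℝ × E → E, ContDiffAt ℝ n Φ (0, x₀) ∧ (∀ᶠ x in 𝓝 x₀, Φ (0, x) = x) ∧
      ∀ᶠ z in 𝓝 ((0 : ℝ), x₀), HasDerivAt (fun t => Φ (t, z.2)) (f (Φ z)) z.1 := by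
  obtain ⟨ε, hε, hball⟩ := Metric.eventually_nhds_iff_ball.1 (hf.eventually (by simp))
  -- Cutting off makes f globally C^n; the flow stays where χ = 1 for small times, so it is a flow
  -- of f itself.
  let χ : ContDiffBump x₀ := ⟨ε / 3, ε / 2, by positivity, by linarith⟩
  have hg : ContDiff ℝ n fun x => χ x • f x := by
    rw [contDiff_iff_contDiffAt]
    intro x
    by_cases hx : x ∈ Metric.ball x₀ ε
    · exact χ.contDiff.contDiffAt.smul (hball x hx)
    · have h0 : (fun x => χ x • f x) =ᶠ[𝓝 x] fun _ => 0 := by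
        have hx' : x ∉ tsupport χ := by
          rw [χ.tsupport_eq]
          intro h
          exact hx (Metric.closedBall_subset_ball (by change ε / 2 < ε; linarith) h)
        filter_upwards [(isClosed_tsupport χ).isOpen_compl.mem_nhds hx'] with z hz
        rw [image_eq_zero_of_notMem_tsupport hz, zero_smul]
      exact contDiffAt_const.congr_of_eventuallyEq h0
  obtain ⟨Φ, h1, h2, h3⟩ := exists_contDiffAt_localFlow_of_contDiff hn hg x₀
  refine ⟨Φ, h1, h2, ?_⟩
  have hΦ0 : Φ (0, x₀) = x₀ := h2.self_of_nhds
  have h4 : ∀ᶠ z in 𝓝 ((0 : ℝ), x₀), χ (Φ z) = 1 := by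
    have : Filter.Tendsto Φ (𝓝 (0, x₀)) (𝓝 x₀) := by
      have := h1.continuousAt.tendsto
      rwa [hΦ0] at this
    exact this.eventually χ.eventuallyEq_one
  filter_upwards [h3, h4] with z hz hz'
  simpa [hz'] using hz

end LocalFlow

/-! ### Smoothness of flows on manifolds. -/

section ManifoldFlow
open scoped Topology

variable {E : Type*} [NormedAddCommGroup E] [NormedSpace ℝ E] [FiniteDimensional ℝ E]
  {H : Type*} [TopologicalSpace H] {I : ModelWithCorners ℝ E H}
  {M : Type*} [TopologicalSpace M] [ChartedSpace H M]
  {v : (x : M) → TangentSpace I x}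

/-- A `C^n` vector field on a manifold without boundary has local flows that are `C^n` in time and
initial value. -/
lemma exists_contMDiffAt_localFlow [I.Boundaryless] [IsManifold I ∞ M]
    {n : ℕ} (hn : n ≠ 0) {x₀ : M}
    (hv : ContMDiffAt I I.tangent n (fun x => (⟨x, v x⟩ : TangentBundle I M)) x₀) :
    ∃ Φ : ℝ × M → M, ContMDiffAt (𝓘(ℝ, ℝ).prod I) I n Φ (0, x₀) ∧
      (∀ᶠ x in 𝓝 x₀, Φ (0, x) = x) ∧
      ∀ᶠ z in 𝓝 ((0 : ℝ), x₀), HasMFDerivAt 𝓘(ℝ, ℝ) I (fun t => Φ (t, z.2)) z.1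
        ((1 : ℝ →L[ℝ] ℝ).smulRight (v (Φ z))) := by
  have : IsManifold I 1 M := IsManifold.of_le (n := ∞) (by simp)
  have : IsManifold I n M := IsManifold.of_le (n := ∞) (by exact_mod_cast le_top)
  have hx : I.IsInteriorPoint x₀ := BoundarylessManifold.isInteriorPoint
  rw [contMDiffAt_iff] at hv
  obtain ⟨_, hv⟩ := hv
  obtain ⟨φ, h1, h2, h3⟩ := exists_contDiffAt_localFlow hn
    (hv.contDiffAt (range_mem_nhds_isInteriorPoint hx)).snd
  set e := extChartAt I x₀ with he
  have hφ0 : φ (0, e x₀) = e x₀ := h2.self_of_nhds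
  have htgt : e.target ∈ 𝓝 (e x₀) := extChartAt_target_mem_nhds x₀
  have hce : ContinuousAt e x₀ := continuousAt_extChartAt x₀
  have hcpair : Filter.Tendsto (fun z : ℝ × M => (z.1, e z.2)) (𝓝 (0, x₀)) (𝓝 (0, e x₀)) := by
    refine Filter.Tendsto.prodMk_nhds continuousAt_fst ?_
    exact hce.tendsto.comp continuousAt_snd
  refine ⟨fun z => e.symm (φ (z.1, e z.2)), ?_, ?_, ?_⟩
  · have hsymm : ContMDiffAt 𝓘(ℝ, E) I n e.symm (φ (0, e x₀)) := by
      rw [hφ0]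
      exact (contMDiffOn_extChartAt_symm x₀).contMDiffAt htgt
    have he' : ContMDiffAt (𝓘(ℝ, ℝ).prod I) 𝓘(ℝ, ℝ × E) n (fun z : ℝ × M => (z.1, e z.2))
        (0, x₀) :=
      contMDiffAt_fst.prodMk_space
        ((contMDiffAt_extChartAt (n := n)).comp (0, x₀) contMDiffAt_snd)
    have hφ' : ContMDiffAt 𝓘(ℝ, ℝ × E) 𝓘(ℝ, E) n φ (0, e x₀) := h1.contMDiffAt
    exact ContMDiffAt.comp (0, x₀) (g := e.symm) hsymm
      (ContMDiffAt.comp (0, x₀) (g := φ) (f := fun z : ℝ × M => (z.1, e z.2)) hφ' he')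
  · filter_upwards [hce.eventually h2, extChartAt_source_mem_nhds (I := I) x₀] with x hx hx'
    simp only [hx]
    exact e.left_inv hx'
  · have hmem : ∀ᶠ z in 𝓝 ((0 : ℝ), e x₀), φ z ∈ interior e.target := by
      have : Filter.Tendsto φ (𝓝 (0, e x₀)) (𝓝 (e x₀)) := by
        have := h1.continuousAt.tendsto
        rwa [hφ0] at this
      exact this.eventually (isOpen_interior.mem_nhds ((I.isInteriorPoint_iff).mp hx))
    filter_upwards [hcpair.eventually (h3.and hmem)] with z hz
    obtain ⟨t, x⟩ := z
    simp only at hz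
    set f : ℝ → E := fun s => φ (s, e x) with hf
    let xₜ : M := e.symm (f t)
    obtain ⟨w, hw⟩ : ∃ w : E, w = v xₜ := ⟨_, rfl⟩
    -- The derivative is known in the chart at x₀, while the derivative on the manifold at xₜ is
    -- read in the chart at xₜ; the tangent coordinate change passes from one to the other.
    have h : HasDerivAt f (x := t) <| fderivWithin ℝ (extChartAt I x₀ ∘ (extChartAt I xₜ).symm)
      (Set.range I) (extChartAt I xₜ xₜ) w := by
      subst hw
      exact hz.1
    rw [← tangentCoordChange_def] at h
    have hf3 : f t ∈ interior e.target := hz.2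
    have hf3' := Set.mem_of_mem_of_subset hf3 interior_subset
    have hft1 := Set.mem_preimage.mp <|
      Set.mem_of_mem_of_subset hf3' (extChartAt I x₀).target_subset_preimage_source
    have hft2 := mem_extChartAt_source (I := I) xₜ
    have hd : HasDerivAt (F := E) ((extChartAt I xₜ ∘ (extChartAt I x₀).symm) ∘ f) w t := by
      rw [← tangentCoordChange_self (I := I) (x := xₜ) (z := xₜ) (v := w) hft2,
        ← tangentCoordChange_comp (x := x₀) ⟨⟨hft2, hft1⟩, hft2⟩]
      apply HasFDerivAt.comp_hasDerivAt _ _ h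
      apply HasFDerivWithinAt.hasFDerivAt (s := Set.range I) _ <|
        mem_nhds_iff.mpr ⟨interior (extChartAt I x₀).target,
          subset_trans interior_subset (extChartAt_target_subset_range ..),
          isOpen_interior, hf3⟩
      rw [← (extChartAt I x₀).right_inv hf3']
      exact hasFDerivWithinAt_tangentCoordChange ⟨hft1, hft2⟩
    have hfd : HasFDerivAt (F := E) ((extChartAt I xₜ ∘ (extChartAt I x₀).symm) ∘ f)
        ((1 : ℝ →L[ℝ] ℝ).smulRight w) t := hd.hasFDerivAt
    refine ⟨(continuousAt_extChartAt_symm'' hf3').comp h.continuousAt, ?_⟩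
    subst hw
    exact hfd.hasFDerivWithinAt

/-- A local flow box with explicit time and space domains. -/
lemma exists_localFlow_box [I.Boundaryless] [IsManifold I ∞ M]
    {n : ℕ} (hn : n ≠ 0)
    (hv : ContMDiff I I.tangent ∞ (fun x => (⟨x, v x⟩ : TangentBundle I M))) (x₀ : M) :
    ∃ Φ : ℝ × M → M, ∃ ε > 0, ∃ U ∈ 𝓝 x₀,
      (∀ s x, |s| < ε → x ∈ U → ContMDiffAt (𝓘(ℝ, ℝ).prod I) I n Φ (s, x)) ∧
      ∀ x ∈ U, Φ (0, x) = x ∧ IsMIntegralCurveOn (fun t => Φ (t, x)) v (Set.Ioo (-ε) ε) := by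
  have : IsManifold I n M := IsManifold.of_le (n := ∞) (by exact_mod_cast le_top)
  obtain ⟨Φ, h1, h2, h3⟩ := exists_contMDiffAt_localFlow hn
    ((hv.of_le (by exact_mod_cast le_top : (n : WithTop ℕ∞) ≤ ∞)) x₀)
  have h4 : ∀ᶠ z in 𝓝 ((0 : ℝ), x₀), ContMDiffAt (𝓘(ℝ, ℝ).prod I) I n Φ z := by
    exact (contMDiffAt_iff_contMDiffAt_nhds (by simp)).1 h1
  have h5 := h3.and h4
  rw [nhds_prod_eq] at h5
  obtain ⟨P, hP, Q, hQ, hPQ⟩ := Filter.eventually_prod_iff.1 h5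
  obtain ⟨ε, hε, hPε⟩ := Metric.eventually_nhds_iff.1 hP
  refine ⟨Φ, ε, hε, {x | Q x ∧ Φ (0, x) = x}, hQ.and h2, ?_, ?_⟩
  · intro s x hs hx
    exact (hPQ (hPε (by simpa using hs)) hx.1).2
  · intro x hx
    refine ⟨hx.2, fun t ht => ?_⟩
    exact (hPQ (hPε (by simpa [abs_lt] using ht)) hx.1).1.hasMFDerivWithinAt

/-- The flow of a complete smooth vector field is smooth. -/
theorem contMDiff_flow [I.Boundaryless] [IsManifold I ∞ M] [T2Space M]
    (hv : ContMDiff I I.tangent ∞ (fun x => (⟨x, v x⟩ : TangentBundle I M)))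
    {Γ : ℝ × M → M} (h0 : ∀ x, Γ (0, x) = x)
    (hΓ : ∀ x, IsMIntegralCurve (fun t => Γ (t, x)) v) :
    ContMDiff (𝓘(ℝ, ℝ).prod I) I ∞ Γ := by
  have : IsManifold I 1 M := IsManifold.of_le (n := ∞) (by simp)
  have hv1 : ContMDiff I I.tangent 1 (fun x => (⟨x, v x⟩ : TangentBundle I M)) :=
    hv.of_le (by simp)
  -- For finite n, being C^n at a point persists on a neighbourhood, so flow boxes are used for each
  -- n separately.
  suffices H : ∀ n : ℕ, n ≠ 0 → ContMDiff (𝓘(ℝ, ℝ).prod I) I n Γ by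
    rw [contMDiff_infty]
    exact fun n => (H (n + 1) (by simp)).of_le (by exact_mod_cast Nat.le_succ n)
  rintro n hn ⟨t₁, p⟩
  -- Near t₀ the flow box at Γ (t₀, p) gives Γ (t', x) = Φ (t' - t, Γ (t, x)). Hence C^n dependence
  -- on x at one time t near t₀ gives joint C^n dependence at all times t' near t₀.
  have step : ∀ t₀ : ℝ, ∃ δ > 0, ∀ t, |t - t₀| < δ → ContMDiffAt I I n (fun x => Γ (t, x)) p →
      ∀ t', |t' - t₀| < δ → ContMDiffAt (𝓘(ℝ, ℝ).prod I) I n Γ (t', p) := by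
    intro t₀
    obtain ⟨Φ, ε, hε, U, hU, hsm, hcur⟩ := exists_localFlow_box hn hv (Γ (t₀, p))
    have hc : Continuous fun t => Γ (t, p) := (hΓ p).continuous
    obtain ⟨δ, hδ, hδU⟩ := Metric.eventually_nhds_iff.1
      (hc.continuousAt.eventually (eventually_mem_nhds_iff.2 hU))
    refine ⟨min δ (ε / 2), by positivity, fun t ht hsmt t' ht' => ?_⟩
    have htt : |t' - t| < ε := by
      have h1 := lt_of_lt_of_le ht (min_le_right _ _)
      have h2 := lt_of_lt_of_le ht' (min_le_right _ _)
      rw [abs_lt] at h1 h2 ⊢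
      constructor <;> linarith
    have hUt : U ∈ 𝓝 (Γ (t, p)) := hδU (by
      rw [Real.dist_eq]; exact lt_of_lt_of_le ht (min_le_left _ _))
    have heq : Γ =ᶠ[𝓝 (t', p)] fun z => Φ (z.1 - t, Γ (t, z.2)) := by
      have e1 : ∀ᶠ z in 𝓝 (t', p), |z.1 - t| < ε := by
        have : Continuous fun z : ℝ × M => |z.1 - t| := by fun_prop
        exact this.continuousAt.eventually (gt_mem_nhds htt)
      have e2 : ∀ᶠ z in 𝓝 (t', p), Γ (t, z.2) ∈ U := by
        have : ContinuousAt (fun z : ℝ × M => Γ (t, z.2)) (t', p) :=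
          ContinuousAt.comp (f := Prod.snd) (g := fun x => Γ (t, x)) hsmt.continuousAt
            continuousAt_snd
        exact this.eventually hUt
      filter_upwards [e1, e2] with z hz1 hz2
      obtain ⟨hΦ0, hΦ⟩ := hcur _ hz2
      have hs : IsMIntegralCurveOn ((fun s => Γ (s, z.2)) ∘ (· + t)) v (Set.Ioo (-ε) ε) :=
        ((hΓ z.2).comp_add t).isMIntegralCurveOn _
      have := isMIntegralCurveOn_Ioo_eqOn_of_contMDiff_boundaryless (t₀ := 0) ⟨by linarith, hε⟩
        hv1 hs hΦ (by simp [hΦ0]) (abs_lt.1 hz1)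
      simpa using this
    refine ContMDiffAt.congr_of_eventuallyEq ?_ heq
    refine ContMDiffAt.comp (t', p) (g := Φ) (f := fun z : ℝ × M => (z.1 - t, Γ (t, z.2)))
      (hsm _ _ htt (mem_of_mem_nhds hUt)) ?_
    refine ContMDiffAt.prodMk ?_ (ContMDiffAt.comp (t', p) (g := fun x => Γ (t, x)) hsmt contMDiffAt_snd)
    exact contMDiffAt_fst.sub contMDiffAt_const
  have hslice : ∀ t, ContMDiffAt (𝓘(ℝ, ℝ).prod I) I n Γ (t, p) →
      ContMDiffAt I I n (fun x => Γ (t, x)) p := fun t h =>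
    ContMDiffAt.comp p (g := Γ) (f := fun x => (t, x)) h
      (contMDiffAt_const.prodMk contMDiffAt_id)
  -- By `step` this set of times is open and closed, and it contains 0, where the flow is the
  -- identity.
  have hA : IsClopen {t | ContMDiffAt I I n (fun x => Γ (t, x)) p} := by
    refine ⟨⟨?_⟩, ?_⟩
    · rw [Metric.isOpen_iff]
      intro t₀ ht₀
      obtain ⟨δ, hδ, hs⟩ := step t₀
      refine ⟨δ, hδ, fun t ht hmem => ht₀ ?_⟩
      exact hslice _ (hs t (by simpa [Real.dist_eq] using ht) hmem t₀ (by simpa using hδ))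
    · rw [Metric.isOpen_iff]
      intro t₀ ht₀
      obtain ⟨δ, hδ, hs⟩ := step t₀
      exact ⟨δ, hδ, fun t ht => hslice _ (hs t₀ (by simpa using hδ) ht₀ t
        (by simpa [Real.dist_eq] using ht))⟩
  have hAu := hA.eq_univ ⟨0, by
    change ContMDiffAt I I n (fun x => Γ (0, x)) p
    simp_rw [h0]
    exact contMDiffAt_id⟩
  obtain ⟨δ, hδ, hs⟩ := step t₁
  exact hs t₁ (by simpa using hδ) (hAu.ge (Set.mem_univ t₁)) t₁ (by simpa using hδ)

end ManifoldFlow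

/-! ### Cut-off functions on vector spaces. -/

section Cutoff
open scoped Topology

variable {E : Type*} [NormedAddCommGroup E] [NormedSpace ℝ E]

lemma ContDiff.mul_of_tsupport_subset {χ f : E → ℝ} {U : Set E} (hχ : ContDiff ℝ ∞ χ)
    (hU : IsOpen U) (hsub : tsupport χ ⊆ U) (hf : ContDiffOn ℝ ∞ f U) :
    ContDiff ℝ ∞ fun x => χ x * f x := by
  rw [contDiff_iff_contDiffAt]
  intro x
  by_cases hx : x ∈ U
  · exact hχ.contDiffAt.mul (hf.contDiffAt (hU.mem_nhds hx))
  · have h0 : (fun x => χ x * f x) =ᶠ[𝓝 x] fun _ => 0 := by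
      filter_upwards [(isClosed_tsupport χ).isOpen_compl.mem_nhds fun h => hx (hsub h)] with z hz
      rw [image_eq_zero_of_notMem_tsupport hz, zero_mul]
    exact contDiffAt_const.congr_of_eventuallyEq h0

lemma exists_contDiff_cutoff [FiniteDimensional ℝ E] {x : E} {U : Set E} (hU : U ∈ 𝓝 x) :
    ∃ χ : E → ℝ, ContDiff ℝ ∞ χ ∧ χ =ᶠ[𝓝 x] 1 ∧ tsupport χ ⊆ U := by
  obtain ⟨ε, hε, hεU⟩ := Metric.nhds_basis_closedBall.mem_iff.1 hU
  let χ : ContDiffBump x := ⟨ε / 2, ε, by positivity, by linarith⟩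
  exact ⟨χ, χ.contDiff, χ.eventuallyEq_one, by rw [χ.tsupport_eq]; exact hεU⟩

end Cutoff

namespace StarLog
open scoped Topology

/-! ### Time-dependent functions on the surface. -/

section TimeDependent

variable {S : Type*} [TopologicalSpace S] [ChartedSpace Plane S]

variable (S) in
/-- Smooth time-dependent functions on the surface. -/
abbrev TFn : Type _ := C^∞⟮𝓘(ℝ, ℝ).prod (𝓡 2), ℝ × S; 𝓘(ℝ, ℝ), ℝ⟯

/-- The value of a time-dependent function at a fixed time. -/
noncomputable def TFn.slice (B : TFn S) (t : ℝ) : SmoothFn S :=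
  ⟨fun p => B (t, p), B.contMDiff.comp (contMDiff_const.prodMk contMDiff_id)⟩

@[simp] lemma TFn.slice_apply (B : TFn S) (t : ℝ) (p : S) : B.slice t p = B (t, p) := rfl

/-- In a chart at the base point the derivative of a function is the ordinary derivative. -/
lemma mvfderiv_eq_fderiv_chartAt {f : S → ℝ} {p : S} (hf : MDifferentiableAt (𝓡 2) 𝓘(ℝ, ℝ) f p)
    (v : TangentSpace (𝓡 2) p) :
    mvfderiv (𝓡 2) f p v = fderiv ℝ (f ∘ (chartAt Plane p).symm) (chartAt Plane p p) v := by
  change mfderiv (𝓡 2) 𝓘(ℝ, ℝ) f p v = _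
  rw [hf.mfderiv]
  simp only [mfld_simps, fderivWithin_univ]
  rfl

variable [IsManifold (𝓡 2) ∞ S]

lemma contMDiff_mvfderiv_apply {E H M : Type*} [NormedAddCommGroup E] [NormedSpace ℝ E]
    [TopologicalSpace H] {J : ModelWithCorners ℝ E H} [TopologicalSpace M] [ChartedSpace H M]
    [IsManifold J ∞ M] {B : M → ℝ} (hB : ContMDiff J 𝓘(ℝ, ℝ) ∞ B)
    {Z : (x : M) → TangentSpace J x}
    (hZ : ContMDiff J J.tangent ∞ fun x => (⟨x, Z x⟩ : TangentBundle J M)) :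
    ContMDiff J 𝓘(ℝ, ℝ) ∞ fun x => mvfderiv J B x (Z x) := by
  have h1 : ContMDiff J.tangent (𝓘(ℝ, ℝ)).tangent ∞ (tangentMap J 𝓘(ℝ, ℝ) B) :=
    hB.contMDiff_tangentMap (by simp)
  exact ((contMDiff_snd_tangentBundle_modelSpace ℝ 𝓘(ℝ, ℝ)).comp h1).comp hZ

/-- Vector fields on `ℝ × S` with constant time component. -/
lemma contMDiff_prod_section (c : ℝ) (X : VField S) :
    ContMDiff (𝓘(ℝ, ℝ).prod (𝓡 2)) (𝓘(ℝ, ℝ).prod (𝓡 2)).tangent ∞ fun z : ℝ × S =>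
      (⟨z, (c, X z.2)⟩ : TangentBundle (𝓘(ℝ, ℝ).prod (𝓡 2)) (ℝ × S)) := by
  have h1 : ContMDiff 𝓘(ℝ, ℝ) (𝓘(ℝ, ℝ)).tangent ∞
      fun t : ℝ => (⟨t, c⟩ : TangentBundle 𝓘(ℝ, ℝ) ℝ) :=
    contMDiff_vectorSpace_iff_contDiff.2 contDiff_const
  exact contMDiff_equivTangentBundleProd_symm.comp
    ((h1.comp contMDiff_fst).prodMk (X.contMDiff.comp contMDiff_snd))

/-- The vector field `∂_t + h X` on `ℝ × S`. -/
lemma contMDiff_prod_section_smul {h : ℝ × S → ℝ}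
    (hh : ContMDiff (𝓘(ℝ, ℝ).prod (𝓡 2)) 𝓘(ℝ, ℝ) ∞ h) (X : VField S) :
    ContMDiff (𝓘(ℝ, ℝ).prod (𝓡 2)) (𝓘(ℝ, ℝ).prod (𝓡 2)).tangent ∞ fun z : ℝ × S =>
      (⟨z, ((1 : ℝ), h z • X z.2)⟩ : TangentBundle (𝓘(ℝ, ℝ).prod (𝓡 2)) (ℝ × S)) := by
  have := (contMDiff_prod_section 1 (0 : VField S)).add_section
    (hh.smul_section (contMDiff_prod_section 0 X))
  refine this.congr fun z => ?_
  refine congrArg (Bundle.TotalSpace.mk z) ?_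
  refine Prod.ext ?_ ?_
  · change (1 : ℝ) = 1 + h z * 0
    simp
  · change h z • X z.2 = 0 + h z • X z.2
    rw [zero_add]

/-- The time derivative. -/
noncomputable def TFn.dot (B : TFn S) : TFn S :=
  ⟨fun z => mvfderiv (𝓘(ℝ, ℝ).prod (𝓡 2)) B z ((1 : ℝ), (0 : TangentSpace (𝓡 2) z.2)),
    contMDiff_mvfderiv_apply B.contMDiff (contMDiff_prod_section 1 (0 : VField S))⟩

/-- The derivative along a vector field of the surface. -/
noncomputable def TFn.act (X : VField S) (B : TFn S) : TFn S :=
  ⟨fun z => mvfderiv (𝓘(ℝ, ℝ).prod (𝓡 2)) B z ((0 : ℝ), X z.2),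
    contMDiff_mvfderiv_apply B.contMDiff (contMDiff_prod_section 0 X)⟩

set_option linter.unusedSectionVars false in
lemma TFn.mdifferentiableAt (B : TFn S) (z : ℝ × S) :
    MDifferentiableAt (𝓘(ℝ, ℝ).prod (𝓡 2)) 𝓘(ℝ, ℝ) B z :=
  B.contMDiff.mdifferentiable (by simp) z

lemma TFn.hasDerivAt_dot (B : TFn S) (t : ℝ) (p : S) :
    HasDerivAt (fun s => B (s, p)) (B.dot (t, p)) t := by
  have h1 : HasMFDerivAt 𝓘(ℝ, ℝ) (𝓘(ℝ, ℝ).prod (𝓡 2)) (fun s : ℝ => (s, p)) t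
      ((ContinuousLinearMap.id ℝ (TangentSpace 𝓘(ℝ, ℝ) t)).prod
        (0 : TangentSpace 𝓘(ℝ, ℝ) t →L[ℝ] TangentSpace (𝓡 2) p)) :=
    (hasMFDerivAt_id t).prodMk (hasMFDerivAt_const p t)
  have h2 := (B.mdifferentiableAt (t, p)).hasMFDerivAt.comp t h1
  have h3 : HasFDerivAt (fun s : ℝ => B (s, p))
      (show ℝ →L[ℝ] ℝ from (mfderiv (𝓘(ℝ, ℝ).prod (𝓡 2)) 𝓘(ℝ, ℝ) B (t, p)).comp
        ((ContinuousLinearMap.id ℝ (TangentSpace 𝓘(ℝ, ℝ) t)).prod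
        (0 : TangentSpace 𝓘(ℝ, ℝ) t →L[ℝ] TangentSpace (𝓡 2) p))) t := h2.hasFDerivAt
  exact h3.hasDerivAt

lemma TFn.act_apply (X : VField S) (B : TFn S) (t : ℝ) (p : S) :
    TFn.act X B (t, p) = StarLog.act X (B.slice t) p := by
  have h1 : HasMFDerivAt (𝓡 2) (𝓘(ℝ, ℝ).prod (𝓡 2)) (fun q : S => (t, q)) p
      ((0 : TangentSpace (𝓡 2) p →L[ℝ] TangentSpace 𝓘(ℝ, ℝ) t).prod
        (ContinuousLinearMap.id ℝ (TangentSpace (𝓡 2) p))) :=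
    (hasMFDerivAt_const t p).prodMk (hasMFDerivAt_id p)
  have h2 := (B.mdifferentiableAt (t, p)).hasMFDerivAt.comp p h1
  rw [StarLog.act_apply]
  change _ = mfderiv (𝓡 2) 𝓘(ℝ, ℝ) (B.slice t) p (X p)
  rw [show (⇑(B.slice t)) = (B ∘ fun q : S => (t, q)) from rfl, h2.mfderiv]
  rfl

set_option linter.unusedSectionVars false in
/-- A time-dependent function in a chart of the surface. -/
lemma TFn.contDiffOn_chart (B : TFn S) {φ : OpenPartialHomeomorph S Plane}
    (hφ : φ ∈ IsManifold.maximalAtlas (𝓡 2) ∞ S) :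
    ContDiffOn ℝ ∞ (fun z : ℝ × Plane => B (z.1, φ.symm z.2)) (Set.univ ×ˢ φ.target) := by
  rw [← contMDiffOn_iff_contDiffOn]
  refine B.contMDiff.comp_contMDiffOn (ContMDiffOn.prodMk contDiff_fst.contMDiff.contMDiffOn ?_)
  exact (contMDiffOn_symm_of_mem_maximalAtlas hφ).comp contDiff_snd.contMDiff.contMDiffOn
    fun z hz => hz.2

/-- Time derivatives commute with derivatives along vector fields of the surface. -/
lemma TFn.dot_act (X : VField S) (B : TFn S) : (TFn.act X B).dot = TFn.act X B.dot := by
  ext ⟨t, p⟩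
  -- In the preferred chart at p a tangent vector at p is its own coordinate vector, so both sides
  -- are mixed second derivatives of F in the directions (1, 0) and (0, X p).
  set φ := chartAt Plane p with hφ
  set F : ℝ × Plane → ℝ := fun z => B (z.1, φ.symm z.2) with hF
  have hU : IsOpen ((Set.univ : Set ℝ) ×ˢ φ.target) := isOpen_univ.prod φ.open_target
  have hC : ContDiffOn ℝ ∞ F (Set.univ ×ˢ φ.target) :=
    B.contDiffOn_chart (IsManifold.chart_mem_maximalAtlas p)
  have hx : φ p ∈ φ.target := φ.map_source (mem_chart_source Plane p)
  have hat : ∀ s, ∀ x ∈ φ.target, ContDiffAt ℝ ∞ F (s, x) := fun s x hx =>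
    hC.contDiffAt (hU.mem_nhds ⟨trivial, hx⟩)
  have hdiff : ∀ s, ∀ x ∈ φ.target, DifferentiableAt ℝ F (s, x) := fun s x hx =>
    (hat s x hx).differentiableAt (by simp)
  have h2 : DifferentiableAt ℝ (fderiv ℝ F) (t, φ p) :=
    ((hat t _ hx).fderiv_right (m := ∞) (by simp)).differentiableAt (by simp)
  -- the two first derivatives in coordinates
  have hact : ∀ s, TFn.act X B (s, p) = fderiv ℝ F (s, φ p) (0, X p) := by
    intro s
    rw [TFn.act_apply, StarLog.act_apply, mvfderiv_eq_fderiv_chartAt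
      (ContMDiffMap.mdifferentiableAt _)]
    have h1 : HasFDerivAt (fun x : Plane => F (s, x))
        ((fderiv ℝ F (s, φ p)).comp (ContinuousLinearMap.inr ℝ ℝ Plane)) (φ p) :=
      (hdiff s _ hx).hasFDerivAt.comp _ (hasFDerivAt_prodMk_right s (φ p))
    exact congrArg (fun L : Plane →L[ℝ] ℝ => L (X p)) h1.fderiv
  have hdot : ∀ x ∈ φ.target, B.dot (t, φ.symm x) = fderiv ℝ F (t, x) (1, 0) := by
    intro x hx
    have h1 : HasDerivAt (fun s => F (s, x)) (fderiv ℝ F (t, x) (1, 0)) t :=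
      HasFDerivAt.comp_hasDerivAt t (f := fun s : ℝ => (s, x)) (hdiff t _ hx).hasFDerivAt
        ((hasDerivAt_id t).prodMk (hasDerivAt_const t x))
    exact (B.hasDerivAt_dot t (φ.symm x)).unique h1
  have hL : (TFn.act X B).dot (t, p) = fderiv ℝ (fderiv ℝ F) (t, φ p) (1, 0) (0, X p) := by
    refine ((TFn.act X B).hasDerivAt_dot t p).unique ?_
    simp_rw [hact]
    have h3 : HasDerivAt (fun s => fderiv ℝ F (s, φ p))
        (fderiv ℝ (fderiv ℝ F) (t, φ p) (1, 0)) t :=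
      HasFDerivAt.comp_hasDerivAt t (f := fun s : ℝ => (s, φ p)) h2.hasFDerivAt
        ((hasDerivAt_id t).prodMk (hasDerivAt_const t (φ p)))
    have h4 := h3.clm_apply (hasDerivAt_const t ((0 : ℝ), (show Plane from X p)))
    simpa using h4
  have hR : TFn.act X B.dot (t, p) = fderiv ℝ (fderiv ℝ F) (t, φ p) (0, X p) (1, 0) := by
    rw [TFn.act_apply, StarLog.act_apply, mvfderiv_eq_fderiv_chartAt
      (ContMDiffMap.mdifferentiableAt _)]
    have e : (⇑(B.dot.slice t) ∘ φ.symm) =ᶠ[𝓝 (φ p)] fun x => fderiv ℝ F (t, x) (1, 0) := by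
      filter_upwards [φ.open_target.mem_nhds hx] with x hx using hdot x hx
    rw [e.fderiv_eq]
    have h3 : HasFDerivAt (fun x : Plane => fderiv ℝ F (t, x))
        ((fderiv ℝ (fderiv ℝ F) (t, φ p)).comp (ContinuousLinearMap.inr ℝ ℝ Plane)) (φ p) :=
      h2.hasFDerivAt.comp _ (hasFDerivAt_prodMk_right t (φ p))
    have h4 := h3.clm_apply (hasFDerivAt_const ((1 : ℝ), (0 : Plane)) (φ p))
    rw [h4.fderiv]
    simp
    rfl
  rw [hL, hR]
  have hsymm : IsSymmSndFDerivAt ℝ F (t, φ p) :=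
    (hat t _ hx).isSymmSndFDerivAt (by
      rw [minSmoothness_of_isRCLikeNormedField]
      exact (WithTop.coe_le_coe.mpr le_top : ((2 : ℕ∞) : WithTop ℕ∞) ≤ ((⊤ : ℕ∞) : WithTop ℕ∞)))
  exact hsymm.eq _ _

/-- The parametric integral needs a function smooth on all of ℝ × Plane. The cut-off depends on the
position only, so the neighbourhood of p serves all times at once. -/
lemma TFn.exists_contDiff_integral_chart (B : TFn S) (p : S) :
    ∃ G : ℝ × Plane → ℝ, ContDiff ℝ ∞ G ∧ ∀ᶠ q in 𝓝 p, ∀ t,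
      (chartAt Plane p).symm (chartAt Plane p q) = q ∧
      ∀ᶠ x in 𝓝 (chartAt Plane p q), G (t, x) = B (t, (chartAt Plane p).symm x) := by
  set φ := chartAt Plane p with hφ
  have hp : p ∈ φ.source := mem_chart_source Plane p
  obtain ⟨χ, hχ, hχ1, hχU⟩ := exists_contDiff_cutoff (φ.open_target.mem_nhds (φ.map_source hp))
  refine ⟨fun z => χ z.2 * B (z.1, φ.symm z.2), ?_, ?_⟩
  · refine (hχ.comp contDiff_snd).mul_of_tsupport_subset (isOpen_univ.prod φ.open_target) ?_
      (B.contDiffOn_chart (IsManifold.chart_mem_maximalAtlas p))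
    intro z hz
    exact ⟨trivial, hχU (tsupport_comp_subset_preimage χ continuous_snd hz)⟩
  · filter_upwards [φ.open_source.mem_nhds hp,
      (φ.continuousAt hp).eventually hχ1.eventually_nhds] with q hq hq1 t
    refine ⟨φ.left_inv hq, ?_⟩
    filter_upwards [hq1] with x hx
    simp [hx]

/-- The average of a time-dependent function over the unit interval. -/
noncomputable def TFn.avg (B : TFn S) : SmoothFn S :=
  ⟨fun p => ∫ t in (0 : ℝ)..1, B (t, p), fun p => by
    obtain ⟨G, hG, hGB⟩ := B.exists_contDiff_integral_chart p
    have h1 : ContDiff ℝ ∞ fun x => ∫ t in (0 : ℝ)..1, G (t, x) :=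
      ContDiff.unitInterval_integral (n := ⊤) hG
    have h2 : ContMDiffAt (𝓡 2) (𝓡 2) ∞ (chartAt Plane p) p :=
      contMDiffAt_of_mem_maximalAtlas (IsManifold.chart_mem_maximalAtlas p)
        (mem_chart_source Plane p)
    refine (h1.contMDiff.contMDiffAt.comp p h2).congr_of_eventuallyEq ?_
    filter_upwards [hGB] with q hq
    refine intervalIntegral.integral_congr fun t _ => ?_
    have := (hq t).2.self_of_nhds
    rw [(hq t).1] at this
    exact this.symm⟩

/-- Differentiation under the integral. -/
lemma TFn.act_avg (X : VField S) (B : TFn S) (p : S) :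
    StarLog.act X B.avg p = ∫ t in (0 : ℝ)..1, TFn.act X B (t, p) := by
  obtain ⟨G, hG, hGB⟩ := B.exists_contDiff_integral_chart p
  rw [StarLog.act_apply, mvfderiv_eq_fderiv_chartAt (ContMDiffMap.mdifferentiableAt _)]
  set φ := chartAt Plane p with hφ
  have hp : p ∈ φ.source := mem_chart_source Plane p
  have hev : ∀ᶠ x in 𝓝 (φ p), ∀ t, G (t, x) = B (t, φ.symm x) := by
    have h1 : Filter.Tendsto φ.symm (𝓝 (φ p)) (𝓝 p) := by
      have := φ.continuousAt_symm (φ.map_source hp)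
      rwa [ContinuousAt, φ.left_inv hp] at this
    filter_upwards [h1.eventually hGB, φ.open_target.mem_nhds (φ.map_source hp)] with x hx hxt t
    have := (hx t).2.self_of_nhds
    rwa [φ.right_inv hxt] at this
  have e : (⇑B.avg ∘ φ.symm) =ᶠ[𝓝 (φ p)] fun x => ∫ t in (0 : ℝ)..1, G (t, x) := by
    filter_upwards [hev] with x hx
    exact intervalIntegral.integral_congr fun t _ => (hx t).symm
  rw [e.fderiv_eq]
  refine (ContDiff.fderiv_unitInterval_integral (hG.of_le (by simp)) (φ p) (X p)).trans ?_
  refine intervalIntegral.integral_congr fun t _ => ?_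
  rw [TFn.act_apply, StarLog.act_apply, mvfderiv_eq_fderiv_chartAt
    (ContMDiffMap.mdifferentiableAt _)]
  have e2 : (⇑(B.slice t) ∘ φ.symm) =ᶠ[𝓝 (φ p)] fun x => G (t, x) := by
    filter_upwards [hev] with x hx using (hx t).symm
  rw [e2.fderiv_eq]
  have h1 : HasFDerivAt (fun x : Plane => G (t, x))
      ((fderiv ℝ G (t, φ p)).comp (ContinuousLinearMap.inr ℝ ℝ Plane)) (φ p) :=
    (hG.differentiable (by simp) _).hasFDerivAt.comp _ (hasFDerivAt_prodMk_right t (φ p))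
  rw [h1.fderiv]
  rfl

end TimeDependent

/-! ### Derivatives, cut-offs and vector fields in smooth charts. -/

section Charts

variable {S : Type*} [TopologicalSpace S] [ChartedSpace Plane S]

lemma mdifferentiable_of_mem_maximalAtlas {φ : OpenPartialHomeomorph S Plane}
    (hφ : φ ∈ IsManifold.maximalAtlas (𝓡 2) ∞ S) : φ.MDifferentiable (𝓡 2) (𝓡 2) :=
  ⟨(contMDiffOn_of_mem_maximalAtlas hφ).mdifferentiableOn (by simp),
    (contMDiffOn_symm_of_mem_maximalAtlas hφ).mdifferentiableOn (by simp)⟩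

/-- The derivative of a function is the ordinary derivative in any smooth chart. -/
lemma mvfderiv_eq_fderiv_chart {φ : OpenPartialHomeomorph S Plane}
    (hφ : φ ∈ IsManifold.maximalAtlas (𝓡 2) ∞ S) {q : S} (hq : q ∈ φ.source) {f : S → ℝ}
    (hf : MDifferentiableAt (𝓡 2) 𝓘(ℝ, ℝ) f q) (v : TangentSpace (𝓡 2) q) :
    mvfderiv (𝓡 2) f q v = fderiv ℝ (f ∘ φ.symm) (φ q) (mvfderiv (𝓡 2) φ q v) := by
  have hd := mdifferentiable_of_mem_maximalAtlas hφ
  have h1 : MDifferentiableAt (𝓡 2) 𝓘(ℝ, ℝ) (f ∘ φ.symm) (φ q) := by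
    refine MDifferentiableAt.comp (φ q) ?_ (hd.mdifferentiableAt_symm (φ.map_source hq))
    rwa [φ.left_inv hq]
  have h2 := h1.hasMFDerivAt.comp q (hd.mdifferentiableAt hq).hasMFDerivAt
  have h3 : HasMFDerivAt (𝓡 2) 𝓘(ℝ, ℝ) f q _ := h2.congr_of_eventuallyEq (by
    filter_upwards [φ.open_source.mem_nhds hq] with r hr
    simp [φ.left_inv hr])
  change mfderiv (𝓡 2) 𝓘(ℝ, ℝ) f q v = _
  rw [h3.mfderiv, mfderiv_eq_fderiv]
  rfl

lemma bijective_mvfderiv_chart {φ : OpenPartialHomeomorph S Plane}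
    (hφ : φ ∈ IsManifold.maximalAtlas (𝓡 2) ∞ S) {q : S} (hq : q ∈ φ.source) :
    Function.Bijective (mvfderiv (𝓡 2) φ q) :=
  (mdifferentiable_of_mem_maximalAtlas hφ).mfderiv_bijective hq

lemma exists_cutoff [T2Space S] [IsManifold (𝓡 2) ∞ S] {p : S} {U : Set S} (hU : U ∈ 𝓝 p) :
    ∃ χ : SmoothFn S, (∀ᶠ q in 𝓝 p, χ q = 1) ∧ tsupport χ ⊆ U := by
  obtain ⟨f, -, hf⟩ := (SmoothBumpFunction.nhds_basis_tsupport (I := 𝓡 2) p).mem_iff.1 hU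
  exact ⟨⟨f, f.contMDiff⟩, f.eventuallyEq_one, hf⟩

lemma exists_cutoff_mul (χ : SmoothFn S) {U : Set S} (hU : IsOpen U) (hχ : tsupport χ ⊆ U)
    {f : S → ℝ} (hf : ContMDiffOn (𝓡 2) 𝓘(ℝ, ℝ) ∞ f U) :
    ∃ g : SmoothFn S, ∀ q, g q = χ q * f q := by
  refine ⟨⟨fun q => χ q * f q, fun q => ?_⟩, fun q => rfl⟩
  by_cases hq : q ∈ U
  · exact χ.contMDiff.contMDiffAt.mul (hf.contMDiffAt (hU.mem_nhds hq))
  · refine ContMDiffAt.congr_of_eventuallyEq (contMDiffAt_const (c := (0 : ℝ))) ?_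
    filter_upwards [(isClosed_tsupport χ).isOpen_compl.mem_nhds fun h => hq (hχ h)] with z hz
    rw [image_eq_zero_of_notMem_tsupport hz, zero_mul]

variable [IsManifold (𝓡 2) ∞ S]

lemma exists_cutoff_smul (χ : SmoothFn S) {U : Set S} (hU : IsOpen U) (hχ : tsupport χ ⊆ U)
    {Z : (q : S) → TangentSpace (𝓡 2) q}
    (hZ : ContMDiffOn (𝓡 2) (𝓡 2).tangent ∞ (fun q => (⟨q, Z q⟩ : TangentBundle (𝓡 2) S)) U) :
    ∃ X : VField S, ∀ q, X q = χ q • Z q :=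
  ⟨⟨fun q => χ q • Z q, ContMDiffOn.smul_section_of_tsupport χ.contMDiff.contMDiffOn hU hχ hZ⟩,
    fun _ => rfl⟩

/-- A smooth vector field of the plane, read in a smooth chart. -/
lemma exists_chart_field {φ : OpenPartialHomeomorph S Plane}
    (hφ : φ ∈ IsManifold.maximalAtlas (𝓡 2) ∞ S) {w : Plane → Plane} (hw : ContDiff ℝ ∞ w) :
    ∃ Z : (q : S) → TangentSpace (𝓡 2) q,
      ContMDiffOn (𝓡 2) (𝓡 2).tangent ∞ (fun q => (⟨q, Z q⟩ : TangentBundle (𝓡 2) S)) φ.source ∧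
      ∀ q ∈ φ.source, mvfderiv (𝓡 2) φ q (Z q) = w (φ q) := by
  have hd := mdifferentiable_of_mem_maximalAtlas hφ
  have hinv : ∀ q ∈ φ.source, (mfderiv (𝓡 2) (𝓡 2) φ q).IsInvertible := fun q hq =>
    ⟨hd.mfderiv hq, rfl⟩
  have hw' : ContMDiff (𝓡 2) (𝓡 2).tangent ∞
      fun x : Plane => (⟨x, w x⟩ : TangentBundle (𝓡 2) Plane) :=
    contMDiff_vectorSpace_iff_contDiff.2 hw
  have : IsManifold (𝓡 2) (∞ + 1) S := by
    simpa using (inferInstance : IsManifold (𝓡 2) ∞ S)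
  refine ⟨mpullback (𝓡 2) (𝓡 2) φ w, fun q hq => ?_, fun q hq => ?_⟩
  · exact (ContMDiffAt.mpullback_vectorField_preimage (n := ∞) hw'.contMDiffAt
      (contMDiffAt_of_mem_maximalAtlas hφ hq) (hinv q hq) (by simp)).contMDiffWithinAt
  · change mfderiv (𝓡 2) (𝓡 2) φ q ((mfderiv (𝓡 2) (𝓡 2) φ q).inverse (w (φ q))) = w (φ q)
    exact (hinv q hq).self_apply_inverse _

end Charts

/-! ### Charts adapted to the divisor. -/

section StarCharts

variable {S : Type*} [TopologicalSpace S] [ChartedSpace Plane S] {D : StarDivisor S}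

/-- A smooth chart centred at `p` in which the curves through `p` are lines and which meets no other
curves. -/
structure StarChart (D : StarDivisor S) (p : S) where
  φ : OpenPartialHomeomorph S Plane
  mem_maximalAtlas : φ ∈ IsManifold.maximalAtlas (𝓡 2) ∞ S
  mem_source : p ∈ φ.source
  map_self : φ p = 0
  l : Fin D.card → (Plane →L[ℝ] ℝ)
  l_ne_zero : ∀ i, p ∈ D.curve i → l i ≠ 0
  mem_curve_iff : ∀ i, p ∈ D.curve i → ∀ q ∈ φ.source, q ∈ D.curve i ↔ l i (φ q) = 0
  linearIndependent : ∀ i j, i ≠ j → p ∈ D.curve i → p ∈ D.curve j →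
    LinearIndependent ℝ ![l i, l j]
  mem_curve_of_mem : ∀ i, ∀ q ∈ φ.source, q ∈ D.curve i → p ∈ D.curve i

/-- The curves missing p are finitely many closed sets, so the chart can be restricted to the
complement of their union. -/
lemma exists_starChart [IsManifold (𝓡 2) ∞ S] (D : StarDivisor S) (p : S) :
    Nonempty (StarChart D p) := by
  obtain ⟨φ, hφ, hp, h0, l, hl, hind⟩ := D.star_chart p
  let V : Set S := ⋂ i : {i // p ∉ D.curve i}, (D.curve i.1)ᶜ
  have hV : IsOpen V := isOpen_iInter_of_finite fun i => (D.isClosed i.1).isOpen_compl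
  have hsrc : (φ.restr V).source = φ.source ∩ V := φ.restr_source' V hV
  refine ⟨⟨φ.restr V, restr_mem_maximalAtlas _ hφ hV, ?_, h0, l, fun i hi => (hl i hi).1, ?_,
    hind, ?_⟩⟩
  · rw [hsrc]
    exact ⟨hp, Set.mem_iInter.2 fun i => i.2⟩
  · intro i hi q hq
    rw [hsrc] at hq
    exact (hl i hi).2 q hq.1
  · intro i q hq hqi
    rw [hsrc] at hq
    by_contra hpi
    exact Set.mem_iInter.1 hq.2 ⟨i, hpi⟩ hqi

/-- The complement of the divisor. -/
def StarDivisor.compl (D : StarDivisor S) : Set S := {p | ∀ i, p ∉ D.curve i}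

/-- A point of the curve is approached along a direction transverse to the line representing it. -/
lemma StarDivisor.dense_compl_curve [IsManifold (𝓡 2) ∞ S] (D : StarDivisor S)
    (i : Fin D.card) : Dense (D.curve i)ᶜ := by
  intro p
  by_cases hp : p ∈ D.curve i
  swap
  · exact subset_closure hp
  obtain ⟨C⟩ := exists_starChart D p
  obtain ⟨w, hw⟩ : ∃ w, C.l i w ≠ 0 := by
    by_contra! H
    exact C.l_ne_zero i hp (by ext x; simpa using H x)
  have h0 : (0 : Plane) ∈ C.φ.target := C.map_self ▸ C.φ.map_source C.mem_source
  have hsymm : C.φ.symm 0 = p := by rw [← C.map_self, C.φ.left_inv C.mem_source]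
  have hlin : Filter.Tendsto (fun s : ℝ => s • w) (𝓝[≠] 0) (𝓝 (0 : Plane)) := by
    have : Continuous fun s : ℝ => s • w := by fun_prop
    have h2 := this.tendsto 0
    rw [zero_smul] at h2
    exact h2.mono_left nhdsWithin_le_nhds
  have ht : Filter.Tendsto (fun s : ℝ => C.φ.symm (s • w)) (𝓝[≠] 0) (𝓝 p) := by
    have h1 := C.φ.continuousAt_symm h0
    rw [ContinuousAt, hsymm] at h1
    exact h1.comp hlin
  refine mem_closure_of_tendsto ht ?_
  filter_upwards [self_mem_nhdsWithin, hlin.eventually (C.φ.open_target.mem_nhds h0)] with s hs hs'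
  intro hmem
  rw [C.mem_curve_iff i hp _ (C.φ.map_target hs'), C.φ.right_inv hs'] at hmem
  rw [map_smul, smul_eq_zero] at hmem
  exact hmem.elim hs hw

/-- A finite intersection of dense open sets. This underlies every later extension by continuity
from the complement of the divisor. -/
lemma StarDivisor.dense_compl [IsManifold (𝓡 2) ∞ S] [T2Space S] [CompactSpace S]
    (D : StarDivisor S) : Dense D.compl := by
  have : D.compl = ⋂ i, (D.curve i)ᶜ := by
    ext p; simp [StarDivisor.compl]
  rw [this]
  exact dense_iInter_of_isOpen (fun i => (D.isClosed i).isOpen_compl)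
    fun i => D.dense_compl_curve i

variable [IsManifold (𝓡 2) ∞ S] [T2Space S] {p : S}

/-- A linear function in a star chart, cut off to a smooth function of the surface. -/
lemma StarChart.exists_coord (C : StarChart D p) {q₀ : S} (hq₀ : q₀ ∈ C.φ.source)
    (m : Plane →L[ℝ] ℝ) :
    ∃ b : SmoothFn S, (∀ᶠ q in 𝓝 q₀, q ∈ C.φ.source ∧ b q = m (C.φ q) ∧
      ∀ v : TangentSpace (𝓡 2) q, mvfderiv (𝓡 2) b q v = m (mvfderiv (𝓡 2) C.φ q v)) ∧
      ∀ q, (q ∈ C.φ.source → m (C.φ q) = 0) → b q = 0 := by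
  obtain ⟨χ, hχ1, hχU⟩ := exists_cutoff (C.φ.open_source.mem_nhds hq₀)
  have hm : ContMDiffOn (𝓡 2) 𝓘(ℝ, ℝ) ∞ (fun q => m (C.φ q)) C.φ.source :=
    m.contDiff.contMDiff.comp_contMDiffOn (contMDiffOn_of_mem_maximalAtlas C.mem_maximalAtlas)
  obtain ⟨b, hb⟩ := exists_cutoff_mul χ C.φ.open_source hχU hm
  refine ⟨b, ?_, ?_⟩
  · filter_upwards [C.φ.open_source.mem_nhds hq₀, hχ1.eventually_nhds] with q hq hq1
    refine ⟨hq, by rw [hb, hq1.self_of_nhds, one_mul], fun v => ?_⟩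
    rw [mvfderiv_eq_fderiv_chart C.mem_maximalAtlas hq b.mdifferentiableAt]
    have e : (b ∘ C.φ.symm) =ᶠ[𝓝 (C.φ q)] m := by
      have h1 := C.φ.continuousAt_symm (C.φ.map_source hq)
      rw [ContinuousAt, C.φ.left_inv hq] at h1
      filter_upwards [h1.eventually hq1, C.φ.open_target.mem_nhds (C.φ.map_source hq)] with x hx hxt
      simp [hb, hx, C.φ.right_inv hxt]
    rw [e.fderiv_eq, m.fderiv]
  · intro q hq
    rw [hb]
    by_cases h : q ∈ C.φ.source
    · rw [hq h, mul_zero]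
    · rw [image_eq_zero_of_notMem_tsupport fun h' => h (hχU h'), zero_mul]

/-- Tangency to a curve in a star chart. -/
lemma StarChart.mem_tangentAlong_iff (C : StarChart D p) {i : Fin D.card} {q : S}
    (hq : q ∈ C.φ.source) (hqi : q ∈ D.curve i) (v : TangentSpace (𝓡 2) q) :
    v ∈ tangentAlong (D.curve i) q ↔ C.l i (mvfderiv (𝓡 2) C.φ q v) = 0 := by
  have hpi := C.mem_curve_of_mem i q hq hqi
  constructor
  · intro hv
    -- The cut-off local equation vanishes on the whole curve, so it is an admissible test function.
    obtain ⟨b, hb1, hb2⟩ := C.exists_coord hq (C.l i)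
    rw [← hb1.self_of_nhds.2.2 v]
    exact hv b fun r hr => hb2 r fun hrs => (C.mem_curve_iff i hpi r hrs).1 hr
  · intro hv f hf
    rw [mvfderiv_eq_fderiv_chart C.mem_maximalAtlas hq f.mdifferentiableAt]
    set w := mvfderiv (𝓡 2) C.φ q v with hw
    have hx : C.φ q ∈ C.φ.target := C.φ.map_source hq
    have hfd : DifferentiableAt ℝ (f ∘ C.φ.symm) (C.φ q) := by
      have : MDifferentiableAt (𝓡 2) 𝓘(ℝ, ℝ) (f ∘ C.φ.symm) (C.φ q) :=
        MDifferentiableAt.comp (C.φ q) f.mdifferentiableAt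
          ((mdifferentiable_of_mem_maximalAtlas C.mem_maximalAtlas).mdifferentiableAt_symm hx)
      exact this.differentiableAt
    -- The chart line through q with direction w lies in the curve, so f is zero along it.
    have h1 : HasDerivAt (fun s : ℝ => C.φ q + s • w) w 0 := by
      simpa using ((hasDerivAt_id (0 : ℝ)).smul_const w).const_add (C.φ q)
    have h2 : HasDerivAt (fun s : ℝ => (f ∘ C.φ.symm) (C.φ q + s • w))
        (fderiv ℝ (f ∘ C.φ.symm) (C.φ q) w) 0 := by
      have h0 : HasFDerivAt (f ∘ C.φ.symm) (fderiv ℝ (f ∘ C.φ.symm) (C.φ q))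
          (C.φ q + (0 : ℝ) • w) := by
        rw [zero_smul, add_zero]
        exact hfd.hasFDerivAt
      exact h0.comp_hasDerivAt (0 : ℝ) h1
    refine h2.unique ((hasDerivAt_const (0 : ℝ) (0 : ℝ)).congr_of_eventuallyEq ?_)
    have h3 : ∀ᶠ s : ℝ in 𝓝 0, C.φ q + s • w ∈ C.φ.target := by
      refine h1.continuousAt.eventually (C.φ.open_target.mem_nhds ?_)
      simpa using hx
    filter_upwards [h3] with s hs
    refine hf _ ?_
    rw [C.mem_curve_iff i hpi _ (C.φ.map_target hs), C.φ.right_inv hs, map_add, map_smul, hv,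
      (C.mem_curve_iff i hpi q hq).1 hqi]
    simp

/-- A plane vector field tangent to the lines of a star chart, cut off to a section of the
`b`-tangent bundle. -/
lemma StarChart.exists_bfield (C : StarChart D p) {w : Plane → Plane} (hw : ContDiff ℝ ∞ w)
    (hl : ∀ i, p ∈ D.curve i → ∀ x, C.l i x = 0 → C.l i (w x) = 0) :
    ∃ X : BField D, ∀ᶠ q in 𝓝 p, q ∈ C.φ.source ∧ mvfderiv (𝓡 2) C.φ q (X.1 q) = w (C.φ q) := by
  obtain ⟨χ, hχ1, hχU⟩ := exists_cutoff (C.φ.open_source.mem_nhds C.mem_source)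
  obtain ⟨Z, hZ, hZw⟩ := exists_chart_field C.mem_maximalAtlas hw
  obtain ⟨X, hX⟩ := exists_cutoff_smul χ C.φ.open_source hχU hZ
  refine ⟨⟨X, fun i q hqi => ?_⟩, ?_⟩
  · by_cases hq : q ∈ C.φ.source
    · have hpi := C.mem_curve_of_mem i q hq hqi
      rw [C.mem_tangentAlong_iff hq hqi, hX, map_smul, map_smul, hZw q hq,
        hl i hpi _ ((C.mem_curve_iff i hpi q hq).1 hqi), smul_zero]
    · intro f _
      rw [hX, image_eq_zero_of_notMem_tsupport fun h' => hq (hχU h'), zero_smul, map_zero]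
  · filter_upwards [C.φ.open_source.mem_nhds C.mem_source, hχ1] with q hq hq1
    refine ⟨hq, ?_⟩
    rw [hX, hq1, one_smul, hZw q hq]

end StarCharts

/-! ### Two-forms on the plane. -/

section Area

/-- The standard area form of the plane. -/
def area (v w : Plane) : ℝ := v 0 * w 1 - v 1 * w 0

lemma clm_plane_apply (m : Plane →L[ℝ] ℝ) (v : Plane) :
    m v = v 0 * m (EuclideanSpace.single 0 1) + v 1 * m (EuclideanSpace.single 1 1) := by
  have : v = v 0 • EuclideanSpace.single 0 (1 : ℝ) + v 1 • EuclideanSpace.single 1 (1 : ℝ) := by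
    ext i
    fin_cases i <;> simp
  conv_lhs => rw [this]
  simp

lemma clm_plane_wedge (m n : Plane →L[ℝ] ℝ) (v w : Plane) :
    m v * n w - n v * m w =
      (m (EuclideanSpace.single 0 1) * n (EuclideanSpace.single 1 1) -
        n (EuclideanSpace.single 0 1) * m (EuclideanSpace.single 1 1)) * area v w := by
  rw [clm_plane_apply m v, clm_plane_apply m w, clm_plane_apply n v, clm_plane_apply n w, area]
  ring

/-- The kernel of a nonzero form on the plane is a line. Two sections of the b-tangent bundle are
thus parallel at points of the divisor. -/
lemma area_eq_zero_of_mem_ker {m : Plane →L[ℝ] ℝ} (hm : m ≠ 0) {v w : Plane} (hv : m v = 0)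
    (hw : m w = 0) : area v w = 0 := by
  have h : m (EuclideanSpace.single 0 1) ≠ 0 ∨ m (EuclideanSpace.single 1 1) ≠ 0 := by
    by_contra! H
    exact hm (by ext x; rw [clm_plane_apply, H.1, H.2]; simp)
  rw [clm_plane_apply] at hv hw
  rw [area]
  rcases h with h | h
  · exact (mul_eq_zero.1 (by linear_combination w 1 * hv - v 1 * hw :
      m (EuclideanSpace.single 0 1) * (v 0 * w 1 - v 1 * w 0) = 0)).resolve_left h
  · exact (mul_eq_zero.1 (by linear_combination v 0 * hw - w 0 * hv :
      m (EuclideanSpace.single 1 1) * (v 0 * w 1 - v 1 * w 0) = 0)).resolve_left h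

/-- A pointwise extension by continuity, for functions known to be continuous only at p. -/
lemma eq_of_eventually_eq_of_dense {X : Type*} [TopologicalSpace X] {f g : X → ℝ} {s : Set X}
    (hs : Dense s) {p : X} (hf : ContinuousAt f p) (hg : ContinuousAt g p)
    (h : ∀ᶠ q in 𝓝 p, q ∈ s → f q = g q) : f p = g p := by
  have : (𝓝[s] p).NeBot := mem_closure_iff_nhdsWithin_neBot.1 (hs p)
  refine tendsto_nhds_unique (l := 𝓝[s] p) (hf.tendsto.mono_left nhdsWithin_le_nhds)
    ((hg.tendsto.mono_left nhdsWithin_le_nhds).congr' ?_)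
  filter_upwards [nhdsWithin_le_nhds h, self_mem_nhdsWithin] with q hq hqs using (hq hqs).symm

end Area

/-! ### Locality and proportionality of b-forms. -/

section Forms

variable {S : Type*} [TopologicalSpace S] [ChartedSpace Plane S] [IsManifold (𝓡 2) ∞ S]
  {D : StarDivisor S}

/-- The two-form `db ∧ dc`. -/
noncomputable def wedge (b c : SmoothFn S) (X Y : BField D) : SmoothFn S :=
  act X.1 b * act Y.1 c - act X.1 c * act Y.1 b

lemma wedge_apply (b c : SmoothFn S) (X Y : BField D) (p : S) : wedge b c X Y p =
    mvfderiv (𝓡 2) b p (X.1 p) * mvfderiv (𝓡 2) c p (Y.1 p) -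
      mvfderiv (𝓡 2) c p (X.1 p) * mvfderiv (𝓡 2) b p (Y.1 p) := rfl

/-- A pairing of sections of the `b`-tangent bundle which, off the divisor, is given by a multiple
of the area form. -/
def IsAreaLike (F : BField D → BField D → SmoothFn S) : Prop :=
  ∀ p ∈ D.compl, ∃ κ : ℝ, ∀ X Y : BField D, F X Y p = κ * area (X.1 p) (Y.1 p)

lemma isAreaLike_wedge (b c : SmoothFn S) : IsAreaLike (wedge b c : BField D → BField D → _) :=
  fun p _ => ⟨_, fun _ _ => clm_plane_wedge (mvfderiv (𝓡 2) b p) (mvfderiv (𝓡 2) c p) _ _⟩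

/-- Two-forms on a plane are proportional, and density carries the cross-multiplied identity onto
the divisor, where the forms may no longer be given by tangent vectors of the surface. -/
lemma IsAreaLike.mul_eq_mul [T2Space S] [CompactSpace S]
    {F G : BField D → BField D → SmoothFn S} (hF : IsAreaLike F) (hG : IsAreaLike G)
    (X Y E W : BField D) (p : S) : F X Y p * G E W p = F E W p * G X Y p := by
  have h : (fun p => F X Y p * G E W p) = fun p => F E W p * G X Y p := by
    refine Continuous.ext_on D.dense_compl
      ((F X Y).contMDiff.continuous.mul (G E W).contMDiff.continuous)
      ((F E W).contMDiff.continuous.mul (G X Y).contMDiff.continuous) fun q hq => ?_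
    obtain ⟨κ, hκ⟩ := hF q hq
    obtain ⟨μ, hμ⟩ := hG q hq
    simp only [hκ, hμ]
    ring
  exact congrFun h p

lemma BField.coe_smul (f : SmoothFn S) (X : BField D) (p : S) : (f • X).1 p = f p • X.1 p := rfl

lemma BField.coe_sub (X Y : BField D) (p : S) : (X - Y).1 p = X.1 p - Y.1 p := rfl

variable [T2Space S]

/-- One-forms are local operators. -/
lemma oneForm_congr (α : BOneForm D) {X X' : BField D} {p : S}
    (h : ∀ᶠ q in 𝓝 p, X.1 q = X'.1 q) : α X p = α X' p := by
  obtain ⟨χ, hχ1, hχU⟩ := exists_cutoff h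
  -- Linearity over smooth functions localises: α kills this product, and χ p = 1.
  have h0 : χ • (X - X') = 0 := by
    ext q : 2
    rw [BField.coe_smul, BField.coe_sub]
    by_cases hq : q ∈ tsupport χ
    · rw [show X.1 q = X'.1 q from hχU hq, sub_self, smul_zero]; rfl
    · rw [image_eq_zero_of_notMem_tsupport hq, zero_smul]; rfl
  have h1 : α (χ • (X - X')) p = 0 := by rw [h0, map_zero]; rfl
  rw [map_smul, map_sub] at h1
  have h2 : χ p * (α X p - α X' p) = 0 := h1
  rw [hχ1.self_of_nhds, one_mul] at h2
  exact sub_eq_zero.1 h2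

lemma bilin_congr (η : BBilin D) {X X' Y Y' : BField D} {p : S}
    (hX : ∀ᶠ q in 𝓝 p, X.1 q = X'.1 q) (hY : ∀ᶠ q in 𝓝 p, Y.1 q = Y'.1 q) :
    η X Y p = η X' Y' p :=
  (oneForm_congr (η X) hY).trans (oneForm_congr (η.flip Y') hX)

set_option linter.unusedSectionVars false in
lemma bilin_antisymm {η : BBilin D} (alt : ∀ X, η X X = 0) (X Y : BField D) :
    η X Y = -η Y X := by
  have h := alt (X + Y)
  simp only [map_add, LinearMap.add_apply, alt, zero_add, add_zero] at h
  exact eq_neg_of_add_eq_zero_right h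

set_option linter.unusedSectionVars false in
/-- The differential of a function as a `b`-form of degree one. -/
noncomputable def dForm (b : SmoothFn S) : BOneForm D where
  toFun X := act X.1 b
  map_add' X Y := by
    ext p
    exact map_add (mvfderiv (𝓡 2) b p) (X.1 p) (Y.1 p)
  map_smul' f X := by
    ext p
    exact map_smul (mvfderiv (𝓡 2) b p) (f p) (X.1 p)

/-- The coordinates of a star chart centred off the divisor give a frame. -/
lemma exists_frame {p : S} (hp : p ∈ D.compl) :
    ∃ (b c : SmoothFn S) (e f : BField D), ∀ᶠ q in 𝓝 p,
      act e.1 b q = 1 ∧ ∀ X : BField D, X.1 q = act X.1 b q • e.1 q + act X.1 c q • f.1 q := by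
  obtain ⟨C⟩ := exists_starChart D p
  obtain ⟨b, hb, -⟩ := C.exists_coord C.mem_source (EuclideanSpace.proj 0)
  obtain ⟨c, hc, -⟩ := C.exists_coord C.mem_source (EuclideanSpace.proj 1)
  obtain ⟨e, he⟩ := C.exists_bfield (w := fun _ => EuclideanSpace.single 0 1) contDiff_const
    fun i hi => absurd hi (hp i)
  obtain ⟨f, hf⟩ := C.exists_bfield (w := fun _ => EuclideanSpace.single 1 1) contDiff_const
    fun i hi => absurd hi (hp i)
  refine ⟨b, c, e, f, ?_⟩
  filter_upwards [hb, hc, he, hf] with q hb hc he hf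
  refine ⟨?_, fun X => ?_⟩
  · rw [act_apply, hb.2.2, he.2]
    simp
  · refine (bijective_mvfderiv_chart C.mem_maximalAtlas hb.1).1 ?_
    rw [map_add, map_smul, map_smul, he.2, hf.2, act_apply, act_apply, hb.2.2, hc.2.2]
    ext i
    fin_cases i <;> simp

/-- Off the divisor a `b`-form of degree two is locally `a db ∧ dc`. -/
lemma exists_eq_mul_wedge {η : BBilin D} (alt : ∀ X, η X X = 0) {p : S} (hp : p ∈ D.compl) :
    ∃ a b c : SmoothFn S, ∀ᶠ q in 𝓝 p, ∀ X Y, η X Y q = a q * wedge b c X Y q := by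
  obtain ⟨b, c, e, f, h⟩ := exists_frame hp
  refine ⟨η e f, b, c, ?_⟩
  filter_upwards [h.eventually_nhds] with q hq X Y
  -- By locality X and Y may be replaced by their expansions in the frame e, f.
  have hX : ∀ᶠ r in 𝓝 q, X.1 r = (act X.1 b • e + act X.1 c • f).1 r := by
    filter_upwards [hq] with r hr using hr.2 X
  have hY : ∀ᶠ r in 𝓝 q, Y.1 r = (act Y.1 b • e + act Y.1 c • f).1 r := by
    filter_upwards [hq] with r hr using hr.2 Y
  rw [bilin_congr η hX hY]
  simp only [map_add, map_smul, LinearMap.add_apply, LinearMap.smul_apply, alt, smul_zero,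
    zero_add, add_zero]
  rw [bilin_antisymm alt f e]
  change act Y.1 b q * (act X.1 c q * -(η e f q)) + act Y.1 c q * (act X.1 b q * η e f q) =
    η e f q * (act X.1 b q * act Y.1 c q - act X.1 c q * act Y.1 b q)
  ring

lemma isAreaLike_bilin {η : BBilin D} (alt : ∀ X, η X X = 0) :
    IsAreaLike fun X Y => η X Y := by
  intro p hp
  obtain ⟨a, b, c, h⟩ := exists_eq_mul_wedge alt hp
  obtain ⟨κ, hκ⟩ := isAreaLike_wedge (D := D) b c p hp
  exact ⟨a p * κ, fun X Y => by rw [h.self_of_nhds, hκ, mul_assoc]⟩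

end Forms

/-! ### Logarithmic one-forms, nonvanishing and local frames. -/

section Nondegenerate

variable {S : Type*} [TopologicalSpace S] [ChartedSpace Plane S] [IsManifold (𝓡 2) ∞ S]
  [T2Space S] {D : StarDivisor S} {p : S}

/-- Hadamard's lemma for a curve of the divisor. -/
lemma StarChart.exists_div (C : StarChart D p) {i : Fin D.card} (hi : p ∈ D.curve i) :
    ∃ χ : SmoothFn S, (∀ᶠ q in 𝓝 p, χ q = 1) ∧ ∀ f : SmoothFn S, (∀ q ∈ D.curve i, f q = 0) →
      ∃ k : SmoothFn S, (∀ q ∈ C.φ.source, χ q * f q = C.l i (C.φ q) * k q) ∧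
        ∀ q ∉ C.φ.source, k q = 0 := by
  -- `χ₀` makes f smooth on the whole plane for the division, `χ₁` brings the quotient back to the
  -- surface. Their product does not depend on f, so the quotient will be linear in f.
  obtain ⟨χ₀, hχ₀, hχ₀1, hχ₀U⟩ := exists_contDiff_cutoff
    (C.φ.open_target.mem_nhds (C.φ.map_source C.mem_source))
  obtain ⟨χ₁, hχ₁1, hχ₁U⟩ := exists_cutoff (C.φ.open_source.mem_nhds C.mem_source)
  have hφ := contMDiffOn_of_mem_maximalAtlas C.mem_maximalAtlas
  obtain ⟨χ, hχ⟩ := exists_cutoff_mul χ₁ C.φ.open_source hχ₁U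
    (hχ₀.contMDiff.comp_contMDiffOn hφ)
  refine ⟨χ, ?_, fun f hf => ?_⟩
  · filter_upwards [hχ₁1, (C.φ.continuousAt C.mem_source).eventually hχ₀1] with q h1 h2
    simp [hχ, h1, h2]
  · have hF : ContDiff ℝ ∞ fun x => χ₀ x * f (C.φ.symm x) := by
      refine hχ₀.mul_of_tsupport_subset C.φ.open_target hχ₀U ?_
      rw [← contMDiffOn_iff_contDiffOn]
      exact f.contMDiff.comp_contMDiffOn (contMDiffOn_symm_of_mem_maximalAtlas C.mem_maximalAtlas)
    obtain ⟨k, hk, hFk⟩ := exists_contDiff_eq_mul_of_eq_zero hF (C.l_ne_zero i hi) (by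
      intro x hx
      by_cases hxt : x ∈ C.φ.target
      · rw [hf _ ((C.mem_curve_iff i hi _ (C.φ.map_target hxt)).2 (by rwa [C.φ.right_inv hxt])),
          mul_zero]
      · rw [image_eq_zero_of_notMem_tsupport fun h => hxt (hχ₀U h), zero_mul])
    obtain ⟨k', hk'⟩ := exists_cutoff_mul χ₁ C.φ.open_source hχ₁U
      (hk.contMDiff.comp_contMDiffOn hφ)
    refine ⟨k', fun q hq => ?_, fun q hq => ?_⟩
    · have := hFk (C.φ q)
      rw [C.φ.left_inv hq] at this
      rw [hχ, hk']
      simp only [Function.comp_apply]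
      linear_combination χ₁ q * this
    · rw [hk', image_eq_zero_of_notMem_tsupport fun h => hq (hχ₁U h), zero_mul]

-- The equation of the curve is nonzero on a dense set. Uniqueness of the quotient gives linearity
-- of the logarithmic form below.
set_option linter.unusedSectionVars false in
lemma StarChart.div_unique (C : StarChart D p) {i : Fin D.card} (hi : p ∈ D.curve i)
    {k k' : SmoothFn S} (h : ∀ q ∈ C.φ.source, C.l i (C.φ q) * k q = C.l i (C.φ q) * k' q)
    (hk : ∀ q ∉ C.φ.source, k q = 0) (hk' : ∀ q ∉ C.φ.source, k' q = 0) : k = k' := by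
  have : (⇑k : S → ℝ) = k' := by
    refine Continuous.ext_on (D.dense_compl_curve i) k.contMDiff.continuous
      k'.contMDiff.continuous fun q hq => ?_
    by_cases hqs : q ∈ C.φ.source
    · exact mul_left_cancel₀ (fun h0 => hq ((C.mem_curve_iff i hi q hqs).2 h0)) (h q hqs)
    · rw [hk q hqs, hk' q hqs]
  exact DFunLike.coe_injective this

/-- A logarithmic one-form with a given curve as polar locus. -/
lemma StarChart.exists_dlog (C : StarChart D p) {i : Fin D.card} (hi : p ∈ D.curve i) :
    ∃ β : BOneForm D, ∃ E : BField D, β E p = 1 := by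
  obtain ⟨χ, hχ1, hdiv⟩ := C.exists_div hi
  obtain ⟨u, hu, hu0⟩ := C.exists_coord C.mem_source (C.l i)
  have hucurve : ∀ q ∈ D.curve i, u q = 0 := fun q hq =>
    hu0 q fun hqs => (C.mem_curve_iff i hi q hqs).1 hq
  -- X is tangent to the curve, so X u vanishes on it and is divisible by its equation; the quotient
  -- is (χ du/u)(X).
  have hex : ∀ X : BField D, ∃ k : SmoothFn S,
      (∀ q ∈ C.φ.source, χ q * act X.1 u q = C.l i (C.φ q) * k q) ∧
        ∀ q ∉ C.φ.source, k q = 0 := fun X =>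
    hdiv (act X.1 u) fun q hq => X.2 i q hq u hucurve
  choose k hk hk0 using hex
  let β : BOneForm D :=
    { toFun := k
      map_add' := fun X Y => by
        refine C.div_unique hi (fun q hq => ?_) (hk0 _) fun q hq => ?_
        · rw [← hk _ q hq]
          change _ = C.l i (C.φ q) * (k X q + k Y q)
          rw [mul_add, ← hk X q hq, ← hk Y q hq, ← mul_add]
          exact congrArg (χ q * ·) (map_add (mvfderiv (𝓡 2) u q) (X.1 q) (Y.1 q))
        · change k X q + k Y q = 0
          rw [hk0 X q hq, hk0 Y q hq, add_zero]
      map_smul' := fun f X => by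
        refine C.div_unique hi (fun q hq => ?_) (hk0 _) fun q hq => ?_
        · rw [← hk _ q hq]
          change _ = C.l i (C.φ q) * (f q * k X q)
          rw [mul_left_comm, ← hk X q hq, mul_left_comm]
          exact congrArg (χ q * ·) (map_smul (mvfderiv (𝓡 2) u q) (f q) (X.1 q))
        · change f q * k X q = 0
          rw [hk0 X q hq, mul_zero] }
  -- The Euler field is tangent to every line through the origin, and du/u takes the value 1 on it.
  obtain ⟨E, hE⟩ := C.exists_bfield (w := id) contDiff_id fun _ _ _ h => h
  refine ⟨β, E, ?_⟩
  refine eq_of_eventually_eq_of_dense (f := β E) (g := fun _ => 1) (D.dense_compl_curve i)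
    (β E).contMDiff.continuous.continuousAt continuousAt_const ?_
  filter_upwards [hχ1, hu, hE] with q h1 h2 h3 hq
  have := hk E q h2.1
  rw [h1, one_mul, act_apply, h2.2.2, h3.2] at this
  exact (mul_left_cancel₀ (fun h0 => hq ((C.mem_curve_iff i hi q h2.1).2 h0))
    (this.symm.trans (mul_one _).symm))

/-- A log symplectic form vanishes nowhere. -/
lemma LogSymplecticForm.exists_ne_zero (η : LogSymplecticForm D) (p : S) :
    ∃ E W : BField D, η.form E W p ≠ 0 := by
  -- Surjectivity of the flat map makes every one-form a contraction of η, so a one-form nonzero at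
  -- p suffices: db off the divisor, a logarithmic form on it.
  have key : ∀ β : BOneForm D, ∀ W : BField D, β W p = 1 → ∃ E W : BField D, η.form E W p ≠ 0 := by
    intro β W h
    obtain ⟨E, hE⟩ := η.nondegenerate.2 β
    exact ⟨E, W, by rw [hE, h]; exact one_ne_zero⟩
  by_cases hp : p ∈ D.compl
  · obtain ⟨b, c, e, f, h⟩ := exists_frame hp
    exact key (dForm b) e h.self_of_nhds.1
  · simp only [StarDivisor.compl, Set.mem_ofPred_eq, not_forall, not_not] at hp
    obtain ⟨i, hi⟩ := hp
    obtain ⟨C⟩ := exists_starChart D p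
    obtain ⟨β, E, h⟩ := C.exists_dlog hi
    exact key β E h

/-- The curves of a star chart. -/
noncomputable def StarChart.curves (_ : StarChart D p) : Finset (Fin D.card) :=
  open scoped Classical in Finset.univ.filter fun i => p ∈ D.curve i

set_option linter.unusedSectionVars false in
lemma StarChart.mem_curves (C : StarChart D p) {i : Fin D.card} :
    i ∈ C.curves ↔ p ∈ D.curve i := by
  simp [StarChart.curves]

/-- Near every point there are two sections of the `b`-tangent bundle whose coordinate
determinant is the equation of the divisor. -/
lemma StarChart.exists_frame (C : StarChart D p) :
    ∃ (b c : SmoothFn S) (E W : BField D), ∀ᶠ q in 𝓝 p, q ∈ C.φ.source ∧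
      (∀ v w : TangentSpace (𝓡 2) q, mvfderiv (𝓡 2) b q v * mvfderiv (𝓡 2) c q w -
        mvfderiv (𝓡 2) c q v * mvfderiv (𝓡 2) b q w =
          area (mvfderiv (𝓡 2) C.φ q v) (mvfderiv (𝓡 2) C.φ q w)) ∧
      wedge b c E W q = ∏ i ∈ C.curves, C.l i (C.φ q) := by
  classical
  obtain ⟨b, hb, -⟩ := C.exists_coord C.mem_source (EuclideanSpace.proj 0)
  obtain ⟨c, hc, -⟩ := C.exists_coord C.mem_source (EuclideanSpace.proj 1)
  suffices H : ∃ e w : Plane → Plane, ContDiff ℝ ∞ e ∧ ContDiff ℝ ∞ w ∧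
      (∀ i, p ∈ D.curve i → ∀ x, C.l i x = 0 → C.l i (e x) = 0) ∧
      (∀ i, p ∈ D.curve i → ∀ x, C.l i x = 0 → C.l i (w x) = 0) ∧
      ∀ x, area (e x) (w x) = ∏ i ∈ C.curves, C.l i x by
    obtain ⟨e, w, he, hw, he', hw', hew⟩ := H
    obtain ⟨E, hE⟩ := C.exists_bfield he he'
    obtain ⟨W, hW⟩ := C.exists_bfield hw hw'
    refine ⟨b, c, E, W, ?_⟩
    filter_upwards [hb, hc, hE, hW] with q hb hc hE hW
    refine ⟨hb.1, fun v w => ?_, ?_⟩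
    · rw [hb.2.2, hb.2.2, hc.2.2, hc.2.2]
      rfl
    · rw [wedge_apply, hb.2.2, hb.2.2, hc.2.2, hc.2.2, hE.2, hW.2, ← hew]
      rfl
  rcases C.curves.eq_empty_or_nonempty with h | ⟨i₀, hi₀⟩
  · refine ⟨fun _ => EuclideanSpace.single 0 1, fun _ => EuclideanSpace.single 1 1, contDiff_const,
      contDiff_const, ?_, ?_, ?_⟩
    · intro i hi
      rw [← C.mem_curves, h] at hi
      simp at hi
    · intro i hi
      rw [← C.mem_curves, h] at hi
      simp at hi
    · intro x
      simp [h, area]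
  -- τ spans ker (l i₀) and area x τ = l i₀ x. So the Euler field and τ times the product of the
  -- other equations are tangent to all lines and have determinant the full product.
  · let τ : Plane := !₂[-C.l i₀ (EuclideanSpace.single 1 1), C.l i₀ (EuclideanSpace.single 0 1)]
    have hτ : C.l i₀ τ = 0 := by
      rw [clm_plane_apply]
      simp [τ]
      ring
    refine ⟨id, fun x => (∏ j ∈ C.curves.erase i₀, C.l j x) • τ, contDiff_id, ?_,
      fun _ _ _ h => h, ?_, ?_⟩
    · exact (contDiff_prod fun j _ => (C.l j).contDiff).smul contDiff_const
    · intro i hi x hx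
      rw [map_smul]
      by_cases h : i = i₀
      · rw [h, hτ, smul_zero]
      · rw [Finset.prod_eq_zero (Finset.mem_erase.2 ⟨h, C.mem_curves.2 hi⟩) hx, zero_smul]
    · intro x
      rw [← Finset.mul_prod_erase _ _ hi₀, clm_plane_apply (C.l i₀) x]
      simp [area, τ]
      ring

end Nondegenerate

/-! ### Push-forward, pull-back and Cartan's formula. -/

section Pull

variable {S : Type*} [TopologicalSpace S] [ChartedSpace Plane S] [IsManifold (𝓡 2) ∞ S]
  {D : StarDivisor S}

lemma act_congr (X : VField S) {f g : SmoothFn S} {p : S} (h : ∀ᶠ q in 𝓝 p, f q = g q) :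
    act X f p = act X g p := by
  have h' : (⇑f : S → ℝ) =ᶠ[𝓝 p] g := h
  change mfderiv (𝓡 2) 𝓘(ℝ, ℝ) f p (X p) = mfderiv (𝓡 2) 𝓘(ℝ, ℝ) g p (X p)
  rw [h'.mfderiv_eq]
  rfl

lemma act_mul (X : VField S) (f g : SmoothFn S) (p : S) :
    act X (f * g) p = f p * act X g p + g p * act X f p := by
  rw [act_apply]
  rw [show (⇑(f * g) : S → ℝ) = ⇑f * ⇑g from rfl,
    mvfderiv_mul f.mdifferentiableAt g.mdifferentiableAt]
  rfl

lemma act_sub (X : VField S) (f g : SmoothFn S) (p : S) :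
    act X (f - g) p = act X f p - act X g p := by
  rw [act_apply, show (⇑(f - g) : S → ℝ) = ⇑f - ⇑g from rfl,
    mvfderiv_sub f.mdifferentiableAt g.mdifferentiableAt]
  rfl

/-- Vector fields are determined by their action on functions. -/
lemma VField.ext_act [T2Space S] (D : StarDivisor S) {X Y : VField S}
    (h : ∀ (f : SmoothFn S) (p : S), act X f p = act Y f p) : X = Y := by
  ext p : 1
  obtain ⟨C⟩ := exists_starChart D p
  refine (bijective_mvfderiv_chart C.mem_maximalAtlas C.mem_source).1 ?_
  ext i
  obtain ⟨b, hb, -⟩ := C.exists_coord C.mem_source (EuclideanSpace.proj i)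
  have := h b p
  rw [act_apply, act_apply, hb.self_of_nhds.2.2, hb.self_of_nhds.2.2] at this
  exact this

set_option linter.unusedSectionVars false in
/-- The chain rule for a function along a curve. -/
lemma hasDerivAt_comp_curve (f : SmoothFn S) {q : ℝ → S} {t : ℝ} {v : TangentSpace (𝓡 2) (q t)}
    (hq : HasMFDerivAt 𝓘(ℝ, ℝ) (𝓡 2) q t ((1 : ℝ →L[ℝ] ℝ).smulRight v)) :
    HasDerivAt (fun s => f (q s)) (mvfderiv (𝓡 2) f (q t) v) t := by
  have h1 := (f.mdifferentiableAt (x := q t)).hasMFDerivAt.comp t hq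
  have h3 : HasFDerivAt (fun s : ℝ => f (q s))
      (show ℝ →L[ℝ] ℝ from (mfderiv (𝓡 2) 𝓘(ℝ, ℝ) f (q t)).comp
        ((1 : ℝ →L[ℝ] ℝ).smulRight v)) t := h1.hasFDerivAt
  refine h3.hasDerivAt.congr_deriv ?_
  change mfderiv (𝓡 2) 𝓘(ℝ, ℝ) f (q t) ((1 : ℝ) • v) = _
  rw [one_smul]
  rfl

/-- A `b`-diffeomorphism as a smooth map. -/
noncomputable abbrev BDiffeo.map (ψ : BDiffeo D) : C^∞⟮𝓡 2, S; 𝓡 2, S⟯ :=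
  ⟨ψ.toDiffeo, ψ.toDiffeo.contMDiff⟩

lemma BDiffeo.act_push (ψ : BDiffeo D) (X : BField D) (f : SmoothFn S) (p : S) :
    act (ψ.push X).1 f (ψ.toDiffeo p) = act X.1 (f.comp ψ.map) p := by
  have key : ∀ q, act (ψ.push X).1 f q = act X.1 (f.comp ψ.map) (ψ.toDiffeo.symm q) := by
    intro q
    exact (mvfderiv_comp_apply_of_eq (I := 𝓡 2) (ψ.toDiffeo.symm q)
      (f.mdifferentiableAt (x := q))
      (ψ.toDiffeo.contMDiff.mdifferentiable (by simp) (ψ.toDiffeo.symm q))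
      (ψ.toDiffeo.apply_symm_apply q) (X.1 (ψ.toDiffeo.symm q))).symm
  rw [key, ψ.toDiffeo.symm_apply_apply]

lemma BDiffeo.act_push_comp (ψ : BDiffeo D) (X : BField D) (f : SmoothFn S) :
    (act (ψ.push X).1 f).comp ψ.map = act X.1 (f.comp ψ.map) := by
  ext p
  exact ψ.act_push X f p

lemma BDiffeo.push_add (ψ : BDiffeo D) (X Y : BField D) :
    ψ.push (X + Y) = ψ.push X + ψ.push Y := by
  ext q : 2
  exact map_add (mfderiv (𝓡 2) (𝓡 2) ψ.toDiffeo (ψ.toDiffeo.symm q)) _ _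

lemma BDiffeo.push_smul (ψ : BDiffeo D) (f : SmoothFn S) (X : BField D) :
    ψ.push (f • X) = (f.comp ⟨ψ.toDiffeo.symm, ψ.toDiffeo.symm.contMDiff⟩ : SmoothFn S) •
      ψ.push X := by
  ext q : 2
  exact map_smul (mfderiv (𝓡 2) (𝓡 2) ψ.toDiffeo (ψ.toDiffeo.symm q)) _ _

/-- Fields are compared through their action on functions, where the bracket is a commutator. -/
lemma BDiffeo.push_bbracket [T2Space S] (ψ : BDiffeo D) (X Y : BField D) :
    ψ.push (bbracket X Y) = bbracket (ψ.push X) (ψ.push Y) := by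
  refine Subtype.ext (VField.ext_act D fun f q => ?_)
  obtain ⟨p, hp⟩ : ∃ p, ψ.toDiffeo p = q :=
    ⟨ψ.toDiffeo.symm q, ψ.toDiffeo.apply_symm_apply q⟩
  subst hp
  rw [ψ.act_push]
  change act (vbracket X.1 Y.1) (f.comp ψ.map) p =
    act (vbracket (ψ.push X).1 (ψ.push Y).1) f (ψ.toDiffeo p)
  rw [act_vbracket, act_vbracket, ψ.act_push, ψ.act_push, ψ.act_push_comp, ψ.act_push_comp]

/-- Pull-back of a `b`-form of degree one by a `b`-diffeomorphism. -/
noncomputable def BDiffeo.pullOne (ψ : BDiffeo D) (α : BOneForm D) : BOneForm D where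
  toFun X := (α (ψ.push X)).comp ψ.map
  map_add' X Y := by
    rw [ψ.push_add, map_add]
    rfl
  map_smul' f X := by
    rw [ψ.push_smul, map_smul]
    ext p
    change f (ψ.toDiffeo.symm (ψ.toDiffeo p)) * _ = _
    rw [ψ.toDiffeo.symm_apply_apply]
    rfl

lemma BDiffeo.pullOne_apply (ψ : BDiffeo D) (α : BOneForm D) (X : BField D) (p : S) :
    ψ.pullOne α X p = α (ψ.push X) (ψ.toDiffeo p) := rfl

/-- The differential commutes with pull-back. -/
lemma BDiffeo.bdOne_pullOne [T2Space S] (ψ : BDiffeo D) (α : BOneForm D) (X Y : BField D) (p : S) :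
    bdOne (ψ.pullOne α) X Y p = bdOne α (ψ.push X) (ψ.push Y) (ψ.toDiffeo p) := by
  change act X.1 ((α (ψ.push Y)).comp ψ.map) p - act Y.1 ((α (ψ.push X)).comp ψ.map) p -
      α (ψ.push (bbracket X Y)) (ψ.toDiffeo p) =
    act (ψ.push X).1 (α (ψ.push Y)) (ψ.toDiffeo p) - act (ψ.push Y).1 (α (ψ.push X)) (ψ.toDiffeo p)
      - α (bbracket (ψ.push X) (ψ.push Y)) (ψ.toDiffeo p)
  rw [ψ.push_bbracket, ψ.act_push, ψ.act_push]

set_option linter.unusedSectionVars false in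
lemma BDiffeo.mem_curve_iff (ψ : BDiffeo D) (i : Fin D.card) (p : S) :
    ψ.toDiffeo p ∈ D.curve i ↔ p ∈ D.curve i := by
  constructor
  · intro h
    obtain ⟨r, hr, hrp⟩ := (ψ.image_curve i).symm ▸ h
    exact ψ.toDiffeo.injective hrp ▸ hr
  · intro h
    exact ψ.image_curve i ▸ Set.mem_image_of_mem _ h

lemma BDiffeo.mem_compl (ψ : BDiffeo D) {p : S} (hp : p ∈ D.compl) :
    ψ.toDiffeo p ∈ D.compl := fun i h => hp i ((ψ.mem_curve_iff i p).1 h)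

/-- A function pulled back by an isotopy. -/
noncomputable def BIsotopy.pullFn (γ : BIsotopy D) (a : SmoothFn S) : TFn S :=
  ⟨fun z => a ((γ.at_time z.1).toDiffeo z.2), a.contMDiff.comp γ.smooth⟩

set_option linter.unusedSectionVars false in
lemma BIsotopy.slice_pullFn (γ : BIsotopy D) (a : SmoothFn S) (t : ℝ) :
    (γ.pullFn a).slice t = a.comp (γ.at_time t).map := rfl

lemma BIsotopy.act_pullFn (γ : BIsotopy D) (a : SmoothFn S) (X : BField D) (t : ℝ) (p : S) :
    TFn.act X.1 (γ.pullFn a) (t, p) =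
      act ((γ.at_time t).push X).1 a ((γ.at_time t).toDiffeo p) := by
  rw [TFn.act_apply, BIsotopy.slice_pullFn, BDiffeo.act_push]

/-- `V` is the velocity field of the isotopy at time `t`. -/
def BIsotopy.IsVelocity (γ : BIsotopy D) (t : ℝ) (V : BField D) : Prop :=
  ∀ p, HasMFDerivAt 𝓘(ℝ, ℝ) (𝓡 2) (fun s => (γ.at_time s).toDiffeo p) t
    ((1 : ℝ →L[ℝ] ℝ).smulRight (V.1 ((γ.at_time t).toDiffeo p)))

lemma BIsotopy.IsVelocity.dot_pullFn {γ : BIsotopy D} {t : ℝ} {V : BField D}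
    (hV : γ.IsVelocity t V) (a : SmoothFn S) (p : S) :
    (γ.pullFn a).dot (t, p) = act V.1 a ((γ.at_time t).toDiffeo p) := by
  refine ((γ.pullFn a).hasDerivAt_dot t p).unique ?_
  exact hasDerivAt_comp_curve a (hV p)

/-- The three-form l ∧ m ∧ n vanishes because the plane has dimension two. -/
lemma det_plane_eq_zero (l m n : Plane →L[ℝ] ℝ) (u v w : Plane) :
    l u * (m v * n w - n v * m w) - l v * (m u * n w - n u * m w) +
      l w * (m u * n v - n u * m v) = 0 := by
  rw [clm_plane_apply l u, clm_plane_apply l v, clm_plane_apply l w, clm_plane_apply m u,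
    clm_plane_apply m v, clm_plane_apply m w, clm_plane_apply n u, clm_plane_apply n v,
    clm_plane_apply n w]
  ring

/-- Cartan's formula for an isotopy, off the divisor: the time derivative of the pull-back of a
two-form is the differential of the pull-back of its contraction with the velocity. -/
theorem BIsotopy.hasDerivAt_pull [T2Space S] (γ : BIsotopy D) {t : ℝ} {V : BField D}
    (hV : γ.IsVelocity t V) {η : BBilin D} (alt : ∀ X, η X X = 0) {p : S} (hp : p ∈ D.compl)
    (X Y : BField D) :
    HasDerivAt (fun s => (γ.at_time s).pull η X Y p)
      (bdOne ((γ.at_time t).pullOne (η V)) X Y p) t := by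
  obtain ⟨a, b, c, h⟩ := exists_eq_mul_wedge alt ((γ.at_time t).mem_compl hp)
  set A := γ.pullFn a
  set B := γ.pullFn b
  set C := γ.pullFn c
  have hcont : Continuous fun z : ℝ × S => (γ.at_time z.1).toDiffeo z.2 := γ.smooth.continuous
  -- The pull-back of a db ∧ dc is A dB ∧ dC, where A, B, C are the functions pulled back along the
  -- isotopy.
  have e1 : ∀ᶠ s in 𝓝 t, (γ.at_time s).pull η X Y p = A (s, p) *
      (TFn.act X.1 B (s, p) * TFn.act Y.1 C (s, p) -
        TFn.act X.1 C (s, p) * TFn.act Y.1 B (s, p)) := by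
    have h1 : Continuous fun s => (γ.at_time s).toDiffeo p :=
      hcont.comp (by fun_prop : Continuous fun s : ℝ => (s, p))
    filter_upwards [h1.continuousAt.eventually h] with s hs
    rw [γ.act_pullFn, γ.act_pullFn, γ.act_pullFn, γ.act_pullFn]
    exact hs _ _
  -- The pulled-back contraction with the velocity is A(Ḃ dC - Ċ dB).
  have e2 : ∀ Z : BField D, ∀ᶠ q in 𝓝 p, (γ.at_time t).pullOne (η V) Z q =
      (A.slice t * (B.dot.slice t * act Z.1 (C.slice t) - C.dot.slice t * act Z.1 (B.slice t))) q := by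
    intro Z
    have h1 : Continuous fun q => (γ.at_time t).toDiffeo q :=
      hcont.comp (by fun_prop : Continuous fun q : S => (t, q))
    filter_upwards [h1.continuousAt.eventually h] with q hq
    rw [BDiffeo.pullOne_apply, hq]
    change _ = A (t, q) * (B.dot (t, q) * act Z.1 (C.slice t) q - C.dot (t, q) *
      act Z.1 (B.slice t) q)
    rw [hV.dot_pullFn, hV.dot_pullFn, ← TFn.act_apply, ← TFn.act_apply, γ.act_pullFn,
      γ.act_pullFn]
    rfl
  -- The defect in Cartan's formula is da ∧ db ∧ dc on the velocity and the two pushed fields.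
  have hdet := det_plane_eq_zero (mvfderiv (𝓡 2) a ((γ.at_time t).toDiffeo p))
    (mvfderiv (𝓡 2) b ((γ.at_time t).toDiffeo p)) (mvfderiv (𝓡 2) c ((γ.at_time t).toDiffeo p))
    (V.1 ((γ.at_time t).toDiffeo p)) (((γ.at_time t).push X).1 ((γ.at_time t).toDiffeo p))
    (((γ.at_time t).push Y).1 ((γ.at_time t).toDiffeo p))
  have hdet' : A.dot (t, p) * (TFn.act X.1 B (t, p) * TFn.act Y.1 C (t, p) -
        TFn.act X.1 C (t, p) * TFn.act Y.1 B (t, p)) -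
      TFn.act X.1 A (t, p) * (B.dot (t, p) * TFn.act Y.1 C (t, p) -
        C.dot (t, p) * TFn.act Y.1 B (t, p)) +
      TFn.act Y.1 A (t, p) * (B.dot (t, p) * TFn.act X.1 C (t, p) -
        C.dot (t, p) * TFn.act X.1 B (t, p)) = 0 := by
    simp only [A, B, C, γ.act_pullFn, hV.dot_pullFn]
    exact hdet
  refine HasDerivAt.congr_of_eventuallyEq ?_ e1
  have hd := (A.hasDerivAt_dot t p).mul
    ((((TFn.act X.1 B).hasDerivAt_dot t p).mul ((TFn.act Y.1 C).hasDerivAt_dot t p)).sub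
    (((TFn.act X.1 C).hasDerivAt_dot t p).mul ((TFn.act Y.1 B).hasDerivAt_dot t p)))
  refine hd.congr_deriv ?_
  change _ = act X.1 ((γ.at_time t).pullOne (η V) Y) p - act Y.1 ((γ.at_time t).pullOne (η V) X) p -
    (γ.at_time t).pullOne (η V) (bbracket X Y) p
  rw [act_congr X.1 (e2 Y), act_congr Y.1 (e2 X), (e2 (bbracket X Y)).self_of_nhds]
  simp only [ContMDiffMap.coe_mul, ContMDiffMap.coe_sub, Pi.mul_apply, Pi.sub_apply, act_mul,
    act_sub]
  rw [show act (bbracket X Y).1 (C.slice t) p = _ from act_vbracket X.1 Y.1 _ p,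
    show act (bbracket X Y).1 (B.slice t) p = _ from act_vbracket X.1 Y.1 _ p]
  simp only [TFn.dot_act, TFn.act_apply] at hdet' ⊢
  simp only [TFn.slice_apply]
  linear_combination hdet'

end Pull

/-! ### Isotopies generated by fields tangent to the divisor. -/

section Flow

variable {S : Type*} [TopologicalSpace S] [ChartedSpace Plane S] [IsManifold (𝓡 2) ∞ S]
  {D : StarDivisor S}

/-- The solution of a linear differential equation that vanishes somewhere vanishes nearby. -/
lemma eventually_eq_zero_of_hasDerivAt_mul {y m : ℝ → ℝ} {t : ℝ} (hm : ContinuousAt m t)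
    (hy : ∀ᶠ s in 𝓝 t, HasDerivAt y (m s * y s) s) (h0 : y t = 0) : ∀ᶠ s in 𝓝 t, y s = 0 := by
  have hb : ∀ᶠ s in 𝓝 t, ‖m s‖₊ ≤ ‖m t‖₊ + 1 := by
    have : ∀ᶠ s in 𝓝 t, ‖m s‖₊ < ‖m t‖₊ + 1 :=
      hm.nnnorm.eventually_lt continuousAt_const (lt_add_one _)
    exact this.mono fun _ => le_of_lt
  refine ODE_solution_unique_of_eventually (v := fun s x => m s * x) (s := fun _ => Set.univ)
    (K := ‖m t‖₊ + 1) (g := fun _ => 0) ?_ (hy.mono fun s hs => ⟨hs, trivial⟩) ?_ h0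
  · filter_upwards [hb] with s hs
    refine LipschitzWith.lipschitzOnWith (LipschitzWith.of_dist_le_mul fun a b => ?_)
    rw [Real.dist_eq, Real.dist_eq, ← mul_sub, abs_mul]
    exact mul_le_mul_of_nonneg_right (by exact_mod_cast hs) (abs_nonneg _)
  · filter_upwards with s
    exact ⟨by simpa using hasDerivAt_const s (0 : ℝ), trivial⟩

/-- Curves along a field tangent to the divisor that touch the divisor stay in it. -/
lemma mem_curve_of_mem_curve [T2Space S] (v : BField D) (i : Fin D.card) {q : ℝ → S} {a : ℝ → ℝ}
    (ha : Continuous a) (hq : ∀ t, HasMFDerivAt 𝓘(ℝ, ℝ) (𝓡 2) q t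
      ((1 : ℝ →L[ℝ] ℝ).smulRight (a t • v.1 (q t)))) {s : ℝ} (hs : q s ∈ D.curve i) (t : ℝ) :
    q t ∈ D.curve i := by
  have hcont : Continuous q := continuous_iff_continuousAt.2 fun t => (hq t).continuousAt
  suffices h : IsClopen (q ⁻¹' D.curve i) by
    have := h.eq_univ ⟨s, hs⟩
    exact (this ▸ trivial : t ∈ q ⁻¹' D.curve i)
  refine ⟨(D.isClosed i).preimage hcont, isOpen_iff_mem_nhds.2 fun t ht => ?_⟩
  obtain ⟨C⟩ := exists_starChart D (q t)
  -- For the local equation u, Hadamard gives v u = k u, so u along q solves a linear equation with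
  -- a zero at t and vanishes nearby. The times spent in the curve thus form an open and closed set.
  obtain ⟨u, hu, hu0⟩ := C.exists_coord C.mem_source (C.l i)
  have hu0' : ∀ r ∈ D.curve i, u r = 0 := fun r hr =>
    hu0 r fun hrs => (C.mem_curve_iff i ht r hrs).1 hr
  obtain ⟨χ, hχ, hdiv⟩ := C.exists_div ht
  obtain ⟨k, hk, -⟩ := hdiv (act v.1 u) fun r hr => v.2 i r hr u hu0'
  have hev := hcont.continuousAt.eventually (hu.and hχ)
  have hy : ∀ᶠ s in 𝓝 t, HasDerivAt (fun s => u (q s)) ((a s * k (q s)) * u (q s)) s := by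
    filter_upwards [hev] with s hs
    refine (hasDerivAt_comp_curve u (hq s)).congr_deriv ?_
    have := hk (q s) hs.1.1
    rw [hs.2, one_mul, act_apply, ← hs.1.2.1] at this
    rw [map_smul, this, smul_eq_mul]
    ring
  have hz := eventually_eq_zero_of_hasDerivAt_mul
    (ha.mul (k.contMDiff.continuous.comp hcont)).continuousAt hy (hu0' _ ht)
  filter_upwards [hz, hev] with s hs1 hs2
  exact (C.mem_curve_iff i ht _ hs2.1.1).2 (hs2.1.2.1 ▸ hs1)

/-- A time-dependent field `∂_t + h X` on a compact surface, with `h` supported in the unit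
interval of times, is complete. -/
lemma exists_flow [T2Space S] [CompactSpace S] (X : VField S) (h : TFn S)
    (h0 : ∀ t p, t ≤ 0 ∨ 1 ≤ t → h (t, p) = 0) :
    ∃ Γ : ℝ × (ℝ × S) → ℝ × S, (∀ z, Γ (0, z) = z) ∧ ∀ z,
      IsMIntegralCurve (I := 𝓘(ℝ, ℝ).prod (𝓡 2)) (fun t => Γ (t, z))
        (fun z : ℝ × S => ((1 : ℝ), h z • X z.2)) := by
  set w : (z : ℝ × S) → TangentSpace (𝓘(ℝ, ℝ).prod (𝓡 2)) z :=
    fun z => ((1 : ℝ), h z • X z.2) with hw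
  have hsm := contMDiff_prod_section_smul h.contMDiff X
  have hK : IsCompact ((Set.Icc (-1 : ℝ) 2) ×ˢ (Set.univ : Set S)) :=
    isCompact_Icc.prod isCompact_univ
  -- Compactness gives a uniform existence time over [-1, 2]. Starting outside these times the field
  -- is just ∂_t for at least one unit of time.
  obtain ⟨ε, hε, hεK⟩ : ∃ ε > (0 : ℝ), ∀ z ∈ (Set.Icc (-1 : ℝ) 2) ×ˢ (Set.univ : Set S),
      ∃ c : ℝ → ℝ × S, c 0 = z ∧ IsMIntegralCurveOn c w (Set.Ioo (-ε) ε) := by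
    refine hK.induction_on (p := fun K => ∃ ε > (0 : ℝ), ∀ z ∈ K,
      ∃ c : ℝ → ℝ × S, c 0 = z ∧ IsMIntegralCurveOn c w (Set.Ioo (-ε) ε)) ⟨1, one_pos, by simp⟩ ?_
      ?_ ?_
    · rintro s t hst ⟨ε, hε, H⟩
      exact ⟨ε, hε, fun z hz => H z (hst hz)⟩
    · rintro s t ⟨ε, hε, H⟩ ⟨δ, hδ, H'⟩
      refine ⟨min ε δ, lt_min hε hδ, ?_⟩
      rintro z (hz | hz)
      · obtain ⟨c, hc, hc'⟩ := H z hz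
        exact ⟨c, hc, hc'.mono (Set.Ioo_subset_Ioo (neg_le_neg (min_le_left _ _))
          (min_le_left _ _))⟩
      · obtain ⟨c, hc, hc'⟩ := H' z hz
        exact ⟨c, hc, hc'.mono (Set.Ioo_subset_Ioo (neg_le_neg (min_le_right _ _))
          (min_le_right _ _))⟩
    · intro z _
      obtain ⟨Φ, ε, hε, U, hU, -, H⟩ := exists_localFlow_box (n := 1) one_ne_zero hsm z
      exact ⟨U, nhdsWithin_le_nhds hU, ε, hε, fun x hx => ⟨fun t => Φ (t, x), H x hx⟩⟩
  have hloc : ∀ z : ℝ × S, ∃ c : ℝ → ℝ × S, c 0 = z ∧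
      IsMIntegralCurveOn c w (Set.Ioo (-(min ε 1)) (min ε 1)) := by
    rintro ⟨t, p⟩
    by_cases ht : t ∈ Set.Icc (-1 : ℝ) 2
    · obtain ⟨c, hc, hc'⟩ := hεK (t, p) ⟨ht, trivial⟩
      exact ⟨c, hc, hc'.mono (Set.Ioo_subset_Ioo (neg_le_neg (min_le_left _ _))
        (min_le_left _ _))⟩
    · refine ⟨fun s => (t + s, p), by simp, fun s hs => ?_⟩
      have hs1 : |s| < 1 := lt_of_lt_of_le (abs_lt.2 hs) (min_le_right _ _)
      have hzero : h (t + s, p) = 0 := by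
        refine h0 _ _ ?_
        rw [Set.mem_Icc, not_and_or, not_le, not_le] at ht
        rw [abs_lt] at hs1
        rcases ht with ht | ht
        · left; linarith
        · right; linarith
      have h1 : HasMFDerivAt 𝓘(ℝ, ℝ) 𝓘(ℝ, ℝ) (fun s : ℝ => t + s) s
          (ContinuousLinearMap.id ℝ ℝ) :=
        ((hasFDerivAt_id s).const_add t).hasMFDerivAt
      have h2 : HasMFDerivAt 𝓘(ℝ, ℝ) (𝓘(ℝ, ℝ).prod (𝓡 2)) (fun s : ℝ => (t + s, p)) s
          ((ContinuousLinearMap.id ℝ ℝ).prod (0 : ℝ →L[ℝ] TangentSpace (𝓡 2) p)) :=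
        h1.prodMk (hasMFDerivAt_const p s)
      have e : ((ContinuousLinearMap.id ℝ ℝ).prod (0 : ℝ →L[ℝ] TangentSpace (𝓡 2) p)) =
          (1 : ℝ →L[ℝ] ℝ).smulRight (w (t + s, p)) := by
        refine ContinuousLinearMap.ext_ring (Prod.ext ?_ ?_)
        · change (1 : ℝ) = (1 : ℝ) * 1
          simp
        · change (0 : TangentSpace (𝓡 2) p) = (1 : ℝ) • (h (t + s, p) • X p)
          rw [hzero, zero_smul, smul_zero]
      exact (e ▸ h2).hasMFDerivWithinAt
  have hglob := exists_isMIntegralCurve_of_isMIntegralCurveOn (hsm.of_le (by simp))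
    (lt_min hε one_pos) hloc
  choose Γ hΓ0 hΓ using hglob
  exact ⟨fun z => Γ z.2 z.1, hΓ0, hΓ⟩

/-- A field tangent to the divisor, scaled by a time-dependent function supported in the unit
interval of times, generates an isotopy. -/
theorem exists_isotopy [T2Space S] [CompactSpace S] (v : BField D) (h : TFn S)
    (h0 : ∀ t p, t ≤ 0 ∨ 1 ≤ t → h (t, p) = 0) :
    ∃ γ : BIsotopy D, ∀ t, γ.IsVelocity t (h.slice t • v) := by
  obtain ⟨Γ, hΓ0, hΓ⟩ := exists_flow v.1 h h0
  set w : (z : ℝ × S) → TangentSpace (𝓘(ℝ, ℝ).prod (𝓡 2)) z :=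
    fun z => ((1 : ℝ), h z • v.1 z.2) with hw
  have hsm := contMDiff_prod_section_smul h.contMDiff v.1
  have hΓs : ContMDiff (𝓘(ℝ, ℝ).prod (𝓘(ℝ, ℝ).prod (𝓡 2))) (𝓘(ℝ, ℝ).prod (𝓡 2)) ∞ Γ :=
    contMDiff_flow hsm hΓ0 hΓ
  -- The time component of the field is 1, so the flow on ℝ × S advances time by s. The isotopy
  -- follows points starting at time 0, and its inverse at t runs back from (t, q).
  have htime : ∀ s z, (Γ (s, z)).1 = z.1 + s := by
    intro s z
    have hd : ∀ s, HasDerivAt (fun s => (Γ (s, z)).1 - s) 0 s := by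
      intro s
      have h1 := (hasMFDerivAt_fst (I := 𝓘(ℝ, ℝ)) (I' := 𝓡 2) (Γ (s, z))).comp s (hΓ z s)
      have h2 : HasFDerivAt (fun s => (Γ (s, z)).1) (1 : ℝ →L[ℝ] ℝ) s := by
        refine HasMFDerivAt.hasFDerivAt (h1.congr_mfderiv ?_)
        refine ContinuousLinearMap.ext_ring ?_
        change (1 : ℝ) * 1 = 1
        simp
      exact (h2.hasDerivAt.sub (hasDerivAt_id s)).congr_deriv (by simp)
    have := is_const_of_deriv_eq_zero (fun s => (hd s).differentiableAt)
      (fun s => (hd s).deriv) s 0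
    simp only [hΓ0, sub_zero] at this
    linarith
  have hgroup : ∀ s r z, Γ (s, Γ (r, z)) = Γ (s + r, z) := by
    intro s r z
    have := isMIntegralCurve_Ioo_eq_of_contMDiff_boundaryless (t₀ := 0) (hsm.of_le (by simp))
      (hΓ (Γ (r, z))) ((hΓ z).comp_add r) (by simp [hΓ0])
    exact congrFun this s
  have hsnd : ∀ s t p, Γ (s, (t, p)) = (t + s, (Γ (s, (t, p))).2) := fun s t p =>
    Prod.ext (htime s (t, p)) rfl
  have hvel : ∀ p t, HasMFDerivAt 𝓘(ℝ, ℝ) (𝓡 2) (fun s => (Γ (s, (0, p))).2) t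
      ((1 : ℝ →L[ℝ] ℝ).smulRight (h (t, (Γ (t, (0, p))).2) • v.1 (Γ (t, (0, p))).2)) := by
    intro p t
    have h1 := (hasMFDerivAt_snd (I := 𝓘(ℝ, ℝ)) (I' := 𝓡 2) (Γ (t, (0, p)))).comp t (hΓ (0, p) t)
    refine h1.congr_mfderiv ?_
    refine ContinuousLinearMap.ext_ring ?_
    change (1 : ℝ) • (h (Γ (t, (0, p))) • v.1 (Γ (t, (0, p))).2) =
      (1 : ℝ) • (h (t, (Γ (t, (0, p))).2) • v.1 (Γ (t, (0, p))).2)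
    conv_lhs => rw [show h (Γ (t, (0, p))) = h (t, (Γ (t, (0, p))).2) by
      conv_lhs => rw [hsnd, zero_add]]
  have hmem : ∀ i p t, (Γ (t, (0, p))).2 ∈ D.curve i ↔ p ∈ D.curve i := by
    intro i p t
    have hc : Continuous fun s => (Γ (s, (0, p))).2 :=
      continuous_iff_continuousAt.2 fun s => (hvel p s).continuousAt
    have ha : Continuous fun s => h (s, (Γ (s, (0, p))).2) :=
      h.contMDiff.continuous.comp (continuous_id.prodMk hc)
    have key := fun s (hs : (Γ (s, (0, p))).2 ∈ D.curve i) t =>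
      mem_curve_of_mem_curve v i ha (hvel p) hs t
    constructor
    · intro ht
      simpa [hΓ0] using key t ht 0
    · intro hp
      exact key 0 (by simpa [hΓ0] using hp) t
  have hsmooth : ContMDiff (𝓘(ℝ, ℝ).prod (𝓡 2)) (𝓡 2) ∞
      fun z : ℝ × S => (Γ (z.1, (0, z.2))).2 :=
    contMDiff_snd.comp (hΓs.comp (contMDiff_fst.prodMk (contMDiff_const.prodMk contMDiff_snd)))
  let ψ : ℝ → (S ≃ₘ⟮𝓡 2, 𝓡 2⟯ S) := fun t =>
    { toFun := fun p => (Γ (t, (0, p))).2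
      invFun := fun q => (Γ (-t, (t, q))).2
      left_inv := fun p => by
        have h1 := hgroup (-t) t (0, p)
        rw [hsnd t, zero_add, neg_add_cancel, hΓ0] at h1
        exact congrArg Prod.snd h1
      right_inv := fun q => by
        have h1 := hgroup t (-t) (t, q)
        rw [hsnd (-t), add_neg_cancel, hΓ0] at h1
        exact congrArg Prod.snd h1
      contMDiff_toFun := hsmooth.comp (contMDiff_const.prodMk contMDiff_id)
      contMDiff_invFun := contMDiff_snd.comp
        (hΓs.comp (contMDiff_const.prodMk (contMDiff_const.prodMk contMDiff_id))) }
  refine ⟨⟨fun t => ⟨ψ t, fun i => ?_⟩, hsmooth, fun p => ?_⟩, fun t p => hvel p t⟩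
  · ext q
    constructor
    · rintro ⟨p, hp, rfl⟩
      exact (hmem i p t).2 hp
    · intro hq
      have e : (Γ (t, (0, (ψ t).symm q))).2 = q := (ψ t).apply_symm_apply q
      exact ⟨(ψ t).symm q, (hmem i _ t).1 (e.symm ▸ hq), e⟩
  · exact congrArg Prod.snd (hΓ0 (0, p))

end Flow

/-! ### Moser's argument. -/

section Moser

variable {S : Type*} [TopologicalSpace S] [ChartedSpace Plane S] [IsManifold (𝓡 2) ∞ S]
  {D : StarDivisor S}

lemma act_add (X : VField S) (f g : SmoothFn S) (p : S) :
    act X (f + g) p = act X f p + act X g p := by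
  rw [act_apply, show (⇑(f + g) : S → ℝ) = ⇑f + ⇑g from rfl,
    mvfderiv_add f.mdifferentiableAt g.mdifferentiableAt]
  rfl

lemma act_const (X : VField S) (c : ℝ) (p : S) :
    act X (ContMDiffMap.const c) p = 0 := by
  rw [act_apply, show (⇑(ContMDiffMap.const c : SmoothFn S)) = fun _ => c from rfl, mvfderiv_const]
  rfl

lemma bdOne_add (α β : BOneForm D) (X Y : BField D) (p : S) :
    bdOne (α + β) X Y p = bdOne α X Y p + bdOne β X Y p := by
  change act X.1 (α Y + β Y) p - act Y.1 (α X + β X) p - (α (bbracket X Y) p + β (bbracket X Y) p) =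
    (act X.1 (α Y) p - act Y.1 (α X) p - α (bbracket X Y) p) +
      (act X.1 (β Y) p - act Y.1 (β X) p - β (bbracket X Y) p)
  rw [act_add, act_add]
  ring

lemma bdOne_const_smul (c : ℝ) (α : BOneForm D) (X Y : BField D) (p : S) :
    bdOne ((ContMDiffMap.const c : SmoothFn S) • α) X Y p = c * bdOne α X Y p := by
  have h1 : ∀ Z W : BField D, act Z.1 (((ContMDiffMap.const c : SmoothFn S) • α) W) p =
      c * act Z.1 (α W) p := by
    intro Z W
    refine (act_mul Z.1 (ContMDiffMap.const c) (α W) p).trans ?_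
    rw [act_const, mul_zero, add_zero]
    rfl
  have h2 : bdOne ((ContMDiffMap.const c : SmoothFn S) • α) X Y p =
      act X.1 (((ContMDiffMap.const c : SmoothFn S) • α) Y) p -
        act Y.1 (((ContMDiffMap.const c : SmoothFn S) • α) X) p - c * α (bbracket X Y) p := rfl
  have h3 : bdOne α X Y p = act X.1 (α Y) p - act Y.1 (α X) p - α (bbracket X Y) p := rfl
  rw [h2, h3, h1, h1]
  ring

/-- The differential of a vanishing linear combination of one-forms. -/
lemma bdOne_linear_combination {a b c : ℝ} {α β δ : BOneForm D}
    (h : ∀ Z q, a * α Z q + b * β Z q + c * δ Z q = 0) (X Y : BField D) (p : S) :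
    a * bdOne α X Y p + b * bdOne β X Y p + c * bdOne δ X Y p = 0 := by
  have h0 : (ContMDiffMap.const a : SmoothFn S) • α + (ContMDiffMap.const b : SmoothFn S) • β +
      (ContMDiffMap.const c : SmoothFn S) • δ = 0 := by
    ext Z q
    exact h Z q
  have h1 : bdOne (0 : BOneForm D) X Y p = 0 := by
    have := bdOne_add (0 : BOneForm D) 0 X Y p
    rw [add_zero] at this
    linarith
  rw [← bdOne_const_smul, ← bdOne_const_smul, ← bdOne_const_smul, ← bdOne_add, ← bdOne_add, h0, h1]

lemma BDiffeo.push_eq_self [T2Space S] (ψ : BDiffeo D) (h : ∀ p, ψ.toDiffeo p = p)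
    (X : BField D) : ψ.push X = X := by
  refine Subtype.ext (VField.ext_act D fun f p => ?_)
  have h1 := ψ.act_push X f p
  rw [h p] at h1
  have h2 : f.comp ψ.map = f := by
    ext q
    exact congrArg f (h q)
  rw [h1, h2]

lemma BDiffeo.pull_eq_self [T2Space S] (ψ : BDiffeo D) (h : ∀ p, ψ.toDiffeo p = p)
    (η : BBilin D) (X Y : BField D) (p : S) : ψ.pull η X Y p = η X Y p := by
  change η (ψ.push X) (ψ.push Y) (ψ.toDiffeo p) = η X Y p
  rw [ψ.push_eq_self h, ψ.push_eq_self h, h]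

/-- At such times the step attains its global minimum 0 or maximum 1; the endpoints are included. -/
lemma deriv_smoothTransition_eq_zero {t : ℝ} (ht : t ≤ 0 ∨ 1 ≤ t) :
    deriv Real.smoothTransition t = 0 := by
  rcases ht with ht | ht
  · refine IsLocalMin.deriv_eq_zero (Filter.Eventually.of_forall fun s => ?_)
    rw [Real.smoothTransition.zero_of_nonpos ht]
    exact Real.smoothTransition.nonneg s
  · refine IsLocalMax.deriv_eq_zero (Filter.Eventually.of_forall fun s => ?_)
    rw [Real.smoothTransition.one_of_one_le ht]
    exact Real.smoothTransition.le_one s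

/-- Smooth functions that agree off the divisor are equal. -/
lemma SmoothFn.ext_compl [T2Space S] [CompactSpace S] (D : StarDivisor S) {f g : SmoothFn S}
    (h : ∀ p ∈ D.compl, f p = g p) : f = g :=
  DFunLike.coe_injective (Continuous.ext_on D.dense_compl f.contMDiff.continuous
    g.contMDiff.continuous h)

/-- Moser's argument: cohomologous forms that induce the same orientation are related by an
isotopy. -/
theorem bSymplectomorphic_of_cohomologous [T2Space S] [CompactSpace S]
    {ω₀ ω₁ : LogSymplecticForm D} (hc : Cohomologous ω₀ ω₁) (ho : SameOrientation ω₀ ω₁) :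
    BSymplectomorphic ω₀ ω₁ := by
  obtain ⟨α, hα⟩ := hc
  obtain ⟨f, hf, hform⟩ := ho
  obtain ⟨v, hv⟩ := ω₁.nondegenerate.2 α
  set τ := Real.smoothTransition with hτ
  have hτs : ContDiff ℝ ∞ τ := Real.smoothTransition.contDiff (n := ⊤)
  have hτd : ∀ t, HasDerivAt τ (deriv τ t) t := fun t =>
    (hτs.differentiable (by simp) t).hasDerivAt
  have hden : ∀ z : ℝ × S, 0 < (1 - τ z.1) * f z.2 + τ z.1 := by
    intro z
    have h1 : 0 ≤ τ z.1 := Real.smoothTransition.nonneg _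
    have h2 : τ z.1 ≤ 1 := Real.smoothTransition.le_one _
    have h3 := hf z.2
    rcases h1.eq_or_lt with h | h
    · rw [← h]; simpa using h3
    · have : 0 ≤ (1 - τ z.1) * f z.2 := mul_nonneg (sub_nonneg.2 h2) h3.le
      linarith
  have hτ1 : ContMDiff (𝓘(ℝ, ℝ).prod (𝓡 2)) 𝓘(ℝ, ℝ) ∞ fun z : ℝ × S => τ z.1 :=
    hτs.contMDiff.comp contMDiff_fst
  have hτ2 : ContMDiff (𝓘(ℝ, ℝ).prod (𝓡 2)) 𝓘(ℝ, ℝ) ∞ fun z : ℝ × S => -deriv τ z.1 :=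
    (contDiff_infty_iff_deriv.1 hτs).2.neg.contMDiff.comp contMDiff_fst
  -- Chosen so that h((1-τ)f + τ) = -τ'. It vanishes outside the unit interval of times, which makes
  -- the flow complete.
  let h : TFn S := ⟨fun z => -deriv τ z.1 / ((1 - τ z.1) * f z.2 + τ z.1),
    hτ2.div₀ (((contMDiff_const.sub hτ1).mul (f.contMDiff.comp contMDiff_snd)).add hτ1)
      fun z => (hden z).ne'⟩
  obtain ⟨γ, hγ⟩ := exists_isotopy v h fun t p ht => by
    change -deriv τ t / _ = 0
    rw [deriv_smoothTransition_eq_zero ht, neg_zero, zero_div]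
  refine ⟨γ, fun X Y => SmoothFn.ext_compl D fun p hp => ?_⟩
  -- The pull-back of (1-τ)ω₀ + τω₁ is constant in time; it is ω₀ at time 0 and γ_1^*ω₁ at time 1.
  have hder : ∀ t, HasDerivAt (fun s => (γ.at_time s).pull ω₀.form X Y p +
      τ s * ((γ.at_time s).pull ω₁.form X Y p - (γ.at_time s).pull ω₀.form X Y p)) 0 t := by
    intro t
    have d0 := γ.hasDerivAt_pull (hγ t) ω₀.alt hp X Y
    have d1 := γ.hasDerivAt_pull (hγ t) ω₁.alt hp X Y
    refine (d0.add ((hτd t).mul (d1.sub d0))).congr_deriv ?_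
    set ψ := γ.at_time t
    have e1 : ψ.pull ω₁.form X Y p - ψ.pull ω₀.form X Y p = bdOne (ψ.pullOne α) X Y p := by
      rw [ψ.bdOne_pullOne, ← hα]
      rfl
    -- The differential of ι_{hv} ω_t + τ'α = 0, pulled back by ψ.
    have e2 := bdOne_linear_combination (a := 1 - τ t) (b := τ t) (c := deriv τ t)
      (α := ψ.pullOne (ω₀.form (h.slice t • v))) (β := ψ.pullOne (ω₁.form (h.slice t • v)))
      (δ := ψ.pullOne α) (fun Z q => by
        rw [BDiffeo.pullOne_apply, BDiffeo.pullOne_apply, BDiffeo.pullOne_apply, hform,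
          LinearMap.smul_apply, map_smul, hv]
        change (1 - τ t) * (f (ψ.toDiffeo q) * (h (t, ψ.toDiffeo q) *
          α (ψ.push Z) (ψ.toDiffeo q))) + τ t * (h (t, ψ.toDiffeo q) *
          α (ψ.push Z) (ψ.toDiffeo q)) + _ = 0
        have hh : h (t, ψ.toDiffeo q) * ((1 - τ t) * f (ψ.toDiffeo q) + τ t) = -deriv τ t :=
          div_mul_cancel₀ _ (hden (t, ψ.toDiffeo q)).ne'
        linear_combination (α (ψ.push Z) (ψ.toDiffeo q)) * hh) X Y p
    simp only [Pi.sub_apply]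
    linear_combination e2 + deriv τ t * e1
  have hconst := is_const_of_deriv_eq_zero (fun s => (hder s).differentiableAt)
    (fun s => (hder s).deriv) 1 0
  rw [hτ, Real.smoothTransition.one_of_one_le le_rfl,
    Real.smoothTransition.zero_of_nonpos le_rfl, one_mul, zero_mul, add_zero] at hconst
  rw [← (γ.at_time 0).pull_eq_self γ.start ω₀.form X Y p, ← hconst]
  ring

end Moser

/-! ### The velocity of an isotopy. -/

section Velocity

variable {S : Type*} [TopologicalSpace S] [ChartedSpace Plane S] [IsManifold (𝓡 2) ∞ S]
  {D : StarDivisor S}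

/-- An isotopy has a velocity field, tangent to the divisor, at every time. -/
theorem BIsotopy.exists_isVelocity (γ : BIsotopy D) (t : ℝ) : ∃ V : BField D, γ.IsVelocity t V := by
  set Γ : ℝ × S → S := fun z => (γ.at_time z.1).toDiffeo z.2 with hΓ
  set ψ := (γ.at_time t).toDiffeo with hψ
  let W : (p : S) → TangentSpace (𝓡 2) (Γ (t, p)) := fun p =>
    mfderiv (𝓘(ℝ, ℝ).prod (𝓡 2)) (𝓡 2) Γ (t, p) ((1 : ℝ), (0 : TangentSpace (𝓡 2) p))
  have hW : ∀ p, HasMFDerivAt 𝓘(ℝ, ℝ) (𝓡 2) (fun s => Γ (s, p)) t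
      ((1 : ℝ →L[ℝ] ℝ).smulRight (W p)) := by
    intro p
    have h1 : HasMFDerivAt 𝓘(ℝ, ℝ) (𝓘(ℝ, ℝ).prod (𝓡 2)) (fun s : ℝ => (s, p)) t
        ((ContinuousLinearMap.id ℝ (TangentSpace 𝓘(ℝ, ℝ) t)).prod
          (0 : TangentSpace 𝓘(ℝ, ℝ) t →L[ℝ] TangentSpace (𝓡 2) p)) :=
      (hasMFDerivAt_id t).prodMk (hasMFDerivAt_const p t)
    have h2 := (γ.smooth.mdifferentiable (by simp) (t, p)).hasMFDerivAt.comp t h1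
    refine h2.congr_mfderiv (ContinuousLinearMap.ext_ring ?_)
    change W p = (1 : ℝ) • W p
    rw [one_smul]
  have hsm : ContMDiff (𝓡 2) (𝓡 2).tangent ∞
      fun q => (⟨q, W (ψ.symm q)⟩ : TangentBundle (𝓡 2) S) := by
    have h1 : ContMDiff (𝓘(ℝ, ℝ).prod (𝓡 2)).tangent (𝓡 2).tangent ∞
        (tangentMap (𝓘(ℝ, ℝ).prod (𝓡 2)) (𝓡 2) Γ) :=
      γ.smooth.contMDiff_tangentMap (by simp)
    have h2 : ContMDiff (𝓡 2) (𝓘(ℝ, ℝ).prod (𝓡 2)) ∞ fun q : S => (t, ψ.symm q) :=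
      contMDiff_const.prodMk ψ.symm.contMDiff
    have h3 := (h1.comp (contMDiff_prod_section 1 (0 : VField S))).comp h2
    refine h3.congr fun q => ?_
    exact Bundle.TotalSpace.ext (ψ.apply_symm_apply q).symm HEq.rfl
  refine ⟨⟨⟨fun q => W (ψ.symm q), hsm⟩, fun i q hq f hf => ?_⟩, fun p => ?_⟩
  -- The path of p stays in the curve, so a function vanishing there is constant along the path.
  · have key : ∀ p ∈ D.curve i, mvfderiv (𝓡 2) f (Γ (t, p)) (W p) = 0 := by
      intro p hp
      refine (hasDerivAt_comp_curve f (hW p)).unique ?_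
      have : (fun s => f (Γ (s, p))) = fun _ => 0 := by
        ext s
        exact hf _ (((γ.at_time s).mem_curve_iff i p).2 hp)
      rw [this]
      exact hasDerivAt_const t 0
    obtain ⟨p, hp, hpq⟩ := ((γ.at_time t).image_curve i).symm ▸ hq
    have hpq' : ψ p = q := hpq
    subst hpq'
    have h := key p hp
    have e : ψ.symm (ψ p) = p := ψ.symm_apply_apply p
    change mvfderiv (𝓡 2) f (ψ p) (W (ψ.symm (ψ p))) = 0
    have h2 : (W (ψ.symm (ψ p)) : Plane) = W p := by rw [e]
    exact (congrArg (mvfderiv (𝓡 2) f (ψ p)) h2).trans h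
  · refine (hW p).congr_mfderiv ?_
    have e : ψ.symm (ψ p) = p := ψ.symm_apply_apply p
    have h2 : (W p : Plane) = W (ψ.symm (ψ p)) := by rw [e]
    exact congrArg (fun w : Plane => (1 : ℝ →L[ℝ] ℝ).smulRight w) h2

end Velocity

/-! ### Division by equations of curves with a time parameter. -/

section Contraction

variable {S : Type*} [TopologicalSpace S] [ChartedSpace Plane S] [IsManifold (𝓡 2) ∞ S]
  {D : StarDivisor S} {p : S}

/-- Cramer's rule: a zero determinant would yield two dependencies forcing l = 0. It supplies the
transverse directions used in Hadamard division. -/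
lemma exists_apply_eq_zero_and_eq_one {l m : Plane →L[ℝ] ℝ} (h : LinearIndependent ℝ ![l, m]) :
    ∃ w, l w = 0 ∧ m w = 1 := by
  rw [LinearIndependent.pair_iff] at h
  set a := l (EuclideanSpace.single 0 1)
  set b := l (EuclideanSpace.single 1 1)
  set c := m (EuclideanSpace.single 0 1)
  set d := m (EuclideanSpace.single 1 1)
  have hdet : a * d - b * c ≠ 0 := by
    intro h0
    have h1 : d • l + (-b) • m = 0 := by
      ext x
      simp only [add_apply, smul_apply, smul_eq_mul,
        zero_apply]
      rw [clm_plane_apply l, clm_plane_apply m]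
      linear_combination x 0 * h0
    have h2 : c • l + (-a) • m = 0 := by
      ext x
      simp only [add_apply, smul_apply, smul_eq_mul,
        zero_apply]
      rw [clm_plane_apply l, clm_plane_apply m]
      linear_combination -x 1 * h0
    have hl : (1 : ℝ) • l + (0 : ℝ) • m = 0 := by
      ext x
      simp only [add_apply, smul_apply, smul_eq_mul,
        zero_apply]
      rw [clm_plane_apply l]
      linear_combination -x 0 * (h _ _ h2).2 - x 1 * (h _ _ h1).2
    exact one_ne_zero (h _ _ hl).1
  refine ⟨(a * d - b * c)⁻¹ • ((-b) • EuclideanSpace.single 0 1 +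
    a • EuclideanSpace.single 1 1), ?_, ?_⟩
  · simp only [map_smul, map_add, smul_eq_mul]
    change (a * d - b * c)⁻¹ * (-b * a + a * b) = 0
    ring
  · simp only [map_smul, map_add, smul_eq_mul]
    change (a * d - b * c)⁻¹ * (-b * c + a * d) = 1
    field_simp
    ring

/-- Division of a time-dependent function by the equations of curves on which it vanishes. -/
lemma StarChart.exists_contDiff_eq_prod_mul (C : StarChart D p) (s : Finset (Fin D.card))
    (hs : ∀ i ∈ s, p ∈ D.curve i) (B : TFn S) {t : ℝ}
    (hB : ∀ᶠ z in 𝓝 (t, p), ∀ i ∈ s, z.2 ∈ D.curve i → B z = 0) :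
    ∃ M : ℝ × Plane → ℝ, ContDiff ℝ ∞ M ∧ ∀ᶠ z in 𝓝 (t, p),
      B z = (∏ i ∈ s, C.l i (C.φ z.2)) * M (z.1, C.φ z.2) := by
  have hpt : C.φ p ∈ C.φ.target := C.φ.map_source C.mem_source
  have hcont : Filter.Tendsto (fun z : ℝ × Plane => (z.1, C.φ.symm z.2)) (𝓝 (t, C.φ p))
      (𝓝 (t, p)) := by
    have h1 := C.φ.continuousAt_symm hpt
    have h2 : ContinuousAt (fun z : ℝ × Plane => (z.1, C.φ.symm z.2)) (t, C.φ p) :=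
      continuousAt_fst.prodMk (ContinuousAt.comp (f := Prod.snd) (x := (t, C.φ p)) h1
        continuousAt_snd)
    simpa [ContinuousAt, C.φ.left_inv C.mem_source] using h2
  have hU : {z : ℝ × Plane | z.2 ∈ C.φ.target ∧ ∀ i ∈ s, C.φ.symm z.2 ∈ D.curve i →
      B (z.1, C.φ.symm z.2) = 0} ∈ 𝓝 (t, C.φ p) :=
    (continuousAt_snd.eventually (C.φ.open_target.mem_nhds hpt)).and (hcont.eventually hB)
  obtain ⟨χ, hχ, hχ1, hχU⟩ := exists_contDiff_cutoff hU
  have hsm : ContDiff ℝ ∞ fun z : ℝ × Plane => χ z * B (z.1, C.φ.symm z.2) :=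
    hχ.mul_of_tsupport_subset (isOpen_univ.prod C.φ.open_target)
      (fun z hz => ⟨trivial, (hχU hz).1⟩) (B.contDiffOn_chart C.mem_maximalAtlas)
  obtain ⟨M, hM, hMeq⟩ := exists_contDiff_eq_prod_mul_of_eq_zero s
    (fun i => (C.l i).comp (ContinuousLinearMap.snd ℝ ℝ Plane)) (fun i hi h0 => by
      refine C.l_ne_zero i (hs i hi) ?_
      ext x
      exact DFunLike.congr_fun h0 ((0 : ℝ), x))
    (fun i hi j hj hij => by
      obtain ⟨w, h1, h2⟩ := exists_apply_eq_zero_and_eq_one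
        (C.linearIndependent i j hij (hs i hi) (hs j hj))
      exact ⟨(0, w), h1, h2⟩) hsm (fun i hi z hz => by
      by_cases h : z ∈ tsupport χ
      · have h1 := hχU h
        have h2 : C.φ.symm z.2 ∈ D.curve i := by
          rw [C.mem_curve_iff i (hs i hi) _ (C.φ.map_target h1.1), C.φ.right_inv h1.1]
          exact hz
        rw [h1.2 i hi h2, mul_zero]
      · rw [image_eq_zero_of_notMem_tsupport h, zero_mul])
  refine ⟨M, hM, ?_⟩
  have hc2 : ContinuousAt (fun z : ℝ × S => (z.1, C.φ z.2)) (t, p) :=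
    continuousAt_fst.prodMk (ContinuousAt.comp (f := Prod.snd) (x := (t, p))
      (C.φ.continuousAt C.mem_source) continuousAt_snd)
  filter_upwards [hc2.eventually hχ1,
    continuousAt_snd.eventually (C.φ.open_source.mem_nhds C.mem_source)] with z hz hzs
  have := hMeq (z.1, C.φ z.2)
  simp only [hz, Pi.one_apply, one_mul, C.φ.left_inv hzs] at this
  exact this

set_option linter.unusedSectionVars false in
/-- The quotient of a function with nonzero derivative by the equation of a curve does not
vanish. -/
lemma StarChart.ne_zero_of_mvfderiv_ne_zero (C : StarChart D p) (i : Fin D.card) {f : SmoothFn S}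
    {M : Plane → ℝ} (hM : ContDiff ℝ ∞ M) (h : ∀ᶠ q in 𝓝 p, f q = C.l i (C.φ q) * M (C.φ q))
    {v : TangentSpace (𝓡 2) p} (hv : mvfderiv (𝓡 2) f p v ≠ 0) : M (C.φ p) ≠ 0 := by
  -- Otherwise f would be a product of two functions vanishing at p, and its differential there
  -- would be zero.
  intro h0
  refine hv ?_
  rw [mvfderiv_eq_fderiv_chart C.mem_maximalAtlas C.mem_source f.mdifferentiableAt]
  have hpt : C.φ p ∈ C.φ.target := C.φ.map_source C.mem_source
  have e : (⇑f ∘ C.φ.symm) =ᶠ[𝓝 (C.φ p)] ⇑(C.l i) * M := by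
    have h1 : Filter.Tendsto C.φ.symm (𝓝 (C.φ p)) (𝓝 p) := by
      have := C.φ.continuousAt_symm hpt
      rwa [ContinuousAt, C.φ.left_inv C.mem_source] at this
    filter_upwards [h1.eventually h, C.φ.open_target.mem_nhds hpt] with x hx hxt
    rw [C.φ.right_inv hxt] at hx
    exact hx
  have hd := (C.l i).hasFDerivAt.mul (hM.differentiable (by simp) (C.φ p)).hasFDerivAt
  rw [e.fderiv_eq, hd.fderiv]
  have h2 : C.l i (C.φ p) = 0 := by rw [C.map_self, map_zero]
  simp [h0, h2]

end Contraction

/-! ### Smoothness in time of the contraction with the velocity. -/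

section Contraction

variable {S : Type*} [TopologicalSpace S] [ChartedSpace Plane S] [IsManifold (𝓡 2) ∞ S]
  {D : StarDivisor S}

set_option linter.unusedSectionVars false in
/-- The derivative of a diffeomorphism, followed by a nonzero linear form in a chart, is not
zero. -/
lemma StarChart.exists_mvfderiv_comp_ne_zero (ψ : BDiffeo D) {p : S}
    (C : StarChart D (ψ.toDiffeo p)) {i : Fin D.card} (hi : ψ.toDiffeo p ∈ D.curve i)
    {u : SmoothFn S} (hu : ∀ v : TangentSpace (𝓡 2) (ψ.toDiffeo p),
      mvfderiv (𝓡 2) u (ψ.toDiffeo p) v = C.l i (mvfderiv (𝓡 2) C.φ (ψ.toDiffeo p) v)) :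
    ∃ v : TangentSpace (𝓡 2) p, mvfderiv (𝓡 2) (u.comp ψ.map) p v ≠ 0 := by
  obtain ⟨x, hx⟩ : ∃ x, C.l i x ≠ 0 := by
    by_contra! H
    exact C.l_ne_zero i hi (by ext x; simpa using H x)
  obtain ⟨w, hw⟩ := (bijective_mvfderiv_chart C.mem_maximalAtlas C.mem_source).2 x
  obtain ⟨v, hv⟩ := (ψ.toDiffeo.mfderivToContinuousLinearEquiv (by simp) p).surjective w
  refine ⟨v, ?_⟩
  have h1 := mvfderiv_comp_apply_of_eq (I := 𝓡 2) p (u.mdifferentiableAt (x := ψ.toDiffeo p))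
      (ψ.toDiffeo.contMDiff.mdifferentiable (by simp) p) rfl v
  have h2 : mfderiv (𝓡 2) (𝓡 2) ψ.toDiffeo p v = w := hv
  rw [h2, hu, hw] at h1
  intro h0
  exact hx (h1.symm.trans h0)

variable [T2Space S] [CompactSpace S]

/-- The pull-back along an isotopy of the contraction of a two-form with the velocity depends
smoothly on time. -/
theorem BIsotopy.contMDiff_pullOne_velocity (γ : BIsotopy D) {V : ℝ → BField D}
    (hV : ∀ t, γ.IsVelocity t (V t)) {η : BBilin D} (alt : ∀ X, η X X = 0) (X : BField D) :
    ContMDiff (𝓘(ℝ, ℝ).prod (𝓡 2)) 𝓘(ℝ, ℝ) ∞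
      fun z : ℝ × S => (γ.at_time z.1).pullOne (η (V z.1)) X z.2 := by
  rintro ⟨t₀, p₀⟩
  set Γ : ℝ × S → S := fun z => (γ.at_time z.1).toDiffeo z.2 with hΓ
  have hcont : Continuous Γ := γ.smooth.continuous
  obtain ⟨C'⟩ := exists_starChart D p₀
  obtain ⟨C⟩ := exists_starChart D (Γ (t₀, p₀))
  have hmem : ∀ i z, Γ z ∈ D.curve i ↔ z.2 ∈ D.curve i := fun i z =>
    (γ.at_time z.1).mem_curve_iff i z.2
  obtain ⟨b, c, E, W, hfr⟩ := C.exists_frame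
  have hcoord := fun i => C.exists_coord C.mem_source (C.l i)
  choose u hu hu0 using hcoord
  have hevq : ∀ᶠ z in 𝓝 (t₀, p₀), _ := hcont.continuousAt.eventually
    (hfr.and (Filter.eventually_all.2 hu))
  -- the pull-back of the coordinate area form on the velocity and `X`
  set N : TFn S := (γ.pullFn b).dot * TFn.act X.1 (γ.pullFn c) -
    (γ.pullFn c).dot * TFn.act X.1 (γ.pullFn b) with hN
  have hNw : ∀ z : ℝ × S, N z = wedge b c (V z.1) ((γ.at_time z.1).push X) (Γ z) := by
    rintro ⟨t, p⟩
    change (γ.pullFn b).dot (t, p) * TFn.act X.1 (γ.pullFn c) (t, p) -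
      (γ.pullFn c).dot (t, p) * TFn.act X.1 (γ.pullFn b) (t, p) = _
    rw [(hV t).dot_pullFn, (hV t).dot_pullFn, γ.act_pullFn, γ.act_pullFn]
    rfl
  have hcurves : ∀ i, i ∈ C.curves → p₀ ∈ D.curve i := fun i hi =>
    (hmem i (t₀, p₀)).1 (C.mem_curves.1 hi)
  obtain ⟨M, hM, hMN⟩ := C'.exists_contDiff_eq_prod_mul C.curves hcurves N (t := t₀) (by
    filter_upwards [hevq] with z hz i hi hzi
    have hqi := (hmem i z).2 hzi
    rw [hNw, wedge_apply, hz.1.2.1]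
    exact area_eq_zero_of_mem_ker (C.l_ne_zero i (C.mem_curves.1 hi))
      ((C.mem_tangentAlong_iff hz.1.1 hqi _).1 ((V z.1).2 i _ hqi))
      ((C.mem_tangentAlong_iff hz.1.1 hqi _).1 (((γ.at_time z.1).push X).2 i _ hqi)))
  -- Each curve is preserved, so its equation pulls back to its equation in the source chart times
  -- m. This factor is nonzero at the base point because the isotopy consists of diffeomorphisms.
  have hdiv : ∀ i, ∃ m : ℝ × Plane → ℝ, i ∈ C.curves → ContDiff ℝ ∞ m ∧
      m (t₀, C'.φ p₀) ≠ 0 ∧ ∀ᶠ z in 𝓝 (t₀, p₀),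
        C.l i (C.φ (Γ z)) = C'.l i (C'.φ z.2) * m (z.1, C'.φ z.2) := by
    intro i
    by_cases hi : i ∈ C.curves
    swap
    · exact ⟨0, fun h => absurd h hi⟩
    have hqi := C.mem_curves.1 hi
    obtain ⟨m, hm, hmeq⟩ := C'.exists_contDiff_eq_prod_mul {i} (by simpa using hcurves i hi)
      (γ.pullFn (u i)) (t := t₀) (Filter.Eventually.of_forall fun z j hj hz => by
        rw [Finset.mem_singleton] at hj
        subst hj
        exact hu0 j _ fun hs => (C.mem_curve_iff j hqi _ hs).1 ((hmem j z).2 hz))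
    simp only [Finset.prod_singleton] at hmeq
    refine ⟨m, fun _ => ⟨hm, ?_, ?_⟩⟩
    · obtain ⟨v, hv⟩ := StarChart.exists_mvfderiv_comp_ne_zero (γ.at_time t₀) C hqi
        (hu i).self_of_nhds.2.2
      refine C'.ne_zero_of_mvfderiv_ne_zero i (M := fun x => m (t₀, x))
        (hm.comp (contDiff_const.prodMk contDiff_id)) ?_ hv
      have h1 : Continuous fun q : S => (t₀, q) := by fun_prop
      exact h1.continuousAt.eventually hmeq
    · filter_upwards [hmeq, hevq] with z hz hz2
      rw [← hz, ← (hz2.2 i).2.1]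
      rfl
  choose m hm using hdiv
  set P : ℝ × Plane → ℝ := fun x => ∏ i ∈ C.curves, m i x with hP
  have hPs : ContDiff ℝ ∞ P := contDiff_prod fun i hi => (hm i hi).1
  have hP0 : P (t₀, C'.φ p₀) ≠ 0 := Finset.prod_ne_zero_iff.2 fun i hi => (hm i hi).2.1
  -- Proportionality gives η(V, X)·∏ l i = η(E, W)·N along the isotopy. The common factor ∏ l i of
  -- the source chart cancels between N and the pulled-back product, leaving a smooth quotient.
  set R : ℝ × S → ℝ := fun z => η E W (Γ z) * M (z.1, C'.φ z.2) / P (z.1, C'.φ z.2) with hR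
  have hRs : ∀ z : ℝ × S, z.2 ∈ C'.φ.source → P (z.1, C'.φ z.2) ≠ 0 →
      ContMDiffAt (𝓘(ℝ, ℝ).prod (𝓡 2)) 𝓘(ℝ, ℝ) ∞ R z := by
    intro z hz hz0
    have h1 : ContMDiffAt (𝓘(ℝ, ℝ).prod (𝓡 2)) 𝓘(ℝ, ℝ × Plane) ∞
        (fun z : ℝ × S => (z.1, C'.φ z.2)) z :=
      contMDiffAt_fst.prodMk_space
        ((contMDiffAt_of_mem_maximalAtlas C'.mem_maximalAtlas hz).comp z contMDiffAt_snd)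
    exact ((((η E W).contMDiff.comp γ.smooth).contMDiffAt).mul
      (hM.contMDiff.contMDiffAt.comp z h1)).div₀ (hPs.contMDiff.contMDiffAt.comp z h1) hz0
  have hsrc : ∀ᶠ z : ℝ × S in 𝓝 (t₀, p₀), z.2 ∈ C'.φ.source :=
    continuousAt_snd.eventually (C'.φ.open_source.mem_nhds C'.mem_source)
  have hPev : ∀ᶠ z : ℝ × S in 𝓝 (t₀, p₀), P (z.1, C'.φ z.2) ≠ 0 := by
    have h1 : ContinuousAt (fun z : ℝ × S => (z.1, C'.φ z.2)) (t₀, p₀) :=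
      continuousAt_fst.prodMk (ContinuousAt.comp (f := Prod.snd) (x := (t₀, p₀))
        (C'.φ.continuousAt C'.mem_source) continuousAt_snd)
    exact (hPs.continuous.continuousAt.comp h1).eventually_ne hP0
  have hdivev : ∀ᶠ z in 𝓝 (t₀, p₀), ∀ i ∈ C.curves,
      C.l i (C.φ (Γ z)) = C'.l i (C'.φ z.2) * m i (z.1, C'.φ z.2) :=
    (Finset.eventually_all _).2 fun i hi => (hm i hi).2.2
  have hoff : ∀ᶠ z in 𝓝 (t₀, p₀), z.2 ∈ C'.φ.source ∧ P (z.1, C'.φ z.2) ≠ 0 ∧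
      (z.2 ∈ D.compl → (γ.at_time z.1).pullOne (η (V z.1)) X z.2 = R z) := by
    filter_upwards [hsrc, hPev, hdivev, hMN, hevq] with z h1 h2 h3 h4 h5
    refine ⟨h1, h2, fun hz => ?_⟩
    have key := (isAreaLike_bilin alt).mul_eq_mul (isAreaLike_wedge b c) (V z.1)
      ((γ.at_time z.1).push X) E W (Γ z)
    rw [h5.1.2.2, ← hNw, h4, Finset.prod_congr rfl h3, Finset.prod_mul_distrib] at key
    have hne : ∏ i ∈ C.curves, C'.l i (C'.φ z.2) ≠ 0 := Finset.prod_ne_zero_iff.2 fun i hi h0 =>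
      hz i ((C'.mem_curve_iff i (hcurves i hi) _ h1).2 h0)
    rw [hR, eq_div_iff h2]
    refine mul_left_cancel₀ hne ?_
    change _ * (η (V z.1) ((γ.at_time z.1).push X) (Γ z) * _) = _
    linear_combination key
  refine (hRs (t₀, p₀) hsrc.self_of_nhds hP0).congr_of_eventuallyEq ?_
  filter_upwards [hoff.eventually_nhds] with z hz
  have h1 : Continuous fun q : S => (z.1, q) := by fun_prop
  -- The cancellation is valid off the divisor; at each fixed time both sides are continuous on the
  -- surface.
  refine eq_of_eventually_eq_of_dense D.dense_compl (p := z.2)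
    (f := fun q => (γ.at_time z.1).pullOne (η (V z.1)) X q) (g := fun q => R (z.1, q))
    (ContMDiff.continuous (ContMDiffMap.contMDiff _)).continuousAt ?_ ?_
  · have h2 : ContinuousAt R (z.1, z.2) :=
      (hRs z hz.self_of_nhds.1 hz.self_of_nhds.2.1).continuousAt
    exact ContinuousAt.comp (f := fun q : S => (z.1, q)) (x := z.2) h2 h1.continuousAt
  · exact (h1.continuousAt (x := z.2)).eventually (hz.mono fun w hw => hw.2.2)

end Contraction

/-! ### Forms related by an isotopy. -/

section Necessity

variable {S : Type*} [TopologicalSpace S] [ChartedSpace Plane S] [IsManifold (𝓡 2) ∞ S]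
  {D : StarDivisor S} [T2Space S] [CompactSpace S]

set_option linter.unusedSectionVars false in
lemma TFn.intervalIntegrable (B : TFn S) (p : S) (a b : ℝ) :
    IntervalIntegrable (fun t => B (t, p)) MeasureTheory.volume a b :=
  (B.contMDiff.continuous.comp (by fun_prop : Continuous fun t : ℝ => (t, p))).intervalIntegrable
    a b

/-- Forms related by an isotopy are cohomologous. -/
theorem cohomologous_of_bSymplectomorphic {ω₀ ω₁ : LogSymplecticForm D}
    (h : BSymplectomorphic ω₀ ω₁) : Cohomologous ω₀ ω₁ := by
  obtain ⟨γ, hγ⟩ := h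
  choose V hV using γ.exists_isVelocity
  let g : BField D → TFn S := fun X =>
    ⟨_, γ.contMDiff_pullOne_velocity hV ω₁.alt X⟩
  have hg : ∀ X t p, g X (t, p) = (γ.at_time t).pullOne (ω₁.form (V t)) X p := fun _ _ _ => rfl
  have hslice : ∀ X t, (g X).slice t = (γ.at_time t).pullOne (ω₁.form (V t)) X := fun _ _ => rfl
  -- The minus sign appears because the pull-back of ω₁ runs from ω₁ at time 0 to ω₀ at time 1.
  let α : BOneForm D :=
    { toFun := fun X => -(g X).avg
      map_add' := fun X Y => by
        ext p
        change -(∫ t in (0 : ℝ)..1, g (X + Y) (t, p)) =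
          -(∫ t in (0 : ℝ)..1, g X (t, p)) + -(∫ t in (0 : ℝ)..1, g Y (t, p))
        rw [← neg_add, ← intervalIntegral.integral_add ((g X).intervalIntegrable p 0 1)
          ((g Y).intervalIntegrable p 0 1)]
        refine congrArg Neg.neg (intervalIntegral.integral_congr fun t _ => ?_)
        simp only [hg, map_add]
        rfl
      map_smul' := fun f X => by
        ext p
        change -(∫ t in (0 : ℝ)..1, g (f • X) (t, p)) = f p * -(∫ t in (0 : ℝ)..1, g X (t, p))
        rw [mul_neg, ← intervalIntegral.integral_const_mul]
        refine congrArg Neg.neg (intervalIntegral.integral_congr fun t _ => ?_)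
        simp only [hg, map_smul]
        rfl }
  have hact : ∀ (X Y : BField D) p, act X.1 (α Y) p =
      -∫ t in (0 : ℝ)..1, TFn.act X.1 (g Y) (t, p) := by
    intro X Y p
    rw [← TFn.act_avg]
    have h1 := act_add X.1 (α Y) (g Y).avg p
    have h2 : α Y + (g Y).avg = ContMDiffMap.const 0 := neg_add_cancel (g Y).avg
    rw [h2, act_const] at h1
    linarith
  refine ⟨α, fun X Y => SmoothFn.ext_compl D fun p hp => ?_⟩
  set B : TFn S := TFn.act X.1 (g Y) - TFn.act Y.1 (g X) - g (bbracket X Y) with hB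
  have hBd : ∀ t, B (t, p) = bdOne ((γ.at_time t).pullOne (ω₁.form (V t))) X Y p := by
    intro t
    change TFn.act X.1 (g Y) (t, p) - TFn.act Y.1 (g X) (t, p) - g (bbracket X Y) (t, p) = _
    rw [TFn.act_apply, TFn.act_apply, hslice, hslice]
    rfl
  have hint : ∫ t in (0 : ℝ)..1, B (t, p) =
      (γ.at_time 1).pull ω₁.form X Y p - (γ.at_time 0).pull ω₁.form X Y p :=
    intervalIntegral.integral_eq_sub_of_hasDerivAt
      (f := fun t => (γ.at_time t).pull ω₁.form X Y p) (fun t _ => by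
        rw [hBd]
        exact γ.hasDerivAt_pull (hV t) ω₁.alt hp X Y) (B.intervalIntegrable p 0 1)
  rw [hγ, (γ.at_time 0).pull_eq_self γ.start] at hint
  have hsplit : ∫ t in (0 : ℝ)..1, B (t, p) = (∫ t in (0 : ℝ)..1, TFn.act X.1 (g Y) (t, p)) -
      (∫ t in (0 : ℝ)..1, TFn.act Y.1 (g X) (t, p)) -
        ∫ t in (0 : ℝ)..1, g (bbracket X Y) (t, p) := by
    rw [← intervalIntegral.integral_sub (TFn.intervalIntegrable _ p 0 1)
      (TFn.intervalIntegrable _ p 0 1), ← intervalIntegral.integral_sub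
      (((TFn.intervalIntegrable _ p 0 1)).sub (TFn.intervalIntegrable _ p 0 1))
      (TFn.intervalIntegrable _ p 0 1)]
    rfl
  change ω₁.form X Y p - ω₀.form X Y p = act X.1 (α Y) p - act Y.1 (α X) p -
    -(∫ t in (0 : ℝ)..1, g (bbracket X Y) (t, p))
  rw [hact, hact]
  linarith

/-- Two log symplectic forms are related by a factor which is nowhere zero. -/
lemma LogSymplecticForm.form_ne_zero (ω₀ ω₁ : LogSymplecticForm D) {E W : BField D} {p : S}
    (h : ω₁.form E W p ≠ 0) : ω₀.form E W p ≠ 0 := by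
  obtain ⟨X, Y, hXY⟩ := ω₀.exists_ne_zero p
  have := (isAreaLike_bilin ω₀.alt).mul_eq_mul (isAreaLike_bilin ω₁.alt) X Y E W p
  intro h0
  rw [h0, zero_mul] at this
  exact (mul_ne_zero hXY h) this

-- The inverse diffeomorphism also preserves the curves, and pushing forward by it inverts the
-- push-forward.
set_option linter.unusedSectionVars false in
lemma BDiffeo.exists_push_eq (ψ : BDiffeo D) (X : BField D) : ∃ Y, ψ.push Y = X := by
  let ψ' : BDiffeo D := ⟨ψ.toDiffeo.symm, fun i => by
    ext q
    constructor
    · rintro ⟨r, hr, rfl⟩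
      rw [← ψ.mem_curve_iff, ψ.toDiffeo.apply_symm_apply]
      exact hr
    · intro hq
      exact ⟨ψ.toDiffeo q, (ψ.mem_curve_iff i q).2 hq, ψ.toDiffeo.symm_apply_apply q⟩⟩
  refine ⟨ψ'.push X, Subtype.ext (VField.ext_act D fun f q => ?_)⟩
  obtain ⟨p, hp⟩ : ∃ p, ψ.toDiffeo p = q :=
    ⟨ψ.toDiffeo.symm q, ψ.toDiffeo.apply_symm_apply q⟩
  subst hp
  rw [ψ.act_push]
  have h1 := ψ'.act_push X (f.comp ψ.map) (ψ.toDiffeo p)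
  have h2 : ψ'.toDiffeo (ψ.toDiffeo p) = p := ψ.toDiffeo.symm_apply_apply p
  have h3 : (f.comp ψ.map).comp ψ'.map = f := by
    ext r
    exact congrArg f (ψ.toDiffeo.apply_symm_apply r)
  rw [h2, h3] at h1
  exact h1

/-- Off the divisor, the pull-back of a log symplectic form is nonzero where the form is. -/
lemma LogSymplecticForm.pull_ne_zero (η : LogSymplecticForm D) (ψ : BDiffeo D) {E W : BField D}
    {p : S} (hp : p ∈ D.compl) (h : η.form E W p ≠ 0) : ψ.pull η.form E W p ≠ 0 := by
  obtain ⟨X', Y', hXY⟩ := η.exists_ne_zero (ψ.toDiffeo p)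
  obtain ⟨X, rfl⟩ := ψ.exists_push_eq X'
  obtain ⟨Y, rfl⟩ := ψ.exists_push_eq Y'
  obtain ⟨a, b, c, habc⟩ := exists_eq_mul_wedge η.alt (ψ.mem_compl hp)
  have hpull : ∀ X Y : BField D, ψ.pull η.form X Y p =
      a (ψ.toDiffeo p) * wedge (b.comp ψ.map) (c.comp ψ.map) X Y p := by
    intro X Y
    change η.form (ψ.push X) (ψ.push Y) (ψ.toDiffeo p) = _
    rw [habc.self_of_nhds]
    change _ * (act _ b _ * act _ c _ - act _ c _ * act _ b _) = _
    rw [ψ.act_push, ψ.act_push, ψ.act_push, ψ.act_push]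
    rfl
  -- At p the pull-back is again a multiple of a wedge, hence proportional to η; it is nonzero on X,
  -- Y, so it cannot vanish on a pair where η does not.
  have key := (isAreaLike_wedge (D := D) (b.comp ψ.map) (c.comp ψ.map)).mul_eq_mul
    (isAreaLike_bilin η.alt) X Y E W p
  intro h0
  have h1 : ψ.pull η.form X Y p ≠ 0 := hXY
  rw [hpull] at h0 h1
  refine mul_ne_zero h1 h ?_
  linear_combination a (ψ.toDiffeo p) * key + η.form X Y p * h0

/-- Forms related by an isotopy induce the same orientation. -/
theorem sameOrientation_of_bSymplectomorphic {ω₀ ω₁ : LogSymplecticForm D}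
    (h : BSymplectomorphic ω₀ ω₁) : SameOrientation ω₀ ω₁ := by
  obtain ⟨γ, hγ⟩ := h
  have hoff : ∀ p ∈ D.compl, ∀ E W : BField D, 0 ≤ ω₀.form E W p * ω₁.form E W p := by
    intro p hp E W
    by_cases h1 : ω₁.form E W p = 0
    · rw [h1, mul_zero]
    -- j is continuous, starts at a square and never vanishes, so its value at time 1 is positive.
    set j : ℝ → ℝ := fun t => (γ.at_time t).pull ω₁.form E W p * ω₁.form E W p with hj
    have hjc : Continuous j := by
      refine continuous_iff_continuousAt.2 fun t => ?_
      obtain ⟨V, hV⟩ := γ.exists_isVelocity t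
      exact (γ.hasDerivAt_pull hV ω₁.alt hp E W).continuousAt.mul continuousAt_const
    have hj0 : 0 < j 0 := by
      simp only [hj, (γ.at_time 0).pull_eq_self γ.start]
      exact mul_self_pos.2 h1
    have hjne : ∀ t, j t ≠ 0 := fun t => mul_ne_zero (ω₁.pull_ne_zero _ hp h1) h1
    have hj1 : 0 < j 1 := by
      by_contra! hneg
      obtain ⟨t, -, ht⟩ := intermediate_value_Icc' zero_le_one hjc.continuousOn
        (⟨hneg, hj0.le⟩ : (0 : ℝ) ∈ Set.Icc (j 1) (j 0))
      exact hjne t ht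
    simp only [hj, hγ] at hj1
    exact hj1.le
  -- Only the weak inequality passes to the closure; `form_ne_zero` makes it strict wherever ω₁(E,
  -- W) ≠ 0.
  have hall : ∀ p (E W : BField D), 0 ≤ ω₀.form E W p * ω₁.form E W p := by
    intro p E W
    have hcl : IsClosed {p | 0 ≤ ω₀.form E W p * ω₁.form E W p} :=
      isClosed_le continuous_const ((ω₀.form E W).contMDiff.continuous.mul
        (ω₁.form E W).contMDiff.continuous)
    exact hcl.closure_subset_iff.2 (fun q hq => hoff q hq E W) (D.dense_compl p)
  -- The local quotients ω₀(E, W)/ω₁(E, W) glue by a partition of unity, since the conditions on the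
  -- factor are convex.
  obtain ⟨f, hf⟩ := exists_contMDiffMap_forall_mem_convex_of_local (𝓡 2) (n := ⊤)
    (t := fun p : S => {c : ℝ | 0 < c ∧ ∀ X Y : BField D, ω₀.form X Y p = c * ω₁.form X Y p})
    (fun p => by
      rintro x ⟨hx, hx'⟩ y ⟨hy, hy'⟩ a b ha hb hab
      refine ⟨convex_Ioi (0 : ℝ) hx hy ha hb hab, fun X Y => ?_⟩
      simp only [smul_eq_mul]
      linear_combination a * hx' X Y + b * hy' X Y - ω₀.form X Y p * hab)
    (fun p => by
      obtain ⟨E, W, hEW⟩ := ω₁.exists_ne_zero p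
      refine ⟨{q | ω₁.form E W q ≠ 0}, (ω₁.form E W).contMDiff.continuous.continuousAt.eventually_ne
        hEW, fun q => ω₀.form E W q / ω₁.form E W q, ?_, fun q hq => ⟨?_, fun X Y => ?_⟩⟩
      · intro q hq
        exact ((ω₀.form E W).contMDiff.contMDiffAt.div₀ (ω₁.form E W).contMDiff.contMDiffAt
          hq).contMDiffWithinAt
      · have h1 := hall q E W
        have h2 := mul_ne_zero (ω₀.form_ne_zero ω₁ hq) hq
        have h3 := lt_of_le_of_ne h1 h2.symm
        exact div_pos_iff.2 (mul_pos_iff.1 h3)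
      · have key := (isAreaLike_bilin ω₀.alt).mul_eq_mul (isAreaLike_bilin ω₁.alt) X Y E W q
        have hq' : ω₁.form E W q ≠ 0 := hq
        field_simp
        linear_combination key)
  refine ⟨f, fun p => (hf p).1, ?_⟩
  ext X Y p
  exact (hf p).2 X Y

end Necessity

end StarLog

theorem theorem1p1 {S : Type*} [TopologicalSpace S] [T2Space S] [CompactSpace S]
    [ConnectedSpace S] [ChartedSpace StarLog.Plane S] [IsManifold (𝓡 2) ∞ S]
    (D : StarLog.StarDivisor S) (ω₀ ω₁ : StarLog.LogSymplecticForm D) :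
    StarLog.BSymplectomorphic ω₀ ω₁ ↔
      StarLog.Cohomologous ω₀ ω₁ ∧ StarLog.SameOrientation ω₀ ω₁ := by
  exact ⟨fun h => ⟨StarLog.cohomologous_of_bSymplectomorphic h,
      StarLog.sameOrientation_of_bSymplectomorphic h⟩,
    fun h => StarLog.bSymplectomorphic_of_cohomologous h.1 h.2⟩
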